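/- Let $n\ge 1$, let $\mathbb B^n$ be the open unit ball of $\mathbb C^n$, $\langle z,w\rangle=\sum_j z_j\overline{w_j}$, and let $\sigma$ be the unnormalized surface measure on $\partial\mathbb B^n$ (of total mass $2\pi^n/\Gamma(n)$). A $C^2$ function $f:\mathbb B^n\to\mathbb C$ is called $M$-harmonic if $$4(1-|z|^2)\sum_{j,k=1}^n(\delta_{jk}-z_j\overline{z_k})\frac{\partial^2 f}{\partial z_j\,\partial\overline{z_k}}=0\quad\text{on }\mathbb B^n .$$ The $M$-harmonic Hardy space $H^2$ consists of the $M$-harmonic $f$ with $\sup_{0\le r<1}\int_{\partial\mathbb B^n}|f(r\zeta)|^2\,d\sigma(\zeta)<\infty$; each such $f$ has radial boundary values $f(\zeta)=\lim_{r\nearrow1}f(r\zeta)$, the limit being taken in $L^2(\sigma)$. The $M$-harmonic Szegő kernel $K_{Sz}$ is the function on $\mathbb B^n\times\mathbb B^n$, $M$-harmonic in both variables and with $K_{Sz}(z,\cdot)\in H^2$ for every $z\in\mathbb B^n$, such that $$f(z)=\int_{\partial\mathbb B^n} f(\zeta)\,K_{Sz}(z,\zeta)\,d\sigma(\zeta)\qquad\text{for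 all } f\in H^2,\ z\in\mathbb B^n,$$ where $f(\zeta)$ and $K_{Sz}(z,\zeta)$ denote the radial boundary values of $f$ and $K_{Sz}(z,\cdot)$. **Theorem.** For every $n\ge1$ the kernel $K_{Sz}$ exists, is unique, and for all $z,w\in\mathbb B^n$ $$K_{Sz}(z,w)=\frac{\Gamma(n)}{2\pi^n}\,\frac{(1-|w|^2)^n}{|1-\langle z,w\rangle|^{2n}}\sum_{i_1=0}^n\ \sum_{i_2=0}^{n-i_1}\ \sum_{j_1=0}^{n-i_1}\frac{(-n)_{i_1+i_2}\,(-n)_{i_1+j_1}\,(n)_{i_2}\,(n)_{j_1}}{i_1!\,i_2!\,j_1!\,(n)_{i_1+i_2+j_1}}\;t_1^{i_1}t_2^{i_2}t_3^{j_1}\;{}_2F_1\!\left(i_2+n,\,j_1+n;\;i_1+i_2+j_1+n;\;t_4\right),$$ where $(a)_k=a(a+1)\cdots(a+k-1)$, ${}_2F_1$ is the Gauss hypergeometric function, and $$t_1=|z|^2,\qquad t_2=\frac{|z|^2-\langle w,z\rangle}{1-\langle w,z\rangle},\qquad t_3=\overline{t_2},\qquad t_4=1-\frac{(1-|z|^2)(1-|w|^2)}{|1-\langle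 z,w\rangle|^2}.$$ -/

import Mathlib

open MeasureTheory Filter Topology

noncomputable section

namespace MHarmonic

/-- The complex Euclidean space `ℂⁿ`. -/
abbrev Cn (n : ℕ) : Type := EuclideanSpace ℂ (Fin n)

/-- The open unit ball `𝔹ⁿ` of `ℂⁿ`. -/
abbrev unitBall (n : ℕ) : Set (Cn n) := Metric.ball 0 1

/-- The unit sphere `∂𝔹ⁿ` of `ℂⁿ`. -/
abbrev unitSphere (n : ℕ) : Type := Metric.sphere (0 : Cn n) 1

/-- The Hermitian product `⟨z, w⟩ = ∑ⱼ zⱼ w̄ⱼ`, linear in the first variable. -/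
def herm {n : ℕ} (z w : Cn n) : ℂ := ∑ j, z j * (starRingEnd ℂ) (w j)

/-- The unnormalized surface measure `σ` on the unit sphere, induced by Lebesgue measure on
`ℂⁿ = ℝ²ⁿ`; its total mass is `2πⁿ / Γ(n)`. -/
def sigma (n : ℕ) : Measure (unitSphere n) := (volume : Measure (Cn n)).toSphere

/-- The Wirtinger derivative `∂f/∂zⱼ = ½ (∂f/∂xⱼ - i ∂f/∂yⱼ)`, where `zⱼ = xⱼ + i yⱼ`. -/
def wirtinger {n : ℕ} (j : Fin n) (f : Cn n → ℂ) (z : Cn n) : ℂ :=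
  (1 / 2) * (fderiv ℝ f z (EuclideanSpace.single j 1)
    - Complex.I * fderiv ℝ f z (EuclideanSpace.single j Complex.I))

/-- The conjugate Wirtinger derivative `∂f/∂z̄ⱼ = ½ (∂f/∂xⱼ + i ∂f/∂yⱼ)`. -/
def wirtingerBar {n : ℕ} (j : Fin n) (f : Cn n → ℂ) (z : Cn n) : ℂ :=
  (1 / 2) * (fderiv ℝ f z (EuclideanSpace.single j 1)
    + Complex.I * fderiv ℝ f z (EuclideanSpace.single j Complex.I))

/-- The invariant Laplacian
`4 (1 - |z|²) ∑_{j,k} (δ_{jk} - zⱼ z̄ₖ) ∂²f / ∂zⱼ∂z̄ₖ` of the unit ball. -/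
def invariantLaplacian {n : ℕ} (f : Cn n → ℂ) (z : Cn n) : ℂ :=
  4 * (1 - (‖z‖ : ℂ) ^ 2) * ∑ j, ∑ k,
    ((if j = k then 1 else 0) - z j * (starRingEnd ℂ) (z k)) *
      wirtinger j (wirtingerBar k f) z

/-- `f` is `M`-harmonic on the unit ball: it is `C²` there and annihilated by the invariant
Laplacian. The values of `f` outside the ball play no role. -/
def IsMHarmonic {n : ℕ} (f : Cn n → ℂ) : Prop :=
  ContDiffOn ℝ 2 f (unitBall n) ∧ ∀ z ∈ unitBall n, invariantLaplacian f z = 0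

/-- Membership in the `M`-harmonic Hardy space `H²` of the ball: `f` is `M`-harmonic and its
`L²(σ)`-means over the spheres `|z| = r`, `0 ≤ r < 1`, are bounded. -/
def MemHardy {n : ℕ} (f : Cn n → ℂ) : Prop :=
  IsMHarmonic f ∧ ∃ C : NNReal, ∀ r ∈ Set.Ico (0 : ℝ) 1,
    eLpNorm (fun ζ : unitSphere n => f (r • (ζ : Cn n))) 2 (sigma n) ≤ C

/-- `g ∈ L²(σ)` is the radial boundary value of `f`: `f(r ·) → g` in `L²(σ)` as `r ↗ 1`. -/
def IsRadialBoundaryValue {n : ℕ} (f : Cn n → ℂ) (g : unitSphere n → ℂ) : Prop :=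
  MemLp g 2 (sigma n) ∧
    Tendsto (fun r : ℝ => eLpNorm (fun ζ : unitSphere n => f (r • (ζ : Cn n)) - g ζ) 2 (sigma n))
      (𝓝[<] 1) (𝓝 0)

/-- `K` is an `M`-harmonic Szegő kernel: a function on `𝔹ⁿ × 𝔹ⁿ`, `M`-harmonic in both variables,
with `K(z, ·)` in the Hardy space, which reproduces each `f` in the Hardy space through boundary
values, `f(z) = ∫ f(ζ) K(z, ζ) dσ(ζ)`. -/
structure IsSzegoKernel {n : ℕ} (K : Cn n → Cn n → ℂ) : Prop where
  mHarmonic_left : ∀ w ∈ unitBall n, IsMHarmonic (fun z => K z w)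
  memHardy_right : ∀ z ∈ unitBall n, MemHardy (fun w => K z w)
  reproducing : ∀ f : Cn n → ℂ, MemHardy f →
    ∃ fb : unitSphere n → ℂ, IsRadialBoundaryValue f fb ∧
      ∀ z ∈ unitBall n, ∃ kb : unitSphere n → ℂ, IsRadialBoundaryValue (fun w => K z w) kb ∧
        f z = ∫ ζ, fb ζ * kb ζ ∂(sigma n)

/-- The Pochhammer symbol `(a)ₖ = a (a + 1) ⋯ (a + k - 1)`. -/
def poch (a : ℂ) (k : ℕ) : ℂ := (ascPochhammer ℂ k).eval a

end MHarmonic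

end

/-!
# The `M`-harmonic Szegő kernel of the ball

Write `P(z, ζ) = σ(∂𝔹)⁻¹ (1 - |z|²)ⁿ / |1 - ⟨z, ζ⟩|²ⁿ` for the Poisson–Szegő kernel (`poisson`) and
`P[g]` for the integral of `g` against it (`poissonInt`). The Szegő kernel is
`K(z, w) = ∫ P(z, ζ) P(w, ζ) dσ(ζ)` (`szego`).

*Existence and uniqueness.* All reduces to the fact that the Hardy space consists of the integrals
`P[g]` with `g ∈ L²(σ)`, and that `P[g]` has radial boundary value `g`
(`MemHardy.exists_eq_poissonInt`, `isRadialBoundaryValue_poissonInt`). Indeed `P(z, ·)` is then the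
boundary value of `K(z, ·) = P[P(z, ·)]`, so that the reproducing formula for `K` is the formula
`f = P[g]`; and any other Szegő kernel agrees with `K` since both sides of
`L(z, w) = ∫ L(z, ζ) K(w, ζ) dσ(ζ) = K(w, z)` are instances of the reproducing formula
(`IsSzegoKernel.eq_szego`).

The kernel `P(·, ζ)` is `M`-harmonic by direct computation, and the maximum principle gives
uniqueness in the Dirichlet problem (`IsMHarmonic.eq_poissonInt`). To represent a Hardy function one
considers the operators `T_r g (ζ) = P[g](r ζ)`. Since two points of the sphere are swapped by an
anti-unitary map, `K(rζ, sη) = K(sζ, rη)`, and hence `T_r T_s = T_s T_r` (`poissonInt_comm`).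
Each `T_r`, `r > 0`, is symmetric, and it is injective: if `T_r g = 0`, then `P[g]` vanishes on a
ball by the maximum principle, and everywhere since on a diameter it extends holomorphically to a
disc. So `T_r` has dense range, first in `L²(σ)` and then uniformly in the continuous functions.
Consequently an `M`-harmonic `f` is a locally uniform limit of functions `P[g]`, and its dilations
`f_r(ζ) = f(r ζ)` satisfy `T_s f_r = T_r f_s` (`IsMHarmonic.poissonInt_dilate_comm`). If the `f_r`
are bounded in `L²(σ)`, a weak limit `g` of them as `r → 1` satisfies
`T_s g = lim T_s f_r = lim T_r f_s = f_s`, that is, `f = P[g]`.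

*The formula.* Let `φ` be the automorphism of the ball exchanging `0` and `z`, and `b = φ(w)`. The
change of variables by `φ` (two `M`-harmonic functions with the same boundary values) gives
`K(z, w) = c² (1 - |w|²)ⁿ / |1 - ⟨z, w⟩|²ⁿ ∫ |1 - ⟨z, ζ⟩|²ⁿ |1 - ⟨b, ζ⟩|⁻²ⁿ dσ(ζ)`, with
`c = σ(∂𝔹)⁻¹` (`szego_eq_integral`). Expanding the integrand in a series leaves the moments of
`⟨z, ζ⟩`, `⟨b, ζ⟩` and their conjugates. These come by polarization from
`c ∫ ⟨ζ, y⟩ᴺ ⟨x, ζ⟩ᴺ dσ(ζ) = N! / (n)_N ⟨x, y⟩ᴺ` (`integral_herm_pow`, `choose_mul_moment`), which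
is the Cauchy–Szegő formula for `⟨·, y⟩ᴺ`. Summing over the exponent of `⟨b, b⟩` produces the
hypergeometric functions (`integral_eq_sum_kernelSum`), and `⟨z, z⟩`, `⟨b, z⟩`, `⟨z, b⟩`, `⟨b, b⟩`
are the variables `t₁, t₂, t₃, t₄`.
-/

noncomputable section

namespace MHarmonic

variable {n : ℕ}

/-! ### The Hermitian product -/

theorem herm_eq_inner (z w : Cn n) : herm z w = inner ℂ w z := by
  simp [herm, PiLp.inner_apply]

theorem herm_self (z : Cn n) : herm z z = (‖z‖ : ℂ) ^ 2 := by
  rw [herm_eq_inner, inner_self_eq_norm_sq_to_K]; rfl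

theorem conj_herm (z w : Cn n) : (starRingEnd ℂ) (herm z w) = herm w z := by
  rw [herm_eq_inner, herm_eq_inner, inner_conj_symm]

theorem herm_add_left (x y w : Cn n) : herm (x + y) w = herm x w + herm y w := by
  simp [herm_eq_inner]

theorem herm_sub_left (x y w : Cn n) : herm (x - y) w = herm x w - herm y w := by
  simp [herm_eq_inner]

theorem herm_smul_left (a : ℂ) (x w : Cn n) : herm (a • x) w = a * herm x w := by
  simp [herm_eq_inner]

theorem herm_add_right (x y w : Cn n) : herm x (y + w) = herm x y + herm x w := by
  simp [herm_eq_inner]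

theorem herm_sub_right (x y w : Cn n) : herm x (y - w) = herm x y - herm x w := by
  simp [herm_eq_inner]

theorem herm_smul_right (a : ℂ) (x w : Cn n) :
    herm x (a • w) = (starRingEnd ℂ) a * herm x w := by
  simp [herm_eq_inner, mul_comm]

theorem herm_real_smul_left (r : ℝ) (x w : Cn n) : herm (r • x) w = r * herm x w := by
  rw [← herm_smul_left]; congr 1

theorem herm_real_smul_right (r : ℝ) (x w : Cn n) : herm x (r • w) = r * herm x w := by
  have : r • w = (r : ℂ) • w := rfl
  rw [this, herm_smul_right, Complex.conj_ofReal]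

@[simp] theorem herm_zero_left (w : Cn n) : herm 0 w = 0 := by simp [herm]

@[simp] theorem herm_zero_right (w : Cn n) : herm w 0 = 0 := by simp [herm]

theorem norm_herm_le (z w : Cn n) : ‖herm z w‖ ≤ ‖z‖ * ‖w‖ := by
  rw [herm_eq_inner, mul_comm]; exact norm_inner_le_norm w z

theorem norm_one_sub_herm_comm (z w : Cn n) : ‖1 - herm z w‖ = ‖1 - herm w z‖ := by
  rw [← conj_herm w z, ← RCLike.norm_conj]; simp

theorem continuous_herm : Continuous fun p : Cn n × Cn n => herm p.1 p.2 := by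
  simp only [herm_eq_inner]; fun_prop

@[fun_prop]
theorem _root_.Continuous.herm {X : Type*} [TopologicalSpace X] {f g : X → Cn n}
    (hf : Continuous f) (hg : Continuous g) : Continuous fun x => herm (f x) (g x) :=
  continuous_herm.comp (hf.prodMk hg)

theorem norm_sphere (ζ : unitSphere n) : ‖(ζ : Cn n)‖ = 1 := by simp

theorem norm_real_smul_sphere {r : ℝ} (hr : 0 ≤ r) (ζ : unitSphere n) :
    ‖r • (ζ : Cn n)‖ = r := by
  rw [norm_smul, norm_sphere, mul_one, Real.norm_of_nonneg hr]

theorem one_sub_herm_ne_zero {z w : Cn n} (hz : ‖z‖ < 1) (hw : ‖w‖ ≤ 1) : 1 - herm z w ≠ 0 := by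
  intro h
  have h1 : ‖herm z w‖ = 1 := by rw [← sub_eq_zero.1 h]; simp
  have := norm_herm_le z w
  nlinarith [norm_nonneg z, norm_nonneg w]

/-- Every point of `ℂⁿ` of norm `r` is `r` times a point of the sphere. -/
theorem exists_smul_sphere (hn : 1 ≤ n) (z : Cn n) : ∃ ζ : unitSphere n, ‖z‖ • (ζ : Cn n) = z := by
  by_cases hz : z = 0
  · refine ⟨⟨EuclideanSpace.single ⟨0, hn⟩ 1, by simp⟩, by simp [hz]⟩
  · have : ‖z‖ ≠ 0 := norm_ne_zero_iff.2 hz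
    refine ⟨⟨‖z‖⁻¹ • z, ?_⟩, ?_⟩
    · simp [norm_smul, this]
    · simp [smul_smul, this]

theorem smul_sphere_mem_ball {r : ℝ} (hr : 0 ≤ r) (hr1 : r < 1) (ζ : unitSphere n) :
    r • (ζ : Cn n) ∈ unitBall n := by
  simpa [norm_smul, abs_of_nonneg hr] using hr1

/-! ### Unitary maps -/

/-- The complex Householder-type map moving `x` to `y`: it is `v ↦ v - (⟨v, d⟩ / ⟨x, d⟩) d` with
`d = x - y`. When `‖x‖ = ‖y‖` it is unitary, sends `x` to `y` and fixes `d^⊥`.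
For `x = y` the quotient is `0 / 0 = 0` and the map is the identity. -/
def householder (x y : Cn n) : Cn n →ₗ[ℂ] Cn n where
  toFun v := v - (herm v (x - y) / herm x (x - y)) • (x - y)
  map_add' u v := by rw [herm_add_left, add_div, add_smul]; abel
  map_smul' a v := by
    rw [herm_smul_left, RingHom.id_apply, smul_sub a v, smul_smul, mul_div_assoc]

theorem householder_apply (x y v : Cn n) :
    householder x y v = v - (herm v (x - y) / herm x (x - y)) • (x - y) := rfl

theorem herm_sub_self_ne_zero {x y : Cn n} (h : ‖x‖ = ‖y‖) (hxy : x ≠ y) :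
    herm x (x - y) ≠ 0 := by
  intro h0
  have h1 : herm (x - y) (x - y) = herm x (x - y) + (starRingEnd ℂ) (herm x (x - y)) := by
    rw [conj_herm]
    rw [herm_sub_left x y (x - y), herm_sub_right x x y, herm_sub_right y x y,
      herm_sub_left x y x, herm_self, herm_self, h]; ring
  rw [h0, herm_self] at h1
  simp [sub_eq_zero, hxy] at h1

theorem householder_self {x y : Cn n} (h : ‖x‖ = ‖y‖) : householder x y x = y := by
  by_cases hxy : x = y
  · simp [householder_apply, hxy]
  · rw [householder_apply, div_self (herm_sub_self_ne_zero h hxy)]; simp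

theorem householder_of_herm_eq {x y v : Cn n} (h : herm v x = herm v y) :
    householder x y v = v := by
  simp [householder_apply, herm_sub_right, h]

theorem herm_householder {x y : Cn n} (h : ‖x‖ = ‖y‖) (u v : Cn n) :
    herm (householder x y u) (householder x y v) = herm u v := by
  by_cases hxy : x = y
  · simp [householder_apply, hxy]
  have h0 := herm_sub_self_ne_zero h hxy
  have h0' : herm (x - y) x ≠ 0 := by rw [← conj_herm]; simpa using h0
  have h1 : herm (x - y) (x - y) = herm x (x - y) + herm (x - y) x := by
    rw [herm_sub_left x y (x - y), herm_sub_right x x y, herm_sub_right y x y,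
      herm_sub_left x y x, herm_self, herm_self, h]; ring
  simp only [householder_apply]
  generalize x - y = d at *
  rw [herm_sub_left, herm_sub_right, herm_sub_right, herm_smul_left, herm_smul_left,
    herm_smul_right, herm_smul_right, h1, map_div₀, conj_herm, conj_herm]
  field_simp
  ring

/-- The unitary map of `ℂⁿ` given by `householder x y` for vectors of equal norm. -/
def householderIsometry {x y : Cn n} (h : ‖x‖ = ‖y‖) : Cn n ≃ₗᵢ[ℂ] Cn n :=
  LinearIsometry.toLinearIsometryEquiv
    { householder x y with
      norm_map' := fun v => by
        have := herm_householder h v v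
        rw [herm_self, herm_self] at this
        have h2 : ‖householder x y v‖ ^ 2 = ‖v‖ ^ 2 := by exact_mod_cast this
        exact (sq_eq_sq₀ (norm_nonneg _) (norm_nonneg _)).1 h2 } rfl

theorem herm_isometry (U : Cn n ≃ₗᵢ[ℂ] Cn n) (z w : Cn n) : herm (U z) (U w) = herm z w := by
  simp [herm_eq_inner]

/-- Coordinatewise complex conjugation, a real-linear isometry of `ℂⁿ`. -/
def conjIsometry (n : ℕ) : Cn n ≃ₗᵢ[ℝ] Cn n :=
  LinearIsometryEquiv.piLpCongrRight 2 fun _ => Complex.conjLIE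

theorem herm_conjIsometry (z w : Cn n) :
    herm (conjIsometry n z) (conjIsometry n w) = herm w z := by
  rw [← conj_herm z w]
  simp [herm, conjIsometry]

/-- Any two points on the sphere are swapped by an isometry under which the Hermitian product is
conjugated. -/
theorem exists_swap (ζ η : unitSphere n) :
    ∃ J : Cn n ≃ₗᵢ[ℝ] Cn n, (∀ z w, herm (J z) (J w) = herm w z) ∧ J ζ = η ∧ J η = ζ := by
  set a := conjIsometry n ζ
  set b := conjIsometry n η
  have ha : ‖a‖ = ‖(η : Cn n)‖ := by simp [a, (conjIsometry n).norm_map]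
  set U := householderIsometry ha
  have hUa : U a = η := householder_self ha
  have hb : ‖U b‖ = ‖(ζ : Cn n)‖ := by
    rw [U.norm_map]; simp [b, (conjIsometry n).norm_map]
  set V := householderIsometry hb
  have hVb : V (U b) = ζ := householder_self hb
  have hVa : V η = η := by
    refine householder_of_herm_eq ?_
    calc herm (η : Cn n) (U b) = herm (U a) (U b) := by rw [hUa]
      _ = herm a b := herm_isometry U a b
      _ = herm (η : Cn n) ζ := herm_conjIsometry _ _
  refine ⟨(conjIsometry n).trans
    (LinearIsometryEquiv.trans { U.toLinearEquiv.restrictScalars ℝ with norm_map' := U.norm_map }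
      { V.toLinearEquiv.restrictScalars ℝ with norm_map' := V.norm_map }), ?_, ?_, ?_⟩
  · intro z w
    change herm (V (U (conjIsometry n z))) (V (U (conjIsometry n w))) = _
    rw [herm_isometry, herm_isometry, herm_conjIsometry]
  · change V (U a) = η
    rw [hUa, hVa]
  · exact hVb

/-! ### The surface measure -/

/-- The action of an isometry on the sphere. -/
def sphereMap (J : Cn n ≃ₗᵢ[ℝ] Cn n) (ζ : unitSphere n) : unitSphere n :=
  ⟨J ζ, by simp [J.norm_map]⟩

@[simp] theorem coe_sphereMap (J : Cn n ≃ₗᵢ[ℝ] Cn n) (ζ : unitSphere n) :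
    (sphereMap J ζ : Cn n) = J ζ := rfl

theorem continuous_sphereMap (J : Cn n ≃ₗᵢ[ℝ] Cn n) : Continuous (sphereMap J) :=
  (J.continuous.comp continuous_subtype_val).subtype_mk _

open scoped Pointwise in
theorem measurePreserving_sphereMap (J : Cn n ≃ₗᵢ[ℝ] Cn n) :
    MeasurePreserving (sphereMap J) (sigma n) (sigma n) := by
  refine ⟨(continuous_sphereMap J).measurable, ?_⟩
  ext s hs
  rw [Measure.map_apply (continuous_sphereMap J).measurable hs, sigma,
    Measure.toSphere_apply' _ ((continuous_sphereMap J).measurable hs),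
    Measure.toSphere_apply' _ hs]
  congr 1
  rw [← J.measurePreserving.measure_preimage_emb J.toHomeomorph.measurableEmbedding
    (Set.Ioo 0 1 • Subtype.val '' s)]
  congr 1
  ext x
  constructor
  · rintro ⟨r, hr, _, ⟨ζ, hζ, rfl⟩, rfl⟩
    exact ⟨r, hr, _, ⟨sphereMap J ζ, hζ, rfl⟩, by simp⟩
  · rintro ⟨r, hr, _, ⟨ζ, hζ, rfl⟩, h⟩
    refine ⟨r, hr, _, ⟨sphereMap J.symm ζ, ?_, rfl⟩, ?_⟩
    · have : sphereMap J (sphereMap J.symm ζ) = ζ := by ext1; simp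
      rwa [Set.mem_preimage, this]
    · apply J.injective
      simpa using h

theorem integral_sphereMap (J : Cn n ≃ₗᵢ[ℝ] Cn n) (f : unitSphere n → ℂ) :
    ∫ ζ, f (sphereMap J ζ) ∂(sigma n) = ∫ ζ, f ζ ∂(sigma n) := by
  refine (measurePreserving_sphereMap J).integral_comp ?_ f
  refine MeasurableEquiv.measurableEmbedding (Homeomorph.toMeasurableEquiv
    { toFun := sphereMap J, invFun := sphereMap J.symm, left_inv := ?_, right_inv := ?_,
      continuous_toFun := continuous_sphereMap J,
      continuous_invFun := continuous_sphereMap J.symm })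
  · intro ζ; ext1; simp
  · intro ζ; ext1; simp

instance : IsFiniteMeasure (sigma n) := by unfold sigma; infer_instance

instance : (sigma n).IsOpenPosMeasure := by unfold sigma; infer_instance

/-- The reciprocal of the total mass of the sphere. -/
def massInv (n : ℕ) : ℝ := Real.Gamma n / (2 * Real.pi ^ n)

theorem massInv_pos (hn : 1 ≤ n) : 0 < massInv n := by
  unfold massInv
  have : 0 < Real.Gamma n := Real.Gamma_pos_of_pos (by exact_mod_cast hn)
  positivity

theorem massInv_mul_sigma (hn : 1 ≤ n) : massInv n * (sigma n).real Set.univ = 1 := by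
  have : Nonempty (Fin n) := ⟨⟨0, hn⟩⟩
  have hd : Module.finrank ℝ (Cn n) = 2 * n := by
    rw [← Module.finrank_mul_finrank ℝ ℂ (Cn n)]; simp
  rw [sigma, Measure.toSphere_real_apply_univ, Measure.real, InnerProductSpace.volume_ball, hd]
  have hG : 0 < Real.Gamma n := Real.Gamma_pos_of_pos (by exact_mod_cast hn)
  have hn0 : (0 : ℝ) < n := by exact_mod_cast hn
  have h1 : Real.Gamma (((2 * n : ℕ) : ℝ) / 2 + 1) = n * Real.Gamma n := by
    rw [← Real.Gamma_add_one hn0.ne']; congr 2; push_cast; ring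
  have h2 : Real.sqrt Real.pi ^ (2 * n) = Real.pi ^ n := by
    rw [pow_mul, Real.sq_sqrt Real.pi_pos.le]
  rw [h1, h2]
  simp only [ENNReal.ofReal_one, one_pow, one_mul]
  rw [ENNReal.toReal_ofReal (by positivity), massInv]
  push_cast
  field_simp

/-! ### Second-order calculus for the invariant Laplacian -/

section Levi

variable {E : Type*} [NormedAddCommGroup E] [NormedSpace ℂ E] [NormedSpace ℝ E]

/-- The sesquilinear form `∑ uⱼ v̄ₖ 4 ∂ⱼ∂̄ₖ f`, expressed through a real bilinear form `D`
(in applications, the second derivative of `f`). -/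
def leviForm (D : Cn n →L[ℝ] Cn n →L[ℝ] E) (u v : Cn n) : E :=
  D u v + D (Complex.I • u) (Complex.I • v) +
    Complex.I • (D u (Complex.I • v) - D (Complex.I • u) v)

theorem leviForm_add_left (D : Cn n →L[ℝ] Cn n →L[ℝ] E) (u u' v : Cn n) :
    leviForm D (u + u') v = leviForm D u v + leviForm D u' v := by
  simp only [leviForm, smul_add, map_add, add_apply]; module

theorem leviForm_add_right (D : Cn n →L[ℝ] Cn n →L[ℝ] E) (u v v' : Cn n) :
    leviForm D u (v + v') = leviForm D u v + leviForm D u v' := by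
  simp only [leviForm, smul_add, map_add]; module

theorem leviForm_self (D : Cn n →L[ℝ] Cn n →L[ℝ] E) (hD : ∀ u v, D u v = D v u) (v : Cn n) :
    leviForm D v v = D v v + D (Complex.I • v) (Complex.I • v) := by
  simp [leviForm, hD v (Complex.I • v)]

theorem leviForm_sum_left {ι : Type*} (s : Finset ι) (D : Cn n →L[ℝ] Cn n →L[ℝ] E)
    (u : ι → Cn n) (v : Cn n) : leviForm D (∑ i ∈ s, u i) v = ∑ i ∈ s, leviForm D (u i) v := by
  classical
  induction s using Finset.induction_on with
  | empty => simp [leviForm]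
  | insert a s ha ih => rw [Finset.sum_insert ha, Finset.sum_insert ha, leviForm_add_left, ih]

theorem leviForm_sum_right {ι : Type*} (s : Finset ι) (D : Cn n →L[ℝ] Cn n →L[ℝ] E)
    (u : Cn n) (v : ι → Cn n) : leviForm D u (∑ i ∈ s, v i) = ∑ i ∈ s, leviForm D u (v i) := by
  classical
  induction s using Finset.induction_on with
  | empty => simp [leviForm]
  | insert a s ha ih => rw [Finset.sum_insert ha, Finset.sum_insert ha, leviForm_add_right, ih]

theorem complex_smul_eq {F : Type*} [AddCommGroup F] [Module ℂ F] [Module ℝ F]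
    [IsScalarTower ℝ ℂ F] (a : ℂ) (u : F) : a • u = a.re • u + a.im • (Complex.I • u) := by
  conv_lhs => rw [← Complex.re_add_im a, add_smul, mul_smul]
  congr 1
  · exact algebraMap_smul ℂ a.re u
  · exact algebraMap_smul ℂ a.im (Complex.I • u)

variable [IsScalarTower ℝ ℂ E]

theorem leviForm_smul_left (D : Cn n →L[ℝ] Cn n →L[ℝ] E) (a : ℂ) (u v : Cn n) :
    leviForm D (a • u) v = a • leviForm D u v := by
  have h2 : Complex.I • a • u = a.re • (Complex.I • u) + a.im • (-u) := by
    rw [smul_comm, complex_smul_eq a (Complex.I • u), smul_smul Complex.I Complex.I u]; simp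
  rw [complex_smul_eq a (leviForm D u v)]
  simp only [leviForm]
  rw [h2, complex_smul_eq a u]
  simp only [map_add, map_smul, map_neg, add_apply,
    smul_apply, neg_apply, smul_add, smul_sub]
  simp only [smul_smul Complex.I Complex.I, Complex.I_mul_I, smul_comm Complex.I (_ : ℝ)]
  module

theorem leviForm_smul_right (D : Cn n →L[ℝ] Cn n →L[ℝ] E) (a : ℂ) (u v : Cn n) :
    leviForm D u (a • v) = (starRingEnd ℂ) a • leviForm D u v := by
  have h2 : Complex.I • a • v = a.re • (Complex.I • v) + a.im • (-v) := by
    rw [smul_comm, complex_smul_eq a (Complex.I • v), smul_smul Complex.I Complex.I v]; simp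
  rw [complex_smul_eq ((starRingEnd ℂ) a) (leviForm D u v)]
  simp only [leviForm]
  rw [h2, complex_smul_eq a v]
  simp only [map_add, map_smul, map_neg, smul_add, smul_sub, Complex.conj_re, Complex.conj_im]
  simp only [smul_smul Complex.I Complex.I, Complex.I_mul_I, smul_comm Complex.I (_ : ℝ)]
  module

/-- The trace of the Levi form of `D` against the matrix `δⱼₖ - zⱼ z̄ₖ`. -/
def leviTrace (z : Cn n) (D : Cn n →L[ℝ] Cn n →L[ℝ] E) : E :=
  (∑ j : Fin n, leviForm D (EuclideanSpace.single j 1) (EuclideanSpace.single j 1)) -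
    leviForm D z z

theorem sum_single_smul (z : Cn n) :
    ∑ j, z j • (EuclideanSpace.single j (1 : ℂ) : Cn n) = z := by
  ext i
  simp [Pi.single_apply]

theorem leviTrace_eq_sum (z : Cn n) (D : Cn n →L[ℝ] Cn n →L[ℝ] E) :
    leviTrace z D = ∑ j, ∑ k, (((if j = k then 1 else 0) : ℂ) - z j * (starRingEnd ℂ) (z k)) •
      leviForm D (EuclideanSpace.single j 1) (EuclideanSpace.single k 1) := by
  have h : leviForm D z z = ∑ j, ∑ k, (z j * (starRingEnd ℂ) (z k)) •
      leviForm D (EuclideanSpace.single j 1) (EuclideanSpace.single k 1) := by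
    conv_lhs => rw [← sum_single_smul z]
    rw [leviForm_sum_left]
    refine Finset.sum_congr rfl fun j _ => ?_
    rw [leviForm_sum_right]
    refine Finset.sum_congr rfl fun k _ => ?_
    rw [leviForm_smul_left, leviForm_smul_right, smul_smul]
  simp only [sub_smul, Finset.sum_sub_distrib]
  rw [leviTrace, h]
  simp

/-- The trace as a sum of diagonal values of the Levi form: the vectors `eₘ - z̄ₘ z / (1 + s)`,
`s = √(1 - |z|²)`, are the columns of the positive square root of `δⱼₖ - zⱼ z̄ₖ`. -/
theorem leviTrace_eq_sum_sqrt (z : Cn n) (hz : ‖z‖ < 1) (D : Cn n →L[ℝ] Cn n →L[ℝ] E) :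
    ∃ v : Fin n → Cn n, leviTrace z D = ∑ m, leviForm D (v m) (v m) := by
  set s := Real.sqrt (1 - ‖z‖ ^ 2)
  have hs : s ^ 2 = 1 - ‖z‖ ^ 2 := Real.sq_sqrt (by nlinarith [norm_nonneg z])
  have hs0 : 0 ≤ s := Real.sqrt_nonneg _
  set c : ℂ := ((1 / (1 + s) : ℝ) : ℂ)
  have hc : 2 * c - c ^ 2 * (‖z‖ : ℂ) ^ 2 = 1 := by
    have : 2 * (1 / (1 + s)) - (1 / (1 + s)) ^ 2 * ‖z‖ ^ 2 = 1 := by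
      have h1 : 1 + s ≠ 0 := by positivity
      have h2 : ‖z‖ ^ 2 = 1 - s ^ 2 := by linarith
      rw [h2]
      field_simp
      ring
    simpa [c] using congrArg (fun x : ℝ => (x : ℂ)) this
  refine ⟨fun m => EuclideanSpace.single m 1 + (-(c * (starRingEnd ℂ) (z m))) • z, ?_⟩
  have hsum : ∑ m, z m * (starRingEnd ℂ) (z m) = (‖z‖ : ℂ) ^ 2 := herm_self z
  have hcc : (starRingEnd ℂ) c = c := Complex.conj_ofReal _
  have h1 : ∑ m, z m • leviForm D (EuclideanSpace.single m 1) z = leviForm D z z := by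
    conv_rhs => rw [← sum_single_smul z, leviForm_sum_left]
    refine Finset.sum_congr rfl fun m _ => ?_
    rw [leviForm_smul_left, sum_single_smul]
  have h2 : ∑ m, (starRingEnd ℂ) (z m) • leviForm D z (EuclideanSpace.single m 1) =
      leviForm D z z := by
    conv_rhs => rw [← sum_single_smul z, leviForm_sum_right]
    refine Finset.sum_congr rfl fun m _ => ?_
    rw [leviForm_smul_right, sum_single_smul]
  have h3 : ∀ m, leviForm D (EuclideanSpace.single m 1 + (-(c * (starRingEnd ℂ) (z m))) • z)
      (EuclideanSpace.single m 1 + (-(c * (starRingEnd ℂ) (z m))) • z) =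
      leviForm D (EuclideanSpace.single m 1) (EuclideanSpace.single m 1)
        - c • (z m • leviForm D (EuclideanSpace.single m 1) z)
        - c • ((starRingEnd ℂ) (z m) • leviForm D z (EuclideanSpace.single m 1))
        + (c ^ 2 * (z m * (starRingEnd ℂ) (z m))) • leviForm D z z := by
    intro m
    simp only [leviForm_add_left, leviForm_add_right, leviForm_smul_left, leviForm_smul_right,
      map_neg, map_mul, hcc, Complex.conj_conj]
    module
  simp only [h3, Finset.sum_add_distrib, Finset.sum_sub_distrib, ← Finset.smul_sum, h1, h2,
    ← Finset.sum_smul, ← Finset.mul_sum, hsum]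
  have : (c ^ 2 * (‖z‖ : ℂ) ^ 2) = 2 * c - 1 := by rw [← hc]; ring
  rw [this, leviTrace]
  module

end Levi

/-- The second derivative of a function on `ℂⁿ`. -/
abbrev hess {E : Type*} [NormedAddCommGroup E] [NormedSpace ℝ E] (f : Cn n → E) (z : Cn n) :
    Cn n →L[ℝ] Cn n →L[ℝ] E := fderiv ℝ (fderiv ℝ f) z

theorem _root_.ContDiffAt.differentiableAt_fderiv_two {E : Type*} [NormedAddCommGroup E]
    [NormedSpace ℝ E] {f : Cn n → E} {z : Cn n}
    (hf : ContDiffAt ℝ 2 f z) : DifferentiableAt ℝ (fderiv ℝ f) z :=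
  (hf.fderiv_right (m := 1) (by norm_num)).differentiableAt (by norm_num)

theorem wirtinger_wirtingerBar {f : Cn n → ℂ} {z : Cn n} (hf : ContDiffAt ℝ 2 f z) (j k : Fin n) :
    wirtinger j (wirtingerBar k f) z =
      4⁻¹ * leviForm (hess f z) (EuclideanSpace.single j 1) (EuclideanSpace.single k 1) := by
  have hd := hf.differentiableAt_fderiv_two.hasFDerivAt
  have h1 : HasFDerivAt (wirtingerBar k f)
      ((1 / 2 : ℂ) • ((hess f z).flip (EuclideanSpace.single k 1) +
        Complex.I • (hess f z).flip (EuclideanSpace.single k Complex.I))) z := by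
    have := ((hd.clm_apply (hasFDerivAt_const (EuclideanSpace.single k (1 : ℂ)) z)).add
      ((hd.clm_apply (hasFDerivAt_const
        (EuclideanSpace.single k Complex.I) z)).const_smul Complex.I)).const_smul (1 / 2 : ℂ)
    refine this.congr_fderiv ?_
    ext v
    simp
  have hI : ∀ j : Fin n, (EuclideanSpace.single j Complex.I : Cn n) =
      Complex.I • EuclideanSpace.single j 1 := by
    intro j; ext i; simp
  rw [wirtinger, h1.fderiv]
  simp only [leviForm, hI, smul_apply, add_apply,
    ContinuousLinearMap.flip_apply, smul_eq_mul]
  linear_combination (-(1 / 4 : ℂ) * (hess f z) (Complex.I • EuclideanSpace.single j 1)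
    (Complex.I • EuclideanSpace.single k 1)) * Complex.I_mul_I

theorem invariantLaplacian_eq {f : Cn n → ℂ} {z : Cn n} (hf : ContDiffAt ℝ 2 f z) :
    invariantLaplacian f z = (1 - (‖z‖ : ℂ) ^ 2) * leviTrace z (hess f z) := by
  rw [invariantLaplacian, leviTrace_eq_sum]
  simp only [wirtinger_wirtingerBar hf, Finset.mul_sum, smul_eq_mul]
  refine Finset.sum_congr rfl fun j _ => Finset.sum_congr rfl fun k _ => ?_
  ring

theorem contDiffAt_of_ball {E : Type*} [NormedAddCommGroup E] [NormedSpace ℝ E] {f : Cn n → E}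
    (hf : ContDiffOn ℝ 2 f (unitBall n)) {z : Cn n} (hz : z ∈ unitBall n) : ContDiffAt ℝ 2 f z :=
  hf.contDiffAt (Metric.isOpen_ball.mem_nhds hz)

theorem one_sub_normSq_ne_zero {z : Cn n} (hz : z ∈ unitBall n) : (1 - (‖z‖ : ℂ) ^ 2) ≠ 0 := by
  have h : ‖z‖ < 1 := by simpa using hz
  have : (1 - ‖z‖ ^ 2 : ℝ) ≠ 0 := by nlinarith [norm_nonneg z]
  exact_mod_cast this

theorem isMHarmonic_iff {f : Cn n → ℂ} : IsMHarmonic f ↔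
    ContDiffOn ℝ 2 f (unitBall n) ∧ ∀ z ∈ unitBall n, leviTrace z (hess f z) = 0 := by
  refine and_congr_right fun hf => forall₂_congr fun z hz => ?_
  rw [invariantLaplacian_eq (contDiffAt_of_ball hf hz), mul_eq_zero,
    or_iff_right (one_sub_normSq_ne_zero hz)]

theorem hess_clm_comp {E F : Type*} [NormedAddCommGroup E] [NormedAddCommGroup F]
    [NormedSpace ℝ F] [NormedSpace ℝ E] (L : E →L[ℝ] F) {Φ : Cn n → E}
    (hΦ : ContDiffOn ℝ 2 Φ (unitBall n)) {z : Cn n} (hz : z ∈ unitBall n) (u v : Cn n) :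
    hess (fun w => L (Φ w)) z u v = L (hess Φ z u v) := by
  have h1 : fderiv ℝ (fun w => L (Φ w)) =ᶠ[𝓝 z]
      fun w => (ContinuousLinearMap.compL ℝ (Cn n) E F L) (fderiv ℝ Φ w) := by
    filter_upwards [Metric.isOpen_ball.mem_nhds hz] with w hw
    exact (L.hasFDerivAt.comp w
      ((contDiffAt_of_ball hΦ hw).differentiableAt (by norm_num)).hasFDerivAt).fderiv
  rw [hess, h1.fderiv_eq]
  have h2 := ((ContinuousLinearMap.compL ℝ (Cn n) E F L).hasFDerivAt.comp z
    (contDiffAt_of_ball hΦ hz).differentiableAt_fderiv_two.hasFDerivAt).fderiv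
  rw [Function.comp_def] at h2
  rw [h2]
  rfl

section Comp

variable {E : Type*} [NormedAddCommGroup E] [NormedSpace ℂ E] [NormedSpace ℝ E]
  [IsScalarTower ℝ ℂ E]

theorem leviTrace_hess_clm_comp (L : E →L[ℂ] ℂ) {Φ : Cn n → E}
    (hΦ : ContDiffOn ℝ 2 Φ (unitBall n)) {z : Cn n} (hz : z ∈ unitBall n) :
    leviTrace z (hess (fun w => L (Φ w)) z) = L (leviTrace z (hess Φ z)) := by
  have h : ∀ u v, leviForm (hess (fun w => L (Φ w)) z) u v = L (leviForm (hess Φ z) u v) := by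
    intro u v
    have h0 := hess_clm_comp (L.restrictScalars ℝ) hΦ hz
    simp only [ContinuousLinearMap.coe_restrictScalars'] at h0
    simp only [leviForm, h0, map_add, map_sub, map_smul]
  simp only [leviTrace, h, map_sub, map_sum]

/-- Applying a continuous functional to a family of functions that is `M`-harmonic pointwise gives
an `M`-harmonic function. -/
theorem isMHarmonic_functional {X : Type*} [TopologicalSpace X] [CompactSpace X]
    {Φ : Cn n → C(X, ℂ)} (hΦ : ContDiffOn ℝ 2 Φ (unitBall n))
    (hpt : ∀ x, IsMHarmonic fun z => Φ z x) (L : C(X, ℂ) →L[ℂ] ℂ) :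
    IsMHarmonic fun z => L (Φ z) := by
  rw [isMHarmonic_iff]
  refine ⟨(L.restrictScalars ℝ).contDiff.comp_contDiffOn hΦ, fun z hz => ?_⟩
  rw [leviTrace_hess_clm_comp L hΦ hz]
  suffices h : leviTrace z (hess Φ z) = 0 by rw [h, map_zero]
  ext x
  have h1 := leviTrace_hess_clm_comp (ContinuousMap.evalCLM ℂ x) hΦ hz
  have h2 := (isMHarmonic_iff.1 (hpt x)).2 z hz
  exact h1.symm.trans h2

end Comp

theorem isMHarmonic_const (c : ℂ) : IsMHarmonic fun _ : Cn n => c := by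
  rw [isMHarmonic_iff]
  refine ⟨contDiffOn_const, fun z _ => ?_⟩
  simp [hess, leviTrace, leviForm]

theorem hess_add {f g : Cn n → ℂ} {z : Cn n} (hf : ContDiffOn ℝ 2 f (unitBall n))
    (hg : ContDiffOn ℝ 2 g (unitBall n)) (hz : z ∈ unitBall n) :
    hess (fun w => f w + g w) z = hess f z + hess g z := by
  have h1 : fderiv ℝ (fun w => f w + g w) =ᶠ[𝓝 z] fun w => fderiv ℝ f w + fderiv ℝ g w := by
    filter_upwards [Metric.isOpen_ball.mem_nhds hz] with w hw
    exact fderiv_fun_add ((contDiffAt_of_ball hf hw).differentiableAt (by norm_num))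
      ((contDiffAt_of_ball hg hw).differentiableAt (by norm_num))
  rw [hess, h1.fderiv_eq]
  exact fderiv_fun_add (contDiffAt_of_ball hf hz).differentiableAt_fderiv_two
    (contDiffAt_of_ball hg hz).differentiableAt_fderiv_two

theorem leviTrace_add (z : Cn n) (D D' : Cn n →L[ℝ] Cn n →L[ℝ] ℂ) :
    leviTrace z (D + D') = leviTrace z D + leviTrace z D' := by
  have h : ∀ u v, leviForm (D + D') u v = leviForm D u v + leviForm D' u v := by
    intro u v; simp only [leviForm, add_apply, smul_eq_mul]; ring
  simp only [leviTrace, h, Finset.sum_add_distrib]; ring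

theorem IsMHarmonic.const_mul {f : Cn n → ℂ} (hf : IsMHarmonic f) (c : ℂ) :
    IsMHarmonic fun z => c * f z := by
  rw [isMHarmonic_iff] at hf ⊢
  refine ⟨contDiffOn_const.mul hf.1, fun z hz => ?_⟩
  have := leviTrace_hess_clm_comp (c • ContinuousLinearMap.id ℂ ℂ) hf.1 hz
  simpa [hf.2 z hz] using this

theorem IsMHarmonic.add {f g : Cn n → ℂ} (hf : IsMHarmonic f) (hg : IsMHarmonic g) :
    IsMHarmonic fun z => f z + g z := by
  rw [isMHarmonic_iff] at hf hg ⊢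
  refine ⟨hf.1.add hg.1, fun z hz => ?_⟩
  rw [hess_add hf.1 hg.1 hz, leviTrace_add, hf.2 z hz, hg.2 z hz, add_zero]

theorem IsMHarmonic.sub {f g : Cn n → ℂ} (hf : IsMHarmonic f) (hg : IsMHarmonic g) :
    IsMHarmonic fun z => f z - g z := by
  simpa [sub_eq_add_neg] using hf.add (hg.const_mul (-1))

/-- Holomorphic functions are `M`-harmonic. -/
theorem isMHarmonic_of_contDiff_complex {f : Cn n → ℂ} (hf : ContDiff ℂ 2 f) : IsMHarmonic f := by
  refine ⟨(hf.restrict_scalars ℝ).contDiffOn, fun z _ => ?_⟩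
  have h : ∀ k, wirtingerBar k f = fun _ => 0 := by
    intro k
    ext w
    have hd : DifferentiableAt ℂ f w := hf.contDiffAt.differentiableAt (by norm_num)
    have hI : (EuclideanSpace.single k Complex.I : Cn n) =
        Complex.I • EuclideanSpace.single k 1 := by
      ext i; simp
    rw [wirtingerBar, hd.fderiv_restrictScalars ℝ, ContinuousLinearMap.coe_restrictScalars', hI,
      map_smul, smul_eq_mul, ← mul_assoc, Complex.I_mul_I]
    ring
  simp [invariantLaplacian, h, wirtinger]

/-! ### Wirtinger derivatives of explicit functions -/

/-- The real-linear map `v ↦ ∑ pⱼ vⱼ + ∑ qⱼ v̄ⱼ`. -/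
def wirtL (p q : Fin n → ℂ) : Cn n →L[ℝ] ℂ :=
  ∑ j, (p j • (EuclideanSpace.proj (𝕜 := ℂ) j : Cn n →L[ℂ] ℂ).restrictScalars ℝ +
    q j • (Complex.conjCLE : ℂ →L[ℝ] ℂ).comp
      ((EuclideanSpace.proj (𝕜 := ℂ) j : Cn n →L[ℂ] ℂ).restrictScalars ℝ))

theorem wirtL_apply (p q : Fin n → ℂ) (v : Cn n) :
    wirtL p q v = ∑ j, (p j * v j + q j * (starRingEnd ℂ) (v j)) := by
  simp [wirtL]

/-- `f` is real differentiable at `z` with Wirtinger derivatives `∂ⱼf = pⱼ`, `∂̄ⱼf = qⱼ`. -/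
def HasWirtinger (f : Cn n → ℂ) (p q : Fin n → ℂ) (z : Cn n) : Prop :=
  HasFDerivAt f (wirtL p q) z

namespace HasWirtinger

variable {f g : Cn n → ℂ} {p q p' q' : Fin n → ℂ} {z : Cn n}

theorem wirtinger_eq (h : HasWirtinger f p q z) (j : Fin n) : wirtinger j f z = p j := by
  have h1 : wirtL p q (EuclideanSpace.single j 1) = p j + q j := by
    simp [wirtL_apply, Finset.sum_add_distrib]
  have h2 : wirtL p q (EuclideanSpace.single j Complex.I) = (p j - q j) * Complex.I := by
    simp [wirtL_apply, Finset.sum_add_distrib, apply_ite (starRingEnd ℂ)]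
    ring
  rw [wirtinger, h.fderiv, h1, h2]
  linear_combination (-(1 / 2 : ℂ) * (p j - q j)) * Complex.I_mul_I

theorem wirtingerBar_eq (h : HasWirtinger f p q z) (j : Fin n) : wirtingerBar j f z = q j := by
  have h1 : wirtL p q (EuclideanSpace.single j 1) = p j + q j := by
    simp [wirtL_apply, Finset.sum_add_distrib]
  have h2 : wirtL p q (EuclideanSpace.single j Complex.I) = (p j - q j) * Complex.I := by
    simp [wirtL_apply, Finset.sum_add_distrib, apply_ite (starRingEnd ℂ)]
    ring
  rw [wirtingerBar, h.fderiv, h1, h2]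
  linear_combination ((1 / 2 : ℂ) * (p j - q j)) * Complex.I_mul_I

theorem congr (h : HasWirtinger f p q z) (hp : ∀ j, p j = p' j) (hq : ∀ j, q j = q' j) :
    HasWirtinger f p' q' z := by
  rw [← funext hp, ← funext hq]; exact h

theorem of_hasFDerivAt {L : Cn n →L[ℝ] ℂ} (h : HasFDerivAt f L z)
    (hL : ∀ v, L v = wirtL p q v) : HasWirtinger f p q z := by
  have : L = wirtL p q := ContinuousLinearMap.ext hL
  rwa [HasWirtinger, ← this]

theorem const_sub (c : ℂ) (h : HasWirtinger f p q z) :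
    HasWirtinger (fun w => c - f w) (fun j => -p j) (fun j => -q j) z := by
  refine of_hasFDerivAt (HasFDerivAt.const_sub h c) fun v => ?_
  simp only [neg_apply, wirtL_apply, ← Finset.sum_neg_distrib]
  exact Finset.sum_congr rfl fun j _ => by ring

theorem sub (h : HasWirtinger f p q z) (h' : HasWirtinger g p' q' z) :
    HasWirtinger (fun w => f w - g w) (fun j => p j - p' j) (fun j => q j - q' j) z := by
  refine of_hasFDerivAt (HasFDerivAt.sub h h') fun v => ?_
  simp only [sub_apply, wirtL_apply, ← Finset.sum_sub_distrib]
  exact Finset.sum_congr rfl fun j _ => by ring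

theorem mul (h : HasWirtinger f p q z) (h' : HasWirtinger g p' q' z) :
    HasWirtinger (fun w => f w * g w) (fun j => f z * p' j + g z * p j)
      (fun j => f z * q' j + g z * q j) z := by
  refine of_hasFDerivAt (HasFDerivAt.mul h h') fun v => ?_
  simp only [add_apply, smul_apply, wirtL_apply, smul_eq_mul, Finset.mul_sum,
    ← Finset.sum_add_distrib]
  exact Finset.sum_congr rfl fun j _ => by ring

theorem const_mul (c : ℂ) (h : HasWirtinger f p q z) :
    HasWirtinger (fun w => c * f w) (fun j => c * p j) (fun j => c * q j) z := by
  refine of_hasFDerivAt (HasFDerivAt.const_mul h c) fun v => ?_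
  simp only [smul_apply, wirtL_apply, smul_eq_mul, Finset.mul_sum]
  exact Finset.sum_congr rfl fun j _ => by ring

theorem comp_hasDerivAt {φ : ℂ → ℂ} {d : ℂ} (h : HasWirtinger f p q z)
    (hφ : HasDerivAt φ d (f z)) :
    HasWirtinger (fun w => φ (f w)) (fun j => d * p j) (fun j => d * q j) z := by
  refine of_hasFDerivAt ((hφ.hasFDerivAt.restrictScalars ℝ).comp z h) fun v => ?_
  simp only [wirtL_apply, ContinuousLinearMap.comp_apply,
    ContinuousLinearMap.coe_restrictScalars', ContinuousLinearMap.toSpanSingleton_apply,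
    smul_eq_mul, Finset.sum_mul]
  exact Finset.sum_congr rfl fun j _ => by ring

theorem inv (h : HasWirtinger f p q z) (h0 : f z ≠ 0) :
    HasWirtinger (fun w => (f w)⁻¹) (fun j => -(f z ^ 2)⁻¹ * p j) (fun j => -(f z ^ 2)⁻¹ * q j) z :=
  h.comp_hasDerivAt (hasDerivAt_inv h0)

theorem pow (h : HasWirtinger f p q z) (h0 : f z ≠ 0) (m : ℕ) :
    HasWirtinger (fun w => f w ^ m) (fun j => m * f z ^ m * ((f z)⁻¹ * p j))
      (fun j => m * f z ^ m * ((f z)⁻¹ * q j)) z := by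
  refine (h.comp_hasDerivAt (hasDerivAt_pow m (f z))).congr ?_ ?_ <;>
  · intro j
    cases m with
    | zero => simp
    | succ m => rw [Nat.add_sub_cancel]; field_simp; ring_nf

end HasWirtinger

theorem hasWirtinger_herm_left (y z : Cn n) :
    HasWirtinger (fun w => herm w y) (fun j => (starRingEnd ℂ) (y j)) (fun _ => 0) z := by
  have h : (fun w : Cn n => herm w y) = wirtL (fun j => (starRingEnd ℂ) (y j)) (fun _ => 0) := by
    ext w; simp [wirtL_apply, herm, mul_comm]
  rw [h]
  exact (wirtL _ _).hasFDerivAt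

theorem hasWirtinger_herm_right (y z : Cn n) :
    HasWirtinger (fun w => herm y w) (fun _ => 0) (fun j => y j) z := by
  have h : (fun w : Cn n => herm y w) = wirtL (fun _ => 0) (fun j => y j) := by
    ext w; simp [wirtL_apply, herm]
  rw [h]
  exact (wirtL _ _).hasFDerivAt

theorem hasWirtinger_coord (k : Fin n) (z : Cn n) :
    HasWirtinger (fun w => w k) (fun j => if j = k then 1 else 0) (fun _ => 0) z := by
  have h : (fun w : Cn n => w k) = wirtL (fun j => if j = k then 1 else 0) (fun _ => 0) := by
    ext w; simp [wirtL_apply]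
  rw [h]
  exact (wirtL _ _).hasFDerivAt

theorem hasWirtinger_herm_self (z : Cn n) :
    HasWirtinger (fun w => herm w w) (fun j => (starRingEnd ℂ) (z j)) (fun j => z j) z := by
  have h : HasFDerivAt (fun w : Cn n => ∑ k, w k * (starRingEnd ℂ) (w k))
      (∑ k, (z k • (Complex.conjCLE : ℂ →L[ℝ] ℂ).comp
          ((EuclideanSpace.proj (𝕜 := ℂ) k : Cn n →L[ℂ] ℂ).restrictScalars ℝ) +
        (starRingEnd ℂ) (z k) •
          (EuclideanSpace.proj (𝕜 := ℂ) k : Cn n →L[ℂ] ℂ).restrictScalars ℝ)) z := by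
    refine HasFDerivAt.fun_sum fun k _ => HasFDerivAt.mul ?_ ?_
    · exact ((EuclideanSpace.proj (𝕜 := ℂ) k : Cn n →L[ℂ] ℂ).restrictScalars ℝ).hasFDerivAt
    · exact ((Complex.conjCLE : ℂ →L[ℝ] ℂ).comp
        ((EuclideanSpace.proj (𝕜 := ℂ) k : Cn n →L[ℂ] ℂ).restrictScalars ℝ)).hasFDerivAt
  refine HasWirtinger.of_hasFDerivAt h fun v => ?_
  simp [wirtL_apply, add_comm]

/-! ### The Poisson–Szegő kernel is `M`-harmonic -/

/-- The Poisson–Szegő kernel of the ball, `(1 - |z|²)ⁿ / |1 - ⟨z, ζ⟩|²ⁿ` divided by the area of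
the sphere. -/
def poisson (z ζ : Cn n) : ℝ := massInv n * ((1 - ‖z‖ ^ 2) ^ n / ‖1 - herm z ζ‖ ^ (2 * n))

theorem normSq_one_sub_herm (z ζ : Cn n) :
    ((‖1 - herm z ζ‖ : ℝ) : ℂ) ^ 2 = (1 - herm z ζ) * (1 - herm ζ z) := by
  rw [← Complex.mul_conj', map_sub, map_one, conj_herm]

theorem poisson_eq (z ζ : Cn n) : (poisson z ζ : ℂ) = massInv n *
    ((1 - herm z z) ^ n * (((1 - herm z ζ) ^ n)⁻¹ * ((1 - herm ζ z) ^ n)⁻¹)) := by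
  rw [poisson]
  push_cast
  rw [pow_mul, normSq_one_sub_herm, herm_self, mul_pow, div_eq_mul_inv, mul_inv]

theorem contDiff_herm_left (y : Cn n) : ContDiff ℝ 2 fun w : Cn n => herm w y := by
  have h : (fun w : Cn n => herm w y) = wirtL (fun j => (starRingEnd ℂ) (y j)) (fun _ => 0) := by
    ext w; simp [wirtL_apply, herm, mul_comm]
  rw [h]; exact (wirtL _ _).contDiff

theorem contDiff_herm_right (y : Cn n) : ContDiff ℝ 2 fun w : Cn n => herm y w := by
  have h : (fun w : Cn n => herm y w) = wirtL (fun _ => 0) (fun j => y j) := by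
    ext w; simp [wirtL_apply, herm]
  rw [h]; exact (wirtL _ _).contDiff

theorem contDiff_herm_self : ContDiff ℝ 2 fun w : Cn n => herm w w := by
  have h : (fun w : Cn n => herm w w) = fun w => Complex.ofRealCLM (‖w‖ ^ 2) := by
    ext w; simp [herm_self]
  rw [h]
  exact Complex.ofRealCLM.contDiff.comp (contDiff_norm_sq ℝ)

/-- The Wirtinger derivatives of the Poisson–Szegő kernel in its first variable; they are given by
logarithmic differentiation. -/
theorem hasWirtinger_poisson {z : Cn n} (hz : z ∈ unitBall n) (ζ : unitSphere n) :
    HasWirtinger (fun w => (poisson w (ζ : Cn n) : ℂ))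
      (fun j => n * poisson z (ζ : Cn n) *
        ((starRingEnd ℂ) ((ζ : Cn n) j) * (1 - herm z ζ)⁻¹ -
          (starRingEnd ℂ) (z j) * (1 - herm z z)⁻¹))
      (fun j => n * poisson z (ζ : Cn n) *
        ((ζ : Cn n) j * (1 - herm ζ z)⁻¹ - z j * (1 - herm z z)⁻¹)) z := by
  have hz' : ‖z‖ < 1 := by simpa using hz
  have hA : 1 - herm z z ≠ 0 := by rw [herm_self]; exact one_sub_normSq_ne_zero hz
  have ha : 1 - herm z ζ ≠ 0 := one_sub_herm_ne_zero hz' (norm_sphere ζ).le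
  have hb : 1 - herm (ζ : Cn n) z ≠ 0 := by
    intro h; apply ha
    have := congrArg (starRingEnd ℂ) h
    simpa [conj_herm] using this
  simp only [poisson_eq]
  have hA' := ((hasWirtinger_herm_self z).const_sub 1).pow hA n
  have ha' := (((hasWirtinger_herm_left (ζ : Cn n) z).const_sub 1).pow ha n).inv (pow_ne_zero n ha)
  have hb' := (((hasWirtinger_herm_right (ζ : Cn n) z).const_sub 1).pow hb n).inv
    (pow_ne_zero n hb)
  refine ((hA'.mul (ha'.mul hb')).const_mul (massInv n : ℂ)).congr (fun j => ?_) (fun j => ?_)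
  · field_simp
    ring
  · field_simp
    ring

theorem isMHarmonic_poisson (ζ : unitSphere n) :
    IsMHarmonic fun z => (poisson z (ζ : Cn n) : ℂ) := by
  constructor
  · simp only [poisson_eq]
    intro z hz
    have hz' : ‖z‖ < 1 := by simpa using hz
    have ha : 1 - herm z ζ ≠ 0 := one_sub_herm_ne_zero hz' (norm_sphere ζ).le
    have hb : 1 - herm (ζ : Cn n) z ≠ 0 := by
      intro h; apply ha
      have := congrArg (starRingEnd ℂ) h
      simpa [conj_herm] using this
    apply ContDiffAt.contDiffWithinAt
    have h1 := (contDiff_const (c := (1 : ℂ))).sub (contDiff_herm_self (n := n))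
    have h2 := (contDiff_const (c := (1 : ℂ))).sub (contDiff_herm_left (ζ : Cn n))
    have h3 := (contDiff_const (c := (1 : ℂ))).sub (contDiff_herm_right (ζ : Cn n))
    exact contDiffAt_const.mul ((h1.pow n).contDiffAt.mul
      (((h2.pow n).contDiffAt.inv (pow_ne_zero n ha)).mul
        ((h3.pow n).contDiffAt.inv (pow_ne_zero n hb))))
  · intro z hz
    have hz' : ‖z‖ < 1 := by simpa using hz
    have hA : 1 - herm z z ≠ 0 := by rw [herm_self]; exact one_sub_normSq_ne_zero hz
    have ha : 1 - herm z ζ ≠ 0 := one_sub_herm_ne_zero hz' (norm_sphere ζ).le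
    have hb : 1 - herm (ζ : Cn n) z ≠ 0 := by
      intro h; apply ha
      have := congrArg (starRingEnd ℂ) h
      simpa [conj_herm] using this
    set P : ℂ := (poisson z (ζ : Cn n) : ℂ)
    set A := 1 - herm z z with hAd
    set a := 1 - herm z ζ with had
    set b := 1 - herm (ζ : Cn n) z with hbd
    have key : ∀ j k, wirtinger j (wirtingerBar k fun w => (poisson w (ζ : Cn n) : ℂ)) z =
        n * P * (n * (((starRingEnd ℂ) ((ζ : Cn n) j) * a⁻¹ - (starRingEnd ℂ) (z j) * A⁻¹) *
          ((ζ : Cn n) k * b⁻¹ - z k * A⁻¹)) - ((if j = k then 1 else 0) * A⁻¹ +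
            z k * (starRingEnd ℂ) (z j) * (A ^ 2)⁻¹)) := by
      intro j k
      have h1 : wirtingerBar k (fun w => (poisson w (ζ : Cn n) : ℂ)) =ᶠ[𝓝 z] fun w =>
          n * poisson w (ζ : Cn n) *
            ((ζ : Cn n) k * (1 - herm (ζ : Cn n) w)⁻¹ - w k * (1 - herm w w)⁻¹) := by
        filter_upwards [Metric.isOpen_ball.mem_nhds hz] with w hw
        exact (hasWirtinger_poisson hw ζ).wirtingerBar_eq k
      have h2 := ((hasWirtinger_poisson hz ζ).const_mul (n : ℂ)).mul
        ((((((hasWirtinger_herm_right (ζ : Cn n) z).const_sub 1).inv hb).const_mul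
          ((ζ : Cn n) k))).sub ((hasWirtinger_coord k z).mul
            (((hasWirtinger_herm_self z).const_sub 1).inv hA)))
      rw [wirtinger, h1.fderiv_eq, ← wirtinger, h2.wirtinger_eq]
      simp only [← hAd, ← had, ← hbd]
      split_ifs <;> · simp only [P]; field_simp; ring_nf
    have s1 : ∑ j, z j * (starRingEnd ℂ) (z j) = 1 - A := by rw [hAd]; simp [herm]
    have s2 : ∑ j, z j * (starRingEnd ℂ) ((ζ : Cn n) j) = 1 - a := by rw [had]; simp [herm]
    have s3 : ∑ j, (ζ : Cn n) j * (starRingEnd ℂ) (z j) = 1 - b := by rw [hbd]; simp [herm]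
    have s4 : ∑ j, (ζ : Cn n) j * (starRingEnd ℂ) ((ζ : Cn n) j) = 1 := by
      have := herm_self (ζ : Cn n)
      rw [norm_sphere] at this
      simpa [herm] using this
    set u : Fin n → ℂ := fun k => (ζ : Cn n) k * b⁻¹ - z k * A⁻¹
    set v : Fin n → ℂ := fun j =>
      (starRingEnd ℂ) ((ζ : Cn n) j) * a⁻¹ - (starRingEnd ℂ) (z j) * A⁻¹
    have t1 : ∑ j, v j * u j = (A ^ 2)⁻¹ * (1 - A) - (1 - b) * (A⁻¹ * b⁻¹) -
        (1 - a) * (A⁻¹ * a⁻¹) + a⁻¹ * b⁻¹ := by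
      rw [← s1, ← s2, ← s3, ← mul_one (a⁻¹ * b⁻¹), ← s4]
      simp only [Finset.mul_sum, Finset.sum_mul, ← Finset.sum_add_distrib,
        ← Finset.sum_sub_distrib]
      refine Finset.sum_congr rfl fun j _ => ?_
      simp only [u, v]; ring_nf
    have t2 : ∑ j, z j * v j = (1 - a) * a⁻¹ - (1 - A) * A⁻¹ := by
      rw [← s1, ← s2]
      simp only [Finset.sum_mul, ← Finset.sum_sub_distrib]
      refine Finset.sum_congr rfl fun j _ => ?_
      simp only [v]; ring
    have t3 : ∑ j, (starRingEnd ℂ) (z j) * u j = (1 - b) * b⁻¹ - (1 - A) * A⁻¹ := by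
      rw [← s1, ← s3]
      simp only [Finset.sum_mul, ← Finset.sum_sub_distrib]
      refine Finset.sum_congr rfl fun j _ => ?_
      simp only [u]; ring
    have hsum : ∑ j, ∑ k, ((if j = k then 1 else 0) - z j * (starRingEnd ℂ) (z k)) *
        wirtinger j (wirtingerBar k fun w => (poisson w (ζ : Cn n) : ℂ)) z =
        n * P * (n * (∑ j, v j * u j - (∑ j, z j * v j) * ∑ k, (starRingEnd ℂ) (z k) * u k) -
          ((n - ∑ j, z j * (starRingEnd ℂ) (z j)) * A⁻¹ +
            (∑ j, z j * (starRingEnd ℂ) (z j) - (∑ j, z j * (starRingEnd ℂ) (z j)) *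
              ∑ k, z k * (starRingEnd ℂ) (z k)) * (A ^ 2)⁻¹)) := by
      simp only [key]
      have e1 : ∀ j k, ((if j = k then 1 else 0) - z j * (starRingEnd ℂ) (z k)) *
          (n * P * (n * (v j * u k) - ((if j = k then 1 else 0) * A⁻¹ +
            z k * (starRingEnd ℂ) (z j) * (A ^ 2)⁻¹))) =
          (if j = k then n * P * (n * (v j * u j) - (A⁻¹ - z j * (starRingEnd ℂ) (z j) * A⁻¹ +
            z j * (starRingEnd ℂ) (z j) * (A ^ 2)⁻¹)) else 0) -
          n * P * (n * ((z j * v j) * ((starRingEnd ℂ) (z k) * u k)) -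
            (z j * (starRingEnd ℂ) (z j)) * (z k * (starRingEnd ℂ) (z k)) * (A ^ 2)⁻¹) := by
        intro j k
        split_ifs with h
        · subst h; ring
        · ring
      simp only [v, u] at e1 ⊢
      simp only [e1, Finset.sum_sub_distrib, Finset.sum_ite_eq, Finset.mem_univ, if_true,
        ← Finset.mul_sum, Finset.sum_add_distrib, ← Finset.sum_mul]
      simp only [Finset.sum_const, Finset.card_univ, Fintype.card_fin, nsmul_eq_mul]
      ring
    rw [invariantLaplacian, hsum, t1, t2, t3, s1]
    field_simp
    ring

/-! ### The maximum principle -/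

theorem deriv_deriv_nonpos_of_isLocalMax {g : ℝ → ℝ} {t : ℝ} (h : IsLocalMax g t)
    (hc : ContinuousAt g t) : deriv (deriv g) t ≤ 0 := by
  by_contra! hpos
  have hmin := isLocalMin_of_deriv_deriv_pos hpos h.deriv_eq_zero hc
  have heq : g =ᶠ[𝓝 t] fun _ => g t := by
    filter_upwards [h, hmin] with s h1 h2
    exact le_antisymm h1 h2
  have h1 : deriv g =ᶠ[𝓝 t] fun _ => 0 := by
    filter_upwards [heq.eventuallyEq_nhds] with s hs
    rw [hs.deriv_eq, deriv_const]
  rw [h1.deriv_eq, deriv_const] at hpos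
  exact lt_irrefl _ hpos

theorem hess_re_nonpos_of_isLocalMax {f : Cn n → ℂ} (hf : ContDiffOn ℝ 2 f (unitBall n))
    {z : Cn n} (hz : z ∈ unitBall n) (hmax : IsLocalMax (fun w => (f w).re) z) (v : Cn n) :
    (hess f z v v).re ≤ 0 := by
  set ℓ : ℝ → Cn n := fun t => z + t • v
  have hℓ0 : ℓ 0 = z := by simp [ℓ]
  have hℓ : ∀ t, HasDerivAt ℓ v t := fun t => by
    have := ((hasDerivAt_id t).smul_const v).const_add z
    rwa [one_smul] at this
  have hℓc : ContinuousAt ℓ 0 := (hℓ 0).continuousAt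
  have hball : ∀ᶠ t in 𝓝 (0 : ℝ), ℓ t ∈ unitBall n :=
    hℓc.eventually_mem (by rw [hℓ0]; exact Metric.isOpen_ball.mem_nhds hz)
  have h1 : ∀ t, ℓ t ∈ unitBall n →
      HasDerivAt (fun t => (f (ℓ t)).re) (fderiv ℝ f (ℓ t) v).re t := by
    intro t ht
    have hd := ((contDiffAt_of_ball hf ht).differentiableAt (by norm_num)).hasFDerivAt
    exact (Complex.reCLM.hasFDerivAt.comp_hasDerivAt t (hd.comp_hasDerivAt t (hℓ t)))
  have h2 : HasDerivAt (fun t => (fderiv ℝ f (ℓ t) v).re) (hess f z v v).re 0 := by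
    have hd := (contDiffAt_of_ball hf hz).differentiableAt_fderiv_two.hasFDerivAt
    rw [← hℓ0] at hd
    have h3 := hd.comp_hasDerivAt 0 (hℓ 0)
    have h4 := h3.clm_apply (hasDerivAt_const 0 v)
    have h5 := Complex.reCLM.hasFDerivAt.comp_hasDerivAt (0 : ℝ) h4
    refine h5.congr_deriv ?_
    simp [hℓ0]
  have h3 : deriv (deriv fun t => (f (ℓ t)).re) 0 = (hess f z v v).re := by
    have : deriv (fun t => (f (ℓ t)).re) =ᶠ[𝓝 0] fun t => (fderiv ℝ f (ℓ t) v).re := by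
      filter_upwards [hball] with t ht
      exact (h1 t ht).deriv
    rw [this.deriv_eq, h2.deriv]
  rw [← h3]
  refine deriv_deriv_nonpos_of_isLocalMax ?_ (h1 0 (by rwa [hℓ0])).continuousAt
  have := hℓc.tendsto
  rw [hℓ0] at this
  have h4 := this.eventually hmax
  simpa [IsLocalMax, IsMaxFilter, hℓ0] using h4

theorem leviTrace_hess_re_nonpos_of_isLocalMax {f : Cn n → ℂ}
    (hf : ContDiffOn ℝ 2 f (unitBall n)) {z : Cn n} (hz : z ∈ unitBall n)
    (hmax : IsLocalMax (fun w => (f w).re) z) : (leviTrace z (hess f z)).re ≤ 0 := by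
  obtain ⟨v, hv⟩ := leviTrace_eq_sum_sqrt z (by simpa using hz) (hess f z)
  have hsymm : ∀ u v, hess f z u v = hess f z v u :=
    (contDiffAt_of_ball hf hz).isSymmSndFDerivAt (by simp)
  rw [hv, Complex.re_sum]
  refine Finset.sum_nonpos fun m _ => ?_
  rw [leviForm_self _ hsymm, Complex.add_re]
  exact add_nonpos (hess_re_nonpos_of_isLocalMax hf hz hmax _)
    (hess_re_nonpos_of_isLocalMax hf hz hmax _)

theorem leviTrace_hess_herm_self (z : Cn n) :
    leviTrace z (hess (fun w => herm w w) z) = 4 * (n - (‖z‖ : ℂ) ^ 2) := by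
  have h : ∀ j k, leviForm (hess (fun w : Cn n => herm w w) z) (EuclideanSpace.single j 1)
      (EuclideanSpace.single k 1) = 4 * if j = k then 1 else 0 := by
    intro j k
    have h1 := wirtinger_wirtingerBar (contDiff_herm_self.contDiffAt (x := z)) j k
    have h2 : wirtingerBar k (fun w : Cn n => herm w w) = fun w => w k := by
      ext w; exact (hasWirtinger_herm_self w).wirtingerBar_eq k
    rw [h2, (hasWirtinger_coord k z).wirtinger_eq] at h1
    rw [h1]; ring
  rw [leviTrace_eq_sum]
  simp only [h, smul_eq_mul]
  have e : ∀ j k, ((if j = k then 1 else 0) - z j * (starRingEnd ℂ) (z k)) *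
      (4 * if j = k then 1 else 0) =
      if j = k then 4 * (1 - z j * (starRingEnd ℂ) (z j)) else 0 := by
    intro j k; split_ifs with h
    · subst h; ring
    · ring
  simp only [e, Finset.sum_ite_eq, Finset.mem_univ, if_true, ← Finset.mul_sum,
    Finset.sum_sub_distrib]
  have : ∑ j, z j * (starRingEnd ℂ) (z j) = (‖z‖ : ℂ) ^ 2 := herm_self z
  rw [this]; simp

/-- The maximum principle: an `M`-harmonic function on a closed ball of radius `R < 1` is bounded
by its maximum over the boundary. It is perturbed by `ε |z|²`, on which the invariant Laplacian is
positive. -/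
theorem IsMHarmonic.norm_le_of_sphere (hn : 1 ≤ n) {f : Cn n → ℂ} (hf : IsMHarmonic f) {R M : ℝ}
    (hR : R < 1) (hM : ∀ z : Cn n, ‖z‖ = R → ‖f z‖ ≤ M) {z : Cn n} (hz : ‖z‖ ≤ R) :
    ‖f z‖ ≤ M := by
  by_contra! hlt
  obtain ⟨c, hc1, hc⟩ : ∃ c : ℂ, ‖c‖ = 1 ∧ c * f z = ‖f z‖ := by
    by_cases h0 : f z = 0
    · exact ⟨1, by simp, by simp [h0]⟩
    · have h1 : (‖f z‖ : ℂ) ≠ 0 := by exact_mod_cast norm_ne_zero_iff.2 h0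
      refine ⟨(starRingEnd ℂ) (f z) / ‖f z‖, ?_, ?_⟩
      · simp [h0]
      · rw [div_mul_eq_mul_div, mul_comm, Complex.mul_conj']
        field_simp
  set ε : ℝ := (‖f z‖ - M) / 2
  have hε : 0 < ε := by simp only [ε]; linarith
  set F : Cn n → ℂ := fun w => c * f w + ε * herm w w
  have hF : ContDiffOn ℝ 2 F (unitBall n) :=
    (contDiffOn_const.mul hf.1).add (contDiff_const.mul contDiff_herm_self).contDiffOn
  have hR0 : 0 ≤ R := (norm_nonneg z).trans hz
  have hsub : Metric.closedBall (0 : Cn n) R ⊆ unitBall n := by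
    intro w hw
    simp only [Metric.mem_closedBall, dist_zero_right, Metric.mem_ball] at hw ⊢
    linarith
  have hFre : ∀ w, (F w).re = (c * f w).re + ε * ‖w‖ ^ 2 := by
    intro w
    simp only [F, herm_self, Complex.add_re]
    congr 1
    rw [← Complex.ofReal_pow, ← Complex.ofReal_mul, Complex.ofReal_re]
  obtain ⟨p, hp, hpmax⟩ := (isCompact_closedBall (0 : Cn n) R).exists_isMaxOn
    ⟨z, by simpa using hz⟩ (Complex.continuous_re.comp_continuousOn (hF.continuousOn.mono hsub))
  have hp' : ‖p‖ ≤ R := by simpa using hp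
  have hpz : (F z).re ≤ (F p).re := hpmax (by simpa using hz)
  have hpR : ‖p‖ ≠ R := by
    intro hpR
    have h1 : (c * f p).re ≤ M := by
      refine (Complex.re_le_norm _).trans ?_
      rw [norm_mul, hc1, one_mul]
      exact hM p hpR
    rw [hFre, hFre, hc, Complex.ofReal_re] at hpz
    have h2 : ε * ‖p‖ ^ 2 ≤ ε := by
      have : ‖p‖ ^ 2 ≤ 1 := by nlinarith [norm_nonneg p]
      nlinarith
    have h3 : 0 ≤ ε * ‖z‖ ^ 2 := by positivity
    simp only [ε] at *
    linarith
  have hpb : p ∈ unitBall n := hsub hp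
  have hloc : IsLocalMax (fun w => (F w).re) p := by
    have : Metric.closedBall (0 : Cn n) R ∈ 𝓝 p := by
      refine mem_of_superset (Metric.isOpen_ball.mem_nhds ?_) Metric.ball_subset_closedBall
      simpa using lt_of_le_of_ne hp' hpR
    exact hpmax.isLocalMax this
  have h1 := leviTrace_hess_re_nonpos_of_isLocalMax hF hpb hloc
  have h2 : leviTrace p (hess F p) = ε * (4 * (n - (‖p‖ : ℂ) ^ 2)) := by
    have hb : ContDiffOn ℝ 2 (fun w : Cn n => (ε : ℂ) * herm w w) (unitBall n) :=
      (contDiff_const.mul contDiff_herm_self).contDiffOn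
    have h4 := leviTrace_hess_clm_comp ((ε : ℂ) • ContinuousLinearMap.id ℂ ℂ)
      (contDiff_herm_self (n := n)).contDiffOn hpb
    simp only [smul_apply, ContinuousLinearMap.id_apply, smul_eq_mul] at h4
    rw [hess_add (hf.const_mul c).1 hb hpb, leviTrace_add,
      (isMHarmonic_iff.1 (hf.const_mul c)).2 p hpb, zero_add, h4, leviTrace_hess_herm_self]
  have h3 : (leviTrace p (hess F p)).re = ε * (4 * (n - ‖p‖ ^ 2)) := by
    rw [h2]; norm_cast
  rw [h3] at h1
  have h5 : ‖p‖ ^ 2 < 1 := by nlinarith [norm_nonneg p]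
  have h6 : (1 : ℝ) ≤ n := by exact_mod_cast hn
  nlinarith [mul_pos hε (by linarith : (0 : ℝ) < n - ‖p‖ ^ 2)]

/-- An `M`-harmonic function tending uniformly to `0` at the boundary vanishes. -/
theorem IsMHarmonic.eq_zero_of_boundary (hn : 1 ≤ n) {f : Cn n → ℂ} (hf : IsMHarmonic f)
    (h : ∀ ε > 0, ∃ δ < (1 : ℝ), ∀ z : Cn n, δ < ‖z‖ → ‖z‖ < 1 → ‖f z‖ ≤ ε) {z : Cn n}
    (hz : z ∈ unitBall n) : f z = 0 := by
  have hz' : ‖z‖ < 1 := by simpa using hz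
  refine norm_le_zero_iff.1 (le_of_forall_pos_le_add fun ε hε => ?_)
  obtain ⟨δ, hδ, H⟩ := h ε hε
  obtain ⟨R, hR1, hR2⟩ := exists_between (max_lt hδ hz')
  rw [zero_add]
  refine hf.norm_le_of_sphere hn hR2 (fun w hw => H w ?_ ?_) ((le_max_right δ ‖z‖).trans hR1.le)
  · rw [hw]; exact (le_max_left _ _).trans_lt hR1
  · rwa [hw]

/-! ### Poisson integrals -/

theorem _root_.ContinuousMap.ringInverse_apply {X : Type*} [TopologicalSpace X]
    {u : C(X, ℂ)} (hu : IsUnit u) (x : X) : Ring.inverse u x = (u x)⁻¹ := by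
  have h : Ring.inverse u * u = 1 := Ring.inverse_mul_cancel u hu
  have h1 : Ring.inverse u x * u x = 1 := congrArg (fun f : C(X, ℂ) => f x) h
  exact eq_inv_of_mul_eq_one_left h1

/-- The function `ζ ↦ ⟨z, ζ⟩` on the sphere, complex linear in `z`. -/
def hermMap (n : ℕ) : Cn n →L[ℂ] C(unitSphere n, ℂ) :=
  LinearMap.toContinuousLinearMap
    { toFun := fun z => ⟨fun ζ => herm z ζ, by fun_prop⟩
      map_add' := fun z w => by ext ζ; exact herm_add_left z w ζ
      map_smul' := fun a z => by ext ζ; exact herm_smul_left a z ζ }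

@[simp] theorem hermMap_apply (z : Cn n) (ζ : unitSphere n) : hermMap n z ζ = herm z ζ := rfl

/-- The function `ζ ↦ ⟨ζ, z⟩` on the sphere, real linear in `z`. -/
def hermMapBar (n : ℕ) : Cn n →L[ℝ] C(unitSphere n, ℂ) :=
  LinearMap.toContinuousLinearMap
    { toFun := fun z => ⟨fun ζ => herm ζ z, by fun_prop⟩
      map_add' := fun z w => by ext ζ; exact herm_add_right ζ z w
      map_smul' := fun a z => by ext ζ; simpa using herm_real_smul_right a ζ z }

@[simp] theorem hermMapBar_apply (z : Cn n) (ζ : unitSphere n) :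
    hermMapBar n z ζ = herm ζ z := rfl

theorem norm_hermMap_le (z : Cn n) : ‖hermMap n z‖ ≤ ‖z‖ := by
  refine (ContinuousMap.norm_le _ (norm_nonneg z)).2 fun ζ => ?_
  simpa using norm_herm_le z (ζ : Cn n)

theorem norm_hermMapBar_le (z : Cn n) : ‖hermMapBar n z‖ ≤ ‖z‖ := by
  refine (ContinuousMap.norm_le _ (norm_nonneg z)).2 fun ζ => ?_
  simpa using norm_herm_le (ζ : Cn n) z

theorem isUnit_one_sub_of_norm_lt {u : C(unitSphere n, ℂ)} (hu : ‖u‖ < 1) : IsUnit (1 - u) := by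
  rw [ContinuousMap.isUnit_iff_forall_ne_zero]
  intro ζ h
  have h1 : u ζ = 1 := by
    have : (1 : ℂ) - u ζ = 0 := h
    exact (sub_eq_zero.1 this).symm
  have h2 := u.norm_coe_le_norm ζ
  rw [h1, norm_one] at h2
  linarith

/-- The Poisson–Szegő kernel with pole variable on the sphere, as a function with values in the
Banach algebra of continuous functions on the sphere. -/
def poissonMap (z : Cn n) : C(unitSphere n, ℂ) :=
  ((massInv n : ℂ) * (1 - herm z z) ^ n) •
    (Ring.inverse (1 - hermMap n z) ^ n * Ring.inverse (1 - hermMapBar n z) ^ n)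

theorem norm_lt_one_of_mem {z : Cn n} (hz : z ∈ unitBall n) : ‖z‖ < 1 := by simpa using hz

theorem poissonMap_apply {z : Cn n} (hz : z ∈ unitBall n) (ζ : unitSphere n) :
    poissonMap z ζ = poisson z (ζ : Cn n) := by
  have hz' := norm_lt_one_of_mem hz
  rw [poisson_eq, poissonMap]
  simp only [ContinuousMap.smul_apply, ContinuousMap.mul_apply, ContinuousMap.pow_apply,
    ContinuousMap.ringInverse_apply (isUnit_one_sub_of_norm_lt ((norm_hermMap_le z).trans_lt hz')),
    ContinuousMap.ringInverse_apply
      (isUnit_one_sub_of_norm_lt ((norm_hermMapBar_le z).trans_lt hz')),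
    ContinuousMap.sub_apply, ContinuousMap.one_apply, hermMap_apply, hermMapBar_apply, inv_pow,
    smul_eq_mul, mul_assoc]

theorem contDiffOn_poissonMap : ContDiffOn ℝ 2 (poissonMap (n := n)) (unitBall n) := by
  intro z hz
  have hz' := norm_lt_one_of_mem hz
  apply ContDiffAt.contDiffWithinAt
  have h0 : ContDiff ℝ 2 fun w : Cn n => (massInv n : ℂ) * (1 - herm w w) ^ n :=
    contDiff_const.mul ((contDiff_const.sub contDiff_herm_self).pow n)
  have h1 : ContDiffAt ℝ 2 (fun w : Cn n => Ring.inverse (1 - hermMap n w)) z := by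
    obtain ⟨x, hx⟩ := isUnit_one_sub_of_norm_lt ((norm_hermMap_le z).trans_lt hz')
    have h := contDiffAt_ringInverse ℝ (n := 2) x
    rw [hx] at h
    exact h.comp z (contDiffAt_const.sub
      ((hermMap n).restrictScalars ℝ).contDiff.contDiffAt)
  have h2 : ContDiffAt ℝ 2 (fun w : Cn n => Ring.inverse (1 - hermMapBar n w)) z := by
    obtain ⟨x, hx⟩ := isUnit_one_sub_of_norm_lt ((norm_hermMapBar_le z).trans_lt hz')
    have h := contDiffAt_ringInverse ℝ (n := 2) x
    rw [hx] at h
    exact h.comp z (contDiffAt_const.sub (hermMapBar n).contDiff.contDiffAt)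
  exact h0.contDiffAt.smul ((h1.pow n).mul (h2.pow n))

theorem continuousOn_poissonMap : ContinuousOn (poissonMap (n := n)) (unitBall n) :=
  contDiffOn_poissonMap.continuousOn

theorem isMHarmonic_poissonMap_apply (ζ : unitSphere n) :
    IsMHarmonic fun z => poissonMap z ζ := by
  have h := isMHarmonic_poisson ζ
  rw [isMHarmonic_iff] at h ⊢
  refine ⟨h.1.congr fun z hz => poissonMap_apply hz ζ, fun z hz => ?_⟩
  rw [← h.2 z hz]
  have h1 : (fun z => poissonMap z ζ) =ᶠ[𝓝 z] fun z => (poisson z (ζ : Cn n) : ℂ) := by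
    filter_upwards [Metric.isOpen_ball.mem_nhds hz] with w hw using poissonMap_apply hw ζ
  rw [hess, h1.fderiv.fderiv_eq]

/-- Being `M`-harmonic depends only on the values in the ball. -/
theorem IsMHarmonic.congr {f g : Cn n → ℂ} (hf : IsMHarmonic f)
    (h : ∀ z ∈ unitBall n, g z = f z) : IsMHarmonic g := by
  rw [isMHarmonic_iff] at hf ⊢
  refine ⟨hf.1.congr h, fun z hz => ?_⟩
  rw [← hf.2 z hz]
  have h1 : g =ᶠ[𝓝 z] f := by
    filter_upwards [Metric.isOpen_ball.mem_nhds hz] with w hw using h w hw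
  rw [hess, h1.fderiv.fderiv_eq]

theorem integrable_of_continuous {f : unitSphere n → ℂ} (hf : Continuous f) :
    Integrable f (sigma n) :=
  hf.integrable_of_hasCompactSupport (HasCompactSupport.of_compactSpace f)

theorem integrable_mul_continuousMap {g : unitSphere n → ℂ} (hg : Integrable g (sigma n))
    (F : C(unitSphere n, ℂ)) : Integrable (fun ζ => g ζ * F ζ) (sigma n) :=
  hg.mul_bdd F.continuous.aestronglyMeasurable
    (Eventually.of_forall fun ζ => F.norm_coe_le_norm ζ)

/-- Integration against an integrable function, as a functional on continuous functions. -/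
def integralCLM {g : unitSphere n → ℂ} (hg : Integrable g (sigma n)) :
    C(unitSphere n, ℂ) →L[ℂ] ℂ :=
  LinearMap.mkContinuous
    { toFun := fun F => ∫ ζ, g ζ * F ζ ∂(sigma n)
      map_add' := fun F G => by
        simp only [ContinuousMap.add_apply, mul_add]
        exact integral_add (integrable_mul_continuousMap hg F) (integrable_mul_continuousMap hg G)
      map_smul' := fun a F => by
        simp only [ContinuousMap.smul_apply, smul_eq_mul, mul_left_comm _ a, RingHom.id_apply]
        exact integral_const_mul a _ } (∫ ζ, ‖g ζ‖ ∂(sigma n)) (fun F => by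
      refine (norm_integral_le_integral_norm _).trans ?_
      rw [← integral_mul_const]
      refine integral_mono (integrable_mul_continuousMap hg F).norm (hg.norm.mul_const _)
        fun ζ => ?_
      simp only [norm_mul]
      gcongr
      exact F.norm_coe_le_norm ζ)

@[simp] theorem integralCLM_apply {g : unitSphere n → ℂ} (hg : Integrable g (sigma n))
    (F : C(unitSphere n, ℂ)) : integralCLM hg F = ∫ ζ, g ζ * F ζ ∂(sigma n) := rfl

/-- The Poisson–Szegő integral of a function on the sphere. -/
def poissonInt (g : unitSphere n → ℂ) (z : Cn n) : ℂ :=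
  ∫ ζ, g ζ * poisson z (ζ : Cn n) ∂(sigma n)

theorem poissonInt_eq_integralCLM {g : unitSphere n → ℂ} (hg : Integrable g (sigma n)) {z : Cn n}
    (hz : z ∈ unitBall n) : poissonInt g z = integralCLM hg (poissonMap z) := by
  simp only [integralCLM_apply, poissonMap_apply hz, poissonInt]

theorem isMHarmonic_poissonInt {g : unitSphere n → ℂ} (hg : Integrable g (sigma n)) :
    IsMHarmonic (poissonInt g) :=
  (isMHarmonic_functional contDiffOn_poissonMap isMHarmonic_poissonMap_apply
    (integralCLM hg)).congr fun _ hz => poissonInt_eq_integralCLM hg hz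

theorem poisson_nonneg {z : Cn n} (hz : ‖z‖ ≤ 1) (ζ : Cn n) : 0 ≤ poisson z ζ := by
  have h : 0 ≤ 1 - ‖z‖ ^ 2 := by nlinarith [norm_nonneg z]
  have : 0 ≤ massInv n := by
    unfold massInv
    have : 0 ≤ Real.Gamma n := Real.Gamma_nonneg_of_nonneg (by positivity)
    positivity
  unfold poisson
  positivity

theorem poisson_isometry (U : Cn n ≃ₗᵢ[ℂ] Cn n) (z ζ : Cn n) :
    poisson (U z) (U ζ) = poisson z ζ := by
  simp [poisson, herm_isometry, U.norm_map]

theorem continuous_poisson {z : Cn n} (hz : z ∈ unitBall n) :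
    Continuous fun ζ : unitSphere n => poisson z (ζ : Cn n) := by
  have h := Complex.continuous_re.comp (poissonMap z).continuous
  refine h.congr fun ζ => ?_
  simp [poissonMap_apply hz]

theorem integrable_mul_poisson {g : unitSphere n → ℂ} (hg : Integrable g (sigma n)) {z : Cn n}
    (hz : z ∈ unitBall n) : Integrable (fun ζ => g ζ * poisson z (ζ : Cn n)) (sigma n) := by
  simpa only [poissonMap_apply hz] using integrable_mul_continuousMap hg (poissonMap z)

theorem poissonInt_one_isometry (U : Cn n ≃ₗᵢ[ℂ] Cn n) (z : Cn n) :
    poissonInt (fun _ => 1) (U z) = poissonInt (fun _ => 1) z := by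
  let J : Cn n ≃ₗᵢ[ℝ] Cn n :=
    { U.toLinearEquiv.restrictScalars ℝ with norm_map' := U.norm_map }
  have h := integral_sphereMap J fun ζ => (1 : ℂ) * poisson (U z) (ζ : Cn n)
  rw [poissonInt, ← h, poissonInt]
  congr 1
  ext ζ
  exact congrArg (fun x : ℝ => (1 : ℂ) * x) (poisson_isometry U z ζ)

/-- The total mass of the Poisson–Szegő kernel is `1`: as a function of `z` it is `M`-harmonic and
unitarily invariant, hence constant by the maximum principle. -/
theorem poissonInt_one (hn : 1 ≤ n) {z : Cn n} (hz : z ∈ unitBall n) :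
    poissonInt (fun _ => 1) z = 1 := by
  set κ := poissonInt (fun _ => 1) z
  have hh : IsMHarmonic fun w : Cn n => poissonInt (fun _ => 1) w - κ :=
    (isMHarmonic_poissonInt (integrable_of_continuous continuous_const)).sub (isMHarmonic_const κ)
  have h0 := hh.norm_le_of_sphere hn (R := ‖z‖) (M := 0) (norm_lt_one_of_mem hz)
    (fun w hw => by
      have h1 : poissonInt (fun _ => 1) w = κ := by
        have h2 : householderIsometry hw w = z := householder_self hw
        rw [← poissonInt_one_isometry (householderIsometry hw) w, h2]
      rw [h1]; simp) (z := 0) (by simp)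
  have h1 : poissonInt (fun _ => 1) (0 : Cn n) = κ := by
    simpa [sub_eq_zero] using h0
  rw [← h1, poissonInt]
  simp only [poisson, herm_zero_left, norm_zero, sub_zero, norm_one, one_pow, one_mul, div_one,
    mul_one, ne_eq, OfNat.ofNat_ne_zero, not_false_eq_true, zero_pow]
  have := massInv_mul_sigma hn
  simp only [integral_const, Complex.real_smul]
  rw [mul_comm]
  exact_mod_cast this

theorem integral_poisson (hn : 1 ≤ n) {z : Cn n} (hz : z ∈ unitBall n) :
    ∫ ζ : unitSphere n, poisson z (ζ : Cn n) ∂(sigma n) = 1 := by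
  have h := poissonInt_one hn hz
  simp only [poissonInt, one_mul] at h
  rw [integral_complex_ofReal] at h
  exact_mod_cast h

theorem poisson_smul_comm {r : ℝ} (ζ η : unitSphere n) :
    poisson (r • (ζ : Cn n)) (η : Cn n) = poisson (r • (η : Cn n)) (ζ : Cn n) := by
  simp only [poisson, norm_smul, norm_sphere, herm_real_smul_left]
  have : ‖1 - r * herm (ζ : Cn n) η‖ = ‖1 - r * herm (η : Cn n) ζ‖ := by
    rw [← conj_herm (η : Cn n) ζ, ← RCLike.norm_conj]; simp
  rw [this]

/-! ### The Poisson–Szegő kernel as an approximate identity -/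

theorem sq_dist_le_norm_one_sub_herm {r : ℝ} (hr0 : 0 ≤ r) (hr1 : r ≤ 1) (ζ η : unitSphere n) :
    dist ζ η ^ 2 ≤ 4 * ‖1 - herm (r • (ζ : Cn n)) η‖ := by
  rw [herm_real_smul_left]
  set a := herm (ζ : Cn n) η
  have ha : ‖a‖ ≤ 1 := by simpa using norm_herm_le (ζ : Cn n) η
  have h1 : dist ζ η ^ 2 = 2 * (1 - a.re) := by
    rw [Subtype.dist_eq, dist_eq_norm, ← RCLike.ofReal_inj (K := ℂ)]
    have h2 : (((‖(ζ : Cn n) - (η : Cn n)‖ ^ 2 : ℝ)) : ℂ) =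
        herm ((ζ : Cn n) - (η : Cn n)) ((ζ : Cn n) - (η : Cn n)) := by
      rw [herm_self]; push_cast; rfl
    refine Eq.trans h2 ?_
    rw [herm_sub_left, herm_sub_right, herm_sub_right, herm_self, herm_self, norm_sphere,
      norm_sphere, ← conj_herm (ζ : Cn n) η]
    change _ = ((2 * (1 - a.re) : ℝ) : ℂ)
    have := Complex.add_conj a
    push_cast
    push_cast at this
    linear_combination -this
  have h2 : 1 - a.re ≤ ‖1 - a‖ := by
    have := Complex.re_le_norm (1 - a)
    simpa using this
  have h3 : ‖1 - a‖ ≤ 2 * ‖1 - r * a‖ := by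
    have h4 : ‖1 - a‖ ≤ ‖1 - r * a‖ + (1 - r) := by
      calc ‖1 - a‖ = ‖(1 - r * a) + ((r - 1 : ℝ) : ℂ) * a‖ := by congr 1; push_cast; ring
        _ ≤ ‖1 - r * a‖ + ‖((r - 1 : ℝ) : ℂ) * a‖ := norm_add_le _ _
        _ ≤ _ := by
          rw [norm_mul, Complex.norm_real, Real.norm_eq_abs, abs_of_nonpos (by linarith)]
          nlinarith [norm_nonneg a]
    have h5 : 1 - r ≤ ‖1 - r * a‖ := by
      have := Complex.re_le_norm (1 - r * a)
      have h6 := (Complex.re_le_norm a).trans ha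
      simp only [Complex.sub_re, Complex.one_re, Complex.re_ofReal_mul] at this
      nlinarith
    linarith
  linarith

theorem poisson_le_of_dist (hn : 1 ≤ n) {r δ : ℝ} (hr0 : 0 ≤ r) (hr1 : r < 1) (hδ : 0 < δ)
    {ζ η : unitSphere n} (h : δ ≤ dist ζ η) :
    poisson (r • (ζ : Cn n)) (η : Cn n) ≤ massInv n * (2 / (δ ^ 2 / 4) ^ (2 * n)) * (1 - r) := by
  have h1 : δ ^ 2 / 4 ≤ ‖1 - herm (r • (ζ : Cn n)) η‖ := by
    have := sq_dist_le_norm_one_sub_herm hr0 hr1.le ζ η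
    nlinarith
  have hm := massInv_pos hn
  rw [poisson, norm_real_smul_sphere hr0, mul_assoc]
  gcongr
  rw [div_mul_eq_mul_div]
  have h2 : (1 - r ^ 2) ^ n ≤ 2 * (1 - r) := by
    have h3 : (1 - r ^ 2) ^ n ≤ (1 - r ^ 2) ^ 1 :=
      pow_le_pow_of_le_one (by nlinarith) (by nlinarith) hn
    nlinarith
  gcongr

/-- Poisson–Szegő integrals of continuous functions converge uniformly to the boundary values. -/
theorem poissonInt_tendsto_uniform (hn : 1 ≤ n) (h : C(unitSphere n, ℂ)) {ε : ℝ} (hε : 0 < ε) :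
    ∃ δ < (1 : ℝ), 0 ≤ δ ∧ ∀ r : ℝ, δ < r → r < 1 → ∀ ζ : unitSphere n,
      ‖poissonInt h (r • (ζ : Cn n)) - h ζ‖ ≤ ε := by
  obtain ⟨d, hd, H⟩ := Metric.uniformContinuous_iff.1
    (CompactSpace.uniformContinuous_of_continuous h.continuous) (ε / 2) (half_pos hε)
  set C := 2 * ‖h‖ * (massInv n * (2 / (d ^ 2 / 4) ^ (2 * n))) with hC
  set m := (sigma n).real Set.univ
  have hm : 0 ≤ m := measureReal_nonneg
  have hC0 : 0 ≤ C := by have := massInv_pos hn; positivity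
  refine ⟨max 0 (1 - ε / (2 * (C * m + 1))), ?_, le_max_left _ _, ?_⟩
  · refine max_lt one_pos ?_
    have : 0 < ε / (2 * (C * m + 1)) := by positivity
    linarith
  intro r hr hr1 ζ
  have hr0 : 0 ≤ r := (le_max_left _ _).trans hr.le
  have hr' : C * m * (1 - r) ≤ ε / 2 := by
    have h1 : 1 - r ≤ ε / (2 * (C * m + 1)) := by
      have := (le_max_right _ _).trans hr.le
      linarith
    calc C * m * (1 - r) ≤ (C * m + 1) * (ε / (2 * (C * m + 1))) := by
          apply mul_le_mul _ h1 (by linarith) (by positivity); linarith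
      _ = ε / 2 := by field_simp
  have hz : r • (ζ : Cn n) ∈ unitBall n := smul_sphere_mem_ball hr0 hr1 ζ
  have h1 : poissonInt h (r • (ζ : Cn n)) - h ζ =
      ∫ η : unitSphere n, (h η - h ζ) * poisson (r • (ζ : Cn n)) (η : Cn n) ∂(sigma n) := by
    simp only [sub_mul]
    rw [integral_sub (integrable_mul_poisson (integrable_of_continuous h.continuous) hz)
      (integrable_mul_poisson (integrable_of_continuous continuous_const) hz), integral_const_mul,
      integral_complex_ofReal, integral_poisson hn hz]
    simp [poissonInt]
  rw [h1]
  have hint : Integrable (fun η : unitSphere n => poisson (r • (ζ : Cn n)) (η : Cn n)) (sigma n) :=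
    (continuous_poisson hz).integrable_of_hasCompactSupport (HasCompactSupport.of_compactSpace _)
  calc _ ≤ ∫ η : unitSphere n, ‖(h η - h ζ) * poisson (r • (ζ : Cn n)) (η : Cn n)‖ ∂(sigma n) :=
        norm_integral_le_integral_norm _
    _ ≤ ∫ η : unitSphere n, (ε / 2 * poisson (r • (ζ : Cn n)) (η : Cn n) + C * (1 - r))
          ∂(sigma n) := by
        refine integral_mono ?_ ((hint.const_mul _).add (integrable_const _)) fun η => ?_
        · simp only [sub_mul]
          exact ((integrable_mul_poisson (integrable_of_continuous h.continuous) hz).sub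
            (integrable_mul_poisson (integrable_of_continuous continuous_const) hz)).norm
        · have hp := poisson_nonneg (norm_lt_one_of_mem hz).le (η : Cn n)
          simp only [norm_mul, Complex.norm_real, Real.norm_of_nonneg hp]
          by_cases hηζ : dist η ζ < d
          · have h2 := (H hηζ).le
            rw [dist_eq_norm] at h2
            have : 0 ≤ C * (1 - r) := mul_nonneg hC0 (by linarith)
            nlinarith
          · have h2 := poisson_le_of_dist hn hr0 hr1 hd (by rw [dist_comm]; exact not_lt.1 hηζ :
              d ≤ dist ζ η)
            have h3 : ‖h η - h ζ‖ ≤ 2 * ‖h‖ := by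
              refine (norm_sub_le _ _).trans ?_
              linarith [h.norm_coe_le_norm η, h.norm_coe_le_norm ζ]
            calc _ ≤ 2 * ‖h‖ * (massInv n * (2 / (d ^ 2 / 4) ^ (2 * n)) * (1 - r)) := by
                  gcongr
              _ = C * (1 - r) := by rw [hC]; ring
              _ ≤ _ := by
                  have : 0 ≤ ε / 2 * poisson (r • (ζ : Cn n)) (η : Cn n) := by positivity
                  linarith
    _ = ε / 2 + C * m * (1 - r) := by
        rw [integral_add (hint.const_mul _) (integrable_const _), integral_const_mul,
          integral_poisson hn hz, integral_const, smul_eq_mul]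
        ring
    _ ≤ ε := by linarith

/-- If `F` is continuous, the Poisson–Szegő integral of its restriction to the sphere approaches
`F` uniformly at the boundary. -/
theorem poissonInt_sub_boundary (hn : 1 ≤ n) {F : Cn n → ℂ}
    (hF : ContinuousOn F (Metric.closedBall 0 1))
    {ε : ℝ} (hε : 0 < ε) :
    ∃ δ < (1 : ℝ), ∀ z : Cn n, δ < ‖z‖ → ‖z‖ < 1 →
      ‖poissonInt (fun ζ : unitSphere n => F ζ) z - F z‖ ≤ ε := by
  have hFs : Continuous fun ζ : unitSphere n => F ζ :=
    hF.comp_continuous continuous_subtype_val fun ζ => by simp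
  obtain ⟨δ, hδ1, hδ0, H⟩ := poissonInt_tendsto_uniform hn ⟨_, hFs⟩ (half_pos hε)
  obtain ⟨d, hd, H'⟩ := Metric.uniformContinuousOn_iff.1
    ((isCompact_closedBall (0 : Cn n) 1).uniformContinuousOn_of_continuous hF) (ε / 2)
    (half_pos hε)
  refine ⟨max δ (1 - d), max_lt hδ1 (by linarith), fun z hz hz1 => ?_⟩
  obtain ⟨ζ, hζ⟩ := exists_smul_sphere hn z
  have h1 := H ‖z‖ ((le_max_left _ _).trans_lt hz) hz1 ζ
  rw [hζ] at h1
  have h2 : dist (ζ : Cn n) z < d := by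
    have : (ζ : Cn n) - z = (1 - ‖z‖) • (ζ : Cn n) := by
      rw [sub_smul, one_smul, hζ]
    rw [dist_eq_norm, this, norm_smul, norm_sphere, mul_one, Real.norm_of_nonneg (by linarith)]
    have := (le_max_right _ _).trans_lt hz
    linarith
  have h3 := (H' (ζ : Cn n) (by simp) z (by simpa using hz1.le) h2).le
  rw [dist_eq_norm] at h3
  calc _ = ‖(poissonInt (fun ζ : unitSphere n => F ζ) z - F ζ) + (F ζ - F z)‖ := by
        congr 1; ring
    _ ≤ ε / 2 + ε / 2 := (norm_add_le _ _).trans (add_le_add h1 h3)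
    _ = ε := by ring

/-- Uniqueness in the Dirichlet problem: an `M`-harmonic function which uniformly approaches, at the
boundary, a function `F` continuous on the closed ball is the Poisson–Szegő integral of `F`. -/
theorem IsMHarmonic.eq_poissonInt (hn : 1 ≤ n) {u F : Cn n → ℂ} (hu : IsMHarmonic u)
    (hF : ContinuousOn F (Metric.closedBall 0 1))
    (h : ∀ ε > 0, ∃ δ < (1 : ℝ), ∀ z : Cn n, δ < ‖z‖ → ‖z‖ < 1 → ‖u z - F z‖ ≤ ε) {z : Cn n}
    (hz : z ∈ unitBall n) : u z = poissonInt (fun ζ : unitSphere n => F ζ) z := by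
  have hFs : Continuous fun ζ : unitSphere n => F ζ :=
    hF.comp_continuous continuous_subtype_val fun ζ => by simp
  refine sub_eq_zero.1 (IsMHarmonic.eq_zero_of_boundary hn
    (hu.sub (isMHarmonic_poissonInt (integrable_of_continuous hFs))) (fun ε hε => ?_) hz)
  obtain ⟨δ, hδ, H⟩ := h (ε / 2) (half_pos hε)
  obtain ⟨δ', hδ', H'⟩ := poissonInt_sub_boundary hn hF (half_pos hε)
  refine ⟨max δ δ', max_lt hδ hδ', fun w hw hw1 => ?_⟩
  have h1 := H w ((le_max_left _ _).trans_lt hw) hw1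
  have h2 := H' w ((le_max_right _ _).trans_lt hw) hw1
  calc _ = ‖(u w - F w) - (poissonInt (fun ζ : unitSphere n => F ζ) w - F w)‖ := by
        congr 1; ring
    _ ≤ ε / 2 + ε / 2 := (norm_sub_le _ _).trans (add_le_add h1 h2)
    _ = ε := by ring

/-! ### Poisson–Szegő operators on the sphere -/

theorem continuous_dilate_of_continuousOn {X : Type*} [TopologicalSpace X] {f : Cn n → X}
    (hf : ContinuousOn f (unitBall n)) {r : ℝ} (hr0 : 0 ≤ r) (hr1 : r < 1) :
    Continuous fun ζ : unitSphere n => f (r • (ζ : Cn n)) :=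
  hf.comp_continuous (by fun_prop) fun ζ => smul_sphere_mem_ball hr0 hr1 ζ

theorem continuous_poissonInt_dilate {g : unitSphere n → ℂ} (hg : Integrable g (sigma n)) {r : ℝ}
    (hr0 : 0 ≤ r) (hr1 : r < 1) :
    Continuous fun ζ : unitSphere n => poissonInt g (r • (ζ : Cn n)) :=
  continuous_dilate_of_continuousOn (isMHarmonic_poissonInt hg).1.continuousOn hr0 hr1

theorem continuous_poisson_dilate {r : ℝ} (hr0 : 0 ≤ r) (hr1 : r < 1) :
    Continuous fun p : unitSphere n × unitSphere n =>
      poisson (r • (p.1 : Cn n)) (p.2 : Cn n) := by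
  unfold poisson
  refine continuous_const.mul (Continuous.div (by fun_prop) (by fun_prop) fun p => ?_)
  refine pow_ne_zero _ (norm_ne_zero_iff.2 (one_sub_herm_ne_zero ?_ (norm_sphere p.2).le))
  rwa [norm_real_smul_sphere hr0]

/-- The Poisson–Szegő operators are symmetric. -/
theorem integral_poissonInt_mul {g h : unitSphere n → ℂ} (hg : Integrable g (sigma n))
    (hh : Integrable h (sigma n)) {r : ℝ} (hr0 : 0 ≤ r) (hr1 : r < 1) :
    ∫ ζ : unitSphere n, poissonInt g (r • (ζ : Cn n)) * h ζ ∂(sigma n) =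
      ∫ ζ : unitSphere n, g ζ * poissonInt h (r • (ζ : Cn n)) ∂(sigma n) := by
  simp only [poissonInt, ← integral_mul_const, ← integral_const_mul]
  rw [integral_integral_swap]
  · refine integral_congr_ae (Eventually.of_forall fun η => ?_)
    refine integral_congr_ae (Eventually.of_forall fun ζ => ?_)
    simp only [poisson_smul_comm ζ η]
    ring
  · have hc : Continuous fun p : unitSphere n × unitSphere n =>
        (poisson (r • (p.1 : Cn n)) (p.2 : Cn n) : ℂ) :=
      Complex.continuous_ofReal.comp (continuous_poisson_dilate hr0 hr1)
    let F : C(unitSphere n × unitSphere n, ℂ) := ⟨_, hc⟩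
    have h1 := (hh.mul_prod hg).mul_bdd (c := ‖F‖) hc.aestronglyMeasurable
      (Eventually.of_forall fun p => F.norm_coe_le_norm p)
    refine h1.congr (Eventually.of_forall fun p => ?_)
    simp only [Function.uncurry]
    ring

/-- The `M`-harmonic Szegő kernel, `K(z, w) = ∫ P(z, ζ) P(w, ζ) dσ(ζ)`. -/
def szego (z w : Cn n) : ℂ :=
  poissonInt (fun ζ : unitSphere n => (poisson z (ζ : Cn n) : ℂ)) w

theorem poisson_swap {J : Cn n ≃ₗᵢ[ℝ] Cn n} (hJ : ∀ z w, herm (J z) (J w) = herm w z)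
    (z w : Cn n) : poisson (J z) (J w) = poisson z w := by
  rw [poisson, poisson, hJ, J.norm_map, norm_one_sub_herm_comm]

/-- The Szegő kernel at `(rζ, sη)` depends symmetrically on `r` and `s`. -/
theorem szego_smul_swap (r s : ℝ) (ζ η : unitSphere n) :
    szego (r • (ζ : Cn n)) (s • (η : Cn n)) = szego (s • (ζ : Cn n)) (r • (η : Cn n)) := by
  obtain ⟨J, hJ, h1, h2⟩ := exists_swap ζ η
  rw [szego, poissonInt, ← integral_sphereMap J, szego, poissonInt]
  refine integral_congr_ae (Eventually.of_forall fun ξ => ?_)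
  have e1 : r • (ζ : Cn n) = J (r • (η : Cn n)) := by rw [map_smul, h2]
  have e2 : s • (η : Cn n) = J (s • (ζ : Cn n)) := by rw [map_smul, h1]
  simp only [coe_sphereMap, e1, e2, poisson_swap hJ]
  ring

theorem integrable_poisson {z : Cn n} (hz : z ∈ unitBall n) :
    Integrable (fun ζ : unitSphere n => (poisson z (ζ : Cn n) : ℂ)) (sigma n) :=
  integrable_of_continuous (Complex.continuous_ofReal.comp (continuous_poisson hz))

theorem poissonInt_poissonInt {g : unitSphere n → ℂ} (hg : Integrable g (sigma n)) {r s : ℝ}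
    (hr0 : 0 ≤ r) (hr1 : r < 1) (hs0 : 0 ≤ s) (hs1 : s < 1) (ζ : unitSphere n) :
    poissonInt (fun η : unitSphere n => poissonInt g (r • (η : Cn n))) (s • (ζ : Cn n)) =
      ∫ ξ : unitSphere n, g ξ * szego (s • (ζ : Cn n)) (r • (ξ : Cn n)) ∂(sigma n) := by
  rw [poissonInt, integral_poissonInt_mul hg
    (integrable_poisson (smul_sphere_mem_ball hs0 hs1 ζ)) hr0 hr1]
  rfl

/-- The Poisson–Szegő operators commute. -/
theorem poissonInt_comm {g : unitSphere n → ℂ} (hg : Integrable g (sigma n)) {r s : ℝ}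
    (hr0 : 0 ≤ r) (hr1 : r < 1) (hs0 : 0 ≤ s) (hs1 : s < 1) (ζ : unitSphere n) :
    poissonInt (fun η : unitSphere n => poissonInt g (r • (η : Cn n))) (s • (ζ : Cn n)) =
      poissonInt (fun η : unitSphere n => poissonInt g (s • (η : Cn n))) (r • (ζ : Cn n)) := by
  rw [poissonInt_poissonInt hg hr0 hr1 hs0 hs1, poissonInt_poissonInt hg hs0 hs1 hr0 hr1]
  simp only [szego_smul_swap s r]

theorem poissonInt_add {g h : unitSphere n → ℂ} (hg : Integrable g (sigma n))
    (hh : Integrable h (sigma n)) {z : Cn n} (hz : z ∈ unitBall n) :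
    poissonInt (fun ζ => g ζ + h ζ) z = poissonInt g z + poissonInt h z := by
  simp only [poissonInt, add_mul]
  exact integral_add (integrable_mul_poisson hg hz) (integrable_mul_poisson hh hz)

theorem poissonInt_sub {g h : unitSphere n → ℂ} (hg : Integrable g (sigma n))
    (hh : Integrable h (sigma n)) {z : Cn n} (hz : z ∈ unitBall n) :
    poissonInt (fun ζ => g ζ - h ζ) z = poissonInt g z - poissonInt h z := by
  simp only [poissonInt, sub_mul]
  exact integral_sub (integrable_mul_poisson hg hz) (integrable_mul_poisson hh hz)

theorem poissonInt_const_mul (a : ℂ) (g : unitSphere n → ℂ) (z : Cn n) :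
    poissonInt (fun ζ => a * g ζ) z = a * poissonInt g z := by
  simp only [poissonInt, mul_assoc]
  exact integral_const_mul a _

theorem conj_poissonInt (g : unitSphere n → ℂ) (z : Cn n) :
    (starRingEnd ℂ) (poissonInt g z) = poissonInt (fun ζ => (starRingEnd ℂ) (g ζ)) z := by
  rw [poissonInt, ← integral_conj]
  simp [poissonInt]

theorem norm_poissonInt_le_of_bound (hn : 1 ≤ n) {g : unitSphere n → ℂ}
    {M : ℝ} (hM : ∀ ζ, ‖g ζ‖ ≤ M) {z : Cn n} (hz : z ∈ unitBall n) :
    ‖poissonInt g z‖ ≤ M := by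
  have hp := fun ζ : unitSphere n => poisson_nonneg (norm_lt_one_of_mem hz).le (ζ : Cn n)
  have hint : Integrable (fun η : unitSphere n => poisson z (η : Cn n)) (sigma n) :=
    (continuous_poisson hz).integrable_of_hasCompactSupport (HasCompactSupport.of_compactSpace _)
  calc ‖poissonInt g z‖ ≤ ∫ ζ : unitSphere n, M * poisson z (ζ : Cn n) ∂(sigma n) := by
        refine norm_integral_le_of_norm_le (hint.const_mul M) (Eventually.of_forall fun ζ => ?_)
        rw [norm_mul, Complex.norm_real, Real.norm_of_nonneg (hp ζ)]
        exact mul_le_mul_of_nonneg_right (hM ζ) (hp ζ)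
    _ = M := by rw [integral_const_mul, integral_poisson hn hz, mul_one]

/-! ### Square-integrable boundary data -/

theorem normSq_poissonInt_le (hn : 1 ≤ n) {g : unitSphere n → ℂ} (hg : MemLp g 2 (sigma n))
    {z : Cn n} (hz : z ∈ unitBall n) :
    ‖poissonInt g z‖ ^ 2 ≤ ∫ ζ : unitSphere n, ‖g ζ‖ ^ 2 * poisson z (ζ : Cn n) ∂(sigma n) := by
  have hp := fun ζ : unitSphere n => poisson_nonneg (norm_lt_one_of_mem hz).le (ζ : Cn n)
  have hg1 : Integrable g (sigma n) := hg.integrable (by norm_num)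
  have hg2 : Integrable (fun ζ => ‖g ζ‖ ^ 2) (sigma n) := (memLp_two_iff_integrable_sq_norm
    hg.1).1 hg
  have hpc := continuous_poisson hz
  have hint : Integrable (fun η : unitSphere n => poisson z (η : Cn n)) (sigma n) :=
    hpc.integrable_of_hasCompactSupport (HasCompactSupport.of_compactSpace _)
  have hint2 : Integrable (fun ζ : unitSphere n => ‖g ζ‖ ^ 2 * poisson z (ζ : Cn n)) (sigma n) := by
    let F : C(unitSphere n, ℝ) := ⟨_, hpc⟩
    exact hg2.mul_bdd (c := ‖F‖) hpc.aestronglyMeasurable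
      (Eventually.of_forall fun ζ => F.norm_coe_le_norm ζ)
  set a := ‖poissonInt g z‖
  have h1 : a * a ≤ ∫ ζ : unitSphere n, (1 / 2 * (‖g ζ‖ ^ 2 * poisson z (ζ : Cn n)) +
      1 / 2 * a ^ 2 * poisson z (ζ : Cn n)) ∂(sigma n) := by
    calc a * a = ‖(a : ℂ) * poissonInt g z‖ := by simp [a]
      _ ≤ _ := by
        rw [poissonInt, ← integral_const_mul]
        refine norm_integral_le_of_norm_le ((hint2.const_mul _).add (hint.const_mul _))
          (Eventually.of_forall fun ζ => ?_)
        rw [norm_mul, norm_mul, Complex.norm_real, Complex.norm_real, Real.norm_of_nonneg (hp ζ),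
          Real.norm_of_nonneg (norm_nonneg _)]
        nlinarith [mul_nonneg (sq_nonneg (‖g ζ‖ - a)) (hp ζ)]
  rw [integral_add (hint2.const_mul _) (hint.const_mul _), integral_const_mul, integral_const_mul,
    integral_poisson hn hz] at h1
  nlinarith

/-- The Poisson–Szegő operators are contractions of `L²(σ)`. -/
theorem eLpNorm_poissonInt_le (hn : 1 ≤ n) {g : unitSphere n → ℂ} (hg : MemLp g 2 (sigma n))
    {r : ℝ} (hr0 : 0 ≤ r) (hr1 : r < 1) :
    eLpNorm (fun ζ : unitSphere n => poissonInt g (r • (ζ : Cn n))) 2 (sigma n) ≤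
      eLpNorm g 2 (sigma n) := by
  have hg1 : Integrable g (sigma n) := hg.integrable (by norm_num)
  have hg2 : Integrable (fun ζ => ‖g ζ‖ ^ 2) (sigma n) := (memLp_two_iff_integrable_sq_norm
    hg.1).1 hg
  have hg2' : Integrable (fun ζ => ((‖g ζ‖ ^ 2 : ℝ) : ℂ)) (sigma n) := hg2.ofReal
  have hc := continuous_poissonInt_dilate hg1 hr0 hr1
  have hT : MemLp (fun ζ : unitSphere n => poissonInt g (r • (ζ : Cn n))) 2 (sigma n) :=
    hc.memLp_of_hasCompactSupport (HasCompactSupport.of_compactSpace _)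
  rw [hT.eLpNorm_eq_integral_rpow_norm (by norm_num) (by norm_num),
    hg.eLpNorm_eq_integral_rpow_norm (by norm_num) (by norm_num)]
  simp only [ENNReal.toReal_ofNat, Real.rpow_two]
  have h0 : 0 ≤ ∫ ζ : unitSphere n, ‖poissonInt g (r • (ζ : Cn n))‖ ^ 2 ∂(sigma n) :=
    integral_nonneg fun ζ => by positivity
  refine ENNReal.ofReal_le_ofReal (Real.rpow_le_rpow h0 ?_ (by norm_num))
  set G : unitSphere n → ℂ := fun ζ => ((‖g ζ‖ ^ 2 : ℝ) : ℂ)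
  have hre : ∀ ζ : unitSphere n, (poissonInt G (r • (ζ : Cn n))) =
      ((∫ η : unitSphere n, ‖g η‖ ^ 2 * poisson (r • (ζ : Cn n)) (η : Cn n) ∂(sigma n) : ℝ) : ℂ) :=
    by
      intro ζ
      rw [← integral_complex_ofReal]
      simp [poissonInt, G]
  have h1 := integral_poissonInt_mul hg2' (integrable_of_continuous (n := n)
    (continuous_const (y := (1 : ℂ)))) hr0 hr1
  have h2 : ∫ ζ : unitSphere n, G ζ * poissonInt (fun _ => 1) (r • (ζ : Cn n)) ∂(sigma n) =
      ((∫ ζ, ‖g ζ‖ ^ 2 ∂(sigma n) : ℝ) : ℂ) := by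
    rw [← integral_complex_ofReal]
    refine integral_congr_ae (Eventually.of_forall fun ζ => ?_)
    simp only [poissonInt_one hn (smul_sphere_mem_ball hr0 hr1 ζ), mul_one, G]
  rw [h2] at h1
  simp only [mul_one] at h1
  change ∫ ζ : unitSphere n, poissonInt G (r • (ζ : Cn n)) ∂(sigma n) = _ at h1
  simp only [hre] at h1
  rw [integral_complex_ofReal, Complex.ofReal_inj] at h1
  rw [← h1]
  have hcG := continuous_poissonInt_dilate hg2' hr0 hr1
  refine integral_mono ((hc.norm.pow 2).integrable_of_hasCompactSupport
    (HasCompactSupport.of_compactSpace _)) ?_ fun ζ =>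
      normSq_poissonInt_le hn hg (smul_sphere_mem_ball hr0 hr1 ζ)
  have h3 := (Complex.continuous_re.comp hcG).integrable_of_hasCompactSupport (μ := sigma n)
    (HasCompactSupport.of_compactSpace _)
  refine h3.congr (Eventually.of_forall fun ζ => ?_)
  change (poissonInt G (r • (ζ : Cn n))).re = _
  rw [hre, Complex.ofReal_re]

theorem eventually_Ioo_left_one {δ : ℝ} (hδ : δ < 1) : ∀ᶠ r in 𝓝[<] (1 : ℝ), δ < r ∧ r < 1 := by
  filter_upwards [Ioo_mem_nhdsLT hδ] with r hr using ⟨hr.1, hr.2⟩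

/-- The Poisson–Szegő integral of `g ∈ L²(σ)` has radial boundary value `g`. -/
theorem isRadialBoundaryValue_poissonInt (hn : 1 ≤ n) {g : unitSphere n → ℂ}
    (hg : MemLp g 2 (sigma n)) : IsRadialBoundaryValue (poissonInt g) g := by
  refine ⟨hg, ENNReal.tendsto_nhds_zero.2 fun ε hε => ?_⟩
  rcases eq_top_or_lt_top ε with rfl | hεtop
  · exact Eventually.of_forall fun _ => le_top
  obtain ⟨h, hgh, hh⟩ := hg.exists_boundedContinuous_eLpNorm_sub_le (by norm_num)
    (ε := ε / 3) (ENNReal.div_pos hε.ne' (by norm_num)).ne'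
  have hg1 : Integrable g (sigma n) := hg.integrable (by norm_num)
  have hh1 : Integrable h (sigma n) := hh.integrable (by norm_num)
  set m := (sigma n).real Set.univ
  set d : ℝ := (ε / 3).toReal / (m ^ (2 : ℝ)⁻¹ + 1)
  have hm : 0 ≤ m := measureReal_nonneg
  have hε3 : ε / 3 ≠ ⊤ := (ENNReal.div_lt_top hεtop.ne (by norm_num)).ne
  have hd : 0 < d := div_pos (ENNReal.toReal_pos (ENNReal.div_pos hε.ne' (by norm_num)).ne' hε3)
    (by positivity)
  obtain ⟨δ, hδ1, hδ0, H⟩ := poissonInt_tendsto_uniform hn h.toContinuousMap hd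
  filter_upwards [eventually_Ioo_left_one hδ1] with r hr
  have hr0 : 0 ≤ r := hδ0.trans hr.1.le
  have e1 : (fun ζ : unitSphere n => poissonInt g (r • (ζ : Cn n)) - g ζ) =
      ((fun ζ : unitSphere n => poissonInt (g - ⇑h) (r • (ζ : Cn n))) +
        fun ζ : unitSphere n => poissonInt h (r • (ζ : Cn n)) - h ζ) - (g - ⇑h) := by
    ext ζ
    have := poissonInt_sub hg1 hh1 (smul_sphere_mem_ball hr0 hr.2 ζ)
    simp only [Pi.sub_apply, Pi.add_apply]
    change _ = poissonInt (fun ζ => g ζ - h ζ) (r • (ζ : Cn n)) + _ - _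
    rw [this]; ring
  have m1 : AEStronglyMeasurable (fun ζ : unitSphere n => poissonInt (g - ⇑h) (r • (ζ : Cn n)))
      (sigma n) := (continuous_poissonInt_dilate (hg1.sub hh1) hr0 hr.2).aestronglyMeasurable
  have m2 : AEStronglyMeasurable (fun ζ : unitSphere n => poissonInt h (r • (ζ : Cn n)) - h ζ)
      (sigma n) :=
    ((continuous_poissonInt_dilate hh1 hr0 hr.2).sub h.continuous).aestronglyMeasurable
  have b2 : eLpNorm (fun ζ : unitSphere n => poissonInt h (r • (ζ : Cn n)) - h ζ) 2 (sigma n) ≤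
      ε / 3 := by
    refine (eLpNorm_le_of_ae_bound (C := d) (Eventually.of_forall fun ζ => H r hr.1 hr.2 ζ)).trans
      ?_
    have hmm : (sigma n) Set.univ = ENNReal.ofReal m := (ofReal_measureReal).symm
    rw [hmm, ENNReal.toReal_ofNat, ENNReal.ofReal_rpow_of_nonneg hm (by norm_num),
      ← ENNReal.ofReal_mul (by positivity)]
    rw [← ENNReal.ofReal_toReal hε3]
    refine ENNReal.ofReal_le_ofReal ?_
    rw [mul_comm, div_mul_eq_mul_div, div_le_iff₀ (by positivity)]
    gcongr
    linarith
  rw [e1]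
  calc _ ≤ eLpNorm ((fun ζ : unitSphere n => poissonInt (g - ⇑h) (r • (ζ : Cn n))) +
        fun ζ : unitSphere n => poissonInt h (r • (ζ : Cn n)) - h ζ) 2 (sigma n) +
        eLpNorm (g - ⇑h) 2 (sigma n) := eLpNorm_sub_le (m1.add m2) (hg.1.sub hh.1) (by norm_num)
    _ ≤ (ε / 3 + ε / 3) + ε / 3 := by
        gcongr
        refine (eLpNorm_add_le m1 m2 (by norm_num)).trans ?_
        gcongr
        exact (eLpNorm_poissonInt_le hn (hg.sub hh) hr0 hr.2).trans hgh
    _ = ε := ENNReal.add_thirds ε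

/-! ### Injectivity and dense range of the Poisson–Szegő operators -/

/-- The Poisson–Szegő kernel on a diameter, as a holomorphic family of continuous functions of the
complex parameter `t`. -/
def poissonLine (ζ : unitSphere n) (t : ℂ) : C(unitSphere n, ℂ) :=
  ((massInv n : ℂ) * (1 - t ^ 2) ^ n) •
    (Ring.inverse (1 - t • hermMap n ζ) ^ n * Ring.inverse (1 - t • hermMapBar n ζ) ^ n)

theorem norm_smul_hermMap_lt {ζ : unitSphere n} {t : ℂ} (ht : ‖t‖ < 1) :
    ‖t • hermMap n ζ‖ < 1 := by
  rw [norm_smul]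
  have := norm_hermMap_le (ζ : Cn n)
  rw [norm_sphere] at this
  nlinarith [norm_nonneg t, norm_nonneg (hermMap n ζ)]

theorem norm_smul_hermMapBar_lt {ζ : unitSphere n} {t : ℂ} (ht : ‖t‖ < 1) :
    ‖t • hermMapBar n ζ‖ < 1 := by
  rw [norm_smul]
  have := norm_hermMapBar_le (ζ : Cn n)
  rw [norm_sphere] at this
  nlinarith [norm_nonneg t, norm_nonneg (hermMapBar n ζ)]

theorem differentiableOn_poissonLine (ζ : unitSphere n) :
    DifferentiableOn ℂ (poissonLine ζ) (Metric.ball 0 1) := by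
  intro t ht
  have ht' : ‖t‖ < 1 := by simpa using ht
  apply DifferentiableAt.differentiableWithinAt
  have key : ∀ u : C(unitSphere n, ℂ), ‖t • u‖ < 1 →
      DifferentiableAt ℂ (fun t : ℂ => Ring.inverse (1 - t • u)) t := by
    intro u hu
    obtain ⟨x, hx⟩ := isUnit_one_sub_of_norm_lt hu
    have h := contDiffAt_ringInverse ℂ (n := 1) x
    rw [hx] at h
    have hl : ContDiffAt ℂ 1 (fun t : ℂ => 1 - t • u) t :=
      contDiffAt_const.sub (contDiffAt_id.smul contDiffAt_const)
    exact (h.comp t hl).differentiableAt (by norm_num)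
  have h0 : DifferentiableAt ℂ (fun t : ℂ => (massInv n : ℂ) * (1 - t ^ 2) ^ n) t := by fun_prop
  exact h0.smul (((key _ (norm_smul_hermMap_lt ht')).pow n).mul
    ((key _ (norm_smul_hermMapBar_lt ht')).pow n))

theorem poissonLine_ofReal (ζ : unitSphere n) (r : ℝ) :
    poissonLine ζ (r : ℂ) = poissonMap (r • (ζ : Cn n)) := by
  have h1 : hermMap n (r • (ζ : Cn n)) = (r : ℂ) • hermMap n ζ := by
    ext η; simp
  have h2 : hermMapBar n (r • (ζ : Cn n)) = (r : ℂ) • hermMapBar n ζ := by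
    ext η; simp
  have h3 : herm (r • (ζ : Cn n)) (r • (ζ : Cn n)) = (r : ℂ) ^ 2 := by
    rw [herm_real_smul_left, herm_real_smul_right, herm_self, norm_sphere]; push_cast; ring
  rw [poissonLine, poissonMap, h1, h2, h3]

/-- A Poisson–Szegő integral vanishing on a sphere of radius `R ∈ (0, 1)` vanishes identically: it
vanishes in the ball of radius `R` by the maximum principle, and then along every diameter since it
is the restriction of a holomorphic function there. -/
theorem poissonInt_eq_zero_of_sphere (hn : 1 ≤ n) {g : unitSphere n → ℂ}
    (hg : Integrable g (sigma n)) {R : ℝ} (hR0 : 0 < R) (hR1 : R < 1)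
    (h : ∀ ζ : unitSphere n, poissonInt g (R • (ζ : Cn n)) = 0) {z : Cn n} (hz : z ∈ unitBall n) :
    poissonInt g z = 0 := by
  have h1 : ∀ w : Cn n, ‖w‖ ≤ R → poissonInt g w = 0 := by
    intro w hw
    refine norm_le_zero_iff.1 ((isMHarmonic_poissonInt hg).norm_le_of_sphere hn hR1
      (fun v hv => ?_) hw)
    obtain ⟨ζ, hζ⟩ := exists_smul_sphere hn v
    rw [← hζ, hv, h, norm_zero]
  obtain ⟨ζ, hζ⟩ := exists_smul_sphere hn z
  set Φ : ℂ → ℂ := fun t => integralCLM hg (poissonLine ζ t)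
  have hΦd : DifferentiableOn ℂ Φ (Metric.ball 0 1) := by
    intro t ht
    exact (integralCLM hg).differentiableAt.comp_differentiableWithinAt t
      (differentiableOn_poissonLine ζ t ht)
  have hΦr : ∀ r : ℝ, 0 ≤ r → r < 1 → Φ r = poissonInt g (r • (ζ : Cn n)) := by
    intro r hr0 hr1
    rw [poissonInt_eq_integralCLM hg (smul_sphere_mem_ball hr0 hr1 ζ), ← poissonLine_ofReal]
  have hfreq : ∃ᶠ t in 𝓝[≠] (0 : ℂ), Φ t = 0 := by
    have ht : Tendsto (fun r : ℝ => (r : ℂ)) (𝓝[>] 0) (𝓝[≠] 0) := by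
      refine tendsto_nhdsWithin_iff.2 ⟨?_, ?_⟩
      · exact (Complex.continuous_ofReal.tendsto' 0 0 (by simp)).mono_left nhdsWithin_le_nhds
      · filter_upwards [self_mem_nhdsWithin] with r hr
        simpa using (ne_of_gt hr)
    refine ht.frequently (Eventually.frequently ?_)
    filter_upwards [Ioo_mem_nhdsGT hR0] with r hr
    rw [hΦr r hr.1.le (hr.2.trans hR1)]
    apply h1
    rw [norm_real_smul_sphere hr.1.le]
    exact hr.2.le
  have hzero := (hΦd.analyticOnNhd Metric.isOpen_ball).eqOn_zero_of_preconnected_of_frequently_eq_zero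
    (convex_ball (0 : ℂ) 1).isPreconnected (z₀ := 0) (by simp) hfreq
  have hz' := norm_lt_one_of_mem hz
  rw [← hζ, ← hΦr ‖z‖ (norm_nonneg z) hz']
  exact hzero (by simpa using hz')

theorem ae_eq_of_isRadialBoundaryValue {f : Cn n → ℂ} {g h : unitSphere n → ℂ}
    (hf : ContinuousOn f (unitBall n))
    (hg : IsRadialBoundaryValue f g) (hh : IsRadialBoundaryValue f h) : g =ᵐ[sigma n] h := by
  have h0 : eLpNorm (g - h) 2 (sigma n) = 0 := by
    refine le_antisymm (ge_of_tendsto (by simpa using hg.2.add hh.2) ?_) bot_le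
    filter_upwards [eventually_Ioo_left_one zero_lt_one] with r hr
    have hc := (continuous_dilate_of_continuousOn hf hr.1.le hr.2).aestronglyMeasurable
      (μ := sigma n)
    have e : g - h = (fun ζ : unitSphere n => f (r • (ζ : Cn n)) - h ζ) -
        fun ζ : unitSphere n => f (r • (ζ : Cn n)) - g ζ := by
      ext ζ; simp
    rw [e, add_comm (eLpNorm _ _ _)]
    exact eLpNorm_sub_le (hc.sub hh.1.1) (hc.sub hg.1.1) (by norm_num)
  rw [eLpNorm_eq_zero_iff (hg.1.1.sub hh.1.1) (by norm_num)] at h0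
  filter_upwards [h0] with ζ hζ
  exact sub_eq_zero.1 hζ

/-- The Poisson–Szegő operators with positive radius are injective on `L²(σ)`. -/
theorem ae_eq_zero_of_poissonInt_sphere (hn : 1 ≤ n) {g : unitSphere n → ℂ}
    (hg : MemLp g 2 (sigma n)) {R : ℝ} (hR0 : 0 < R) (hR1 : R < 1)
    (h : ∀ ζ : unitSphere n, poissonInt g (R • (ζ : Cn n)) = 0) : g =ᵐ[sigma n] 0 := by
  have hg1 : Integrable g (sigma n) := hg.integrable (by norm_num)
  refine ae_eq_of_isRadialBoundaryValue (isMHarmonic_poissonInt hg1).1.continuousOn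
    (isRadialBoundaryValue_poissonInt hn hg) ⟨MemLp.zero, ?_⟩
  refine tendsto_const_nhds.congr' ?_
  filter_upwards [eventually_Ioo_left_one zero_lt_one] with r hr
  have : (fun ζ : unitSphere n => poissonInt g (r • (ζ : Cn n)) - (0 : unitSphere n → ℂ) ζ) =
      0 := by
    ext ζ
    simp [poissonInt_eq_zero_of_sphere hn hg1 hR0 hR1 h (smul_sphere_mem_ball hr.1.le hr.2 ζ)]
  rw [this, eLpNorm_zero]

theorem integrable_lp (g : Lp ℂ 2 (sigma n)) : Integrable g (sigma n) :=
  (Lp.memLp g).integrable (by norm_num)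

/-- The `L²` class of a continuous function on the sphere. -/
abbrev toL2 (n : ℕ) : C(unitSphere n, ℂ) →L[ℂ] Lp ℂ 2 (sigma n) :=
  ContinuousMap.toLp 2 (sigma n) ℂ

theorem inner_toL2 (F : C(unitSphere n, ℂ)) (g : Lp ℂ 2 (sigma n)) :
    inner ℂ (toL2 n F) g = ∫ ζ, g ζ * (starRingEnd ℂ) (F ζ) ∂(sigma n) := by
  rw [L2.inner_def]
  refine integral_congr_ae ?_
  filter_upwards [ContinuousMap.coeFn_toLp (sigma n) (p := 2) (𝕜 := ℂ) F] with ζ hζ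
  rw [toL2, hζ]; simp

theorem inner_toL2_poissonMap {z : Cn n} (hz : z ∈ unitBall n) (g : Lp ℂ 2 (sigma n)) :
    inner ℂ (toL2 n (poissonMap z)) g = poissonInt g z := by
  rw [inner_toL2, poissonInt]
  simp [poissonMap_apply hz]

theorem poissonInt_congr_ae {g h : unitSphere n → ℂ} (H : g =ᵐ[sigma n] h) (z : Cn n) :
    poissonInt g z = poissonInt h z := by
  refine integral_congr_ae ?_
  filter_upwards [H] with ζ hζ
  rw [hζ]

/-- The Poisson–Szegő operator `g ↦ (ζ ↦ P[g](rζ))` on continuous functions on the sphere. -/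
def poissonOp {r : ℝ} (hr0 : 0 ≤ r) (hr1 : r < 1) :
    C(unitSphere n, ℂ) →ₗ[ℂ] C(unitSphere n, ℂ) where
  toFun g := ⟨fun ζ => poissonInt g (r • (ζ : Cn n)),
    continuous_poissonInt_dilate (integrable_of_continuous g.continuous) hr0 hr1⟩
  map_add' g h := by
    ext ζ
    exact poissonInt_add (integrable_of_continuous g.continuous)
      (integrable_of_continuous h.continuous) (smul_sphere_mem_ball hr0 hr1 ζ)
  map_smul' a g := by
    ext ζ
    exact poissonInt_const_mul a g _

@[simp] theorem poissonOp_apply {r : ℝ} (hr0 : 0 ≤ r) (hr1 : r < 1) (g : C(unitSphere n, ℂ))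
    (ζ : unitSphere n) : poissonOp hr0 hr1 g ζ = poissonInt g (r • (ζ : Cn n)) := rfl

/-- The range of a Poisson–Szegő operator with positive radius is dense in `L²(σ)`. -/
theorem exists_poissonOp_near_L2 (hn : 1 ≤ n) {R : ℝ} (hR0 : 0 < R) (hR1 : R < 1)
    (F : C(unitSphere n, ℂ)) {ε : ℝ} (hε : 0 < ε) :
    ∃ g : C(unitSphere n, ℂ), ‖toL2 n (poissonOp hR0.le hR1 g - F)‖ < ε := by
  set V : Submodule ℂ (Lp ℂ 2 (sigma n)) :=
    LinearMap.range ((toL2 n).toLinearMap ∘ₗ poissonOp hR0.le hR1)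
  have hV : Vᗮ = ⊥ := by
    rw [Submodule.eq_bot_iff]
    intro h hh
    have h1 : ∀ g : C(unitSphere n, ℂ),
        ∫ ζ, h ζ * (starRingEnd ℂ) (poissonOp hR0.le hR1 g ζ) ∂(sigma n) = 0 := by
      intro g
      rw [← inner_toL2]
      exact (Submodule.mem_orthogonal V h).1 hh _ ⟨g, rfl⟩
    let H : C(unitSphere n, ℂ) := ⟨fun ζ => poissonInt h (R • (ζ : Cn n)),
      continuous_poissonInt_dilate (integrable_lp h) hR0.le hR1⟩
    have h2 : inner ℂ (toL2 n H) (toL2 n H) = 0 := by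
      rw [inner_toL2]
      have h3 := h1 H
      simp only [poissonOp_apply, conj_poissonInt] at h3
      have h4 := integral_poissonInt_mul (h := fun ζ => (starRingEnd ℂ) (H ζ)) (integrable_lp h)
        (integrable_of_continuous (Complex.continuous_conj.comp H.continuous)) hR0.le hR1
      rw [← h4] at h3
      rw [← h3]
      refine integral_congr_ae ?_
      filter_upwards [ContinuousMap.coeFn_toLp (sigma n) (p := 2) (𝕜 := ℂ) H] with ζ hζ
      rw [toL2, hζ]; rfl
    have h4 : H = 0 := by
      have h5 : toL2 n H = 0 := inner_self_eq_zero.1 h2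
      exact ContinuousMap.toLp_injective (sigma n) (𝕜 := ℂ) (by rw [h5, map_zero])
    have h5 := ae_eq_zero_of_poissonInt_sphere hn (Lp.memLp h) hR0 hR1
      fun ζ => congrArg (fun f : C(unitSphere n, ℂ) => f ζ) h4
    exact (Lp.eq_zero_iff_ae_eq_zero).2 h5
  have hdense : Dense (V : Set (Lp ℂ 2 (sigma n))) :=
    Submodule.dense_iff_topologicalClosure_eq_top.2
      ((Submodule.topologicalClosure_eq_top_iff).2 hV)
  obtain ⟨y, hy, ⟨g, rfl⟩⟩ := Metric.dense_iff.1 hdense (toL2 n F) ε hε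
  refine ⟨g, ?_⟩
  rw [map_sub, ← dist_eq_norm]
  exact hy

/-- The range of a Poisson–Szegő operator with positive radius is uniformly dense in the continuous
functions on the sphere. -/
theorem exists_poissonOp_near (hn : 1 ≤ n) {R : ℝ} (hR0 : 0 < R) (hR1 : R < 1)
    (F : C(unitSphere n, ℂ)) {ε : ℝ} (hε : 0 < ε) :
    ∃ g : C(unitSphere n, ℂ), ∀ ζ, ‖poissonOp hR0.le hR1 g ζ - F ζ‖ ≤ ε := by
  obtain ⟨δ, hδ1, hδ0, H⟩ := poissonInt_tendsto_uniform hn F (half_pos hε)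
  obtain ⟨r, hrδ, hr1⟩ := exists_between hδ1
  have hr0 : 0 ≤ r := hδ0.trans hrδ.le
  have hc : Continuous fun ζ : unitSphere n => toL2 n (poissonMap (r • (ζ : Cn n))) :=
    (toL2 n).continuous.comp (continuous_dilate_of_continuousOn continuousOn_poissonMap hr0 hr1)
  let N : C(unitSphere n, Lp ℂ 2 (sigma n)) := ⟨_, hc⟩
  obtain ⟨g, hg⟩ := exists_poissonOp_near_L2 hn hR0 hR1 F
    (ε := ε / (2 * (‖N‖ + 1))) (by positivity)
  refine ⟨poissonOp hr0 hr1 g, fun ζ => ?_⟩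
  have h1 : poissonOp hR0.le hR1 (poissonOp hr0 hr1 g) ζ =
      poissonOp hr0 hr1 (poissonOp hR0.le hR1 g) ζ :=
    poissonInt_comm (integrable_of_continuous g.continuous) hr0 hr1 hR0.le hR1 ζ
  have h2 : ‖poissonOp hr0 hr1 (poissonOp hR0.le hR1 g - F) ζ‖ ≤ ε / 2 := by
    have h3 : poissonOp hr0 hr1 (poissonOp hR0.le hR1 g - F) ζ =
        inner ℂ (N ζ) (toL2 n (poissonOp hR0.le hR1 g - F)) := by
      change _ = inner ℂ (toL2 n (poissonMap (r • (ζ : Cn n)))) _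
      rw [inner_toL2_poissonMap (smul_sphere_mem_ball hr0 hr1 ζ), poissonOp_apply]
      exact (poissonInt_congr_ae (ContinuousMap.coeFn_toLp (sigma n) (p := 2) (𝕜 := ℂ) _) _).symm
    rw [h3]
    calc _ ≤ ‖N ζ‖ * ‖toL2 n (poissonOp hR0.le hR1 g - F)‖ := norm_inner_le_norm _ _
      _ ≤ (‖N‖ + 1) * (ε / (2 * (‖N‖ + 1))) := by
          gcongr
          linarith [N.norm_coe_le_norm ζ]
      _ = ε / 2 := by have : ‖N‖ + 1 ≠ 0 := by positivity
                      field_simp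
  have h4 := H r hrδ hr1 ζ
  rw [h1]
  calc _ = ‖poissonOp hr0 hr1 (poissonOp hR0.le hR1 g - F) ζ +
        (poissonInt F (r • (ζ : Cn n)) - F ζ)‖ := by
        rw [map_sub, ContinuousMap.sub_apply, poissonOp_apply _ _ F]; congr 1; ring
    _ ≤ ε / 2 + ε / 2 := (norm_add_le _ _).trans (add_le_add h2 h4)
    _ = ε := by ring

/-! ### Hardy space functions are Poisson–Szegő integrals -/

/-- For `M`-harmonic `f`, applying the Poisson–Szegő operator of radius `s` to the dilation `f(r ·)`
gives a result symmetric in `r` and `s`: this holds for Poisson–Szegő integrals since the operators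
commute, and these approximate `f` uniformly on compact sets. -/
theorem IsMHarmonic.poissonInt_dilate_comm (hn : 1 ≤ n) {f : Cn n → ℂ} (hf : IsMHarmonic f)
    {r s : ℝ} (hr0 : 0 ≤ r) (hr1 : r < 1) (hs0 : 0 ≤ s) (hs1 : s < 1) (ζ : unitSphere n) :
    poissonInt (fun η : unitSphere n => f (r • (η : Cn n))) (s • (ζ : Cn n)) =
      poissonInt (fun η : unitSphere n => f (s • (η : Cn n))) (r • (ζ : Cn n)) := by
  obtain ⟨R, hR, hR1⟩ := exists_between (max_lt hr1 hs1)
  have hrR : r ≤ R := (le_max_left _ _).trans hR.le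
  have hsR : s ≤ R := (le_max_right _ _).trans hR.le
  have hR0 : 0 < R := hr0.trans_lt ((le_max_left _ _).trans_lt hR)
  have hfc := hf.1.continuousOn
  rw [← sub_eq_zero, ← norm_le_zero_iff]
  refine le_of_forall_pos_le_add fun ε hε => ?_
  obtain ⟨g, hg⟩ := exists_poissonOp_near hn hR0 hR1
    ⟨_, continuous_dilate_of_continuousOn hfc hR0.le hR1⟩ (half_pos hε)
  have hgi := integrable_of_continuous g.continuous
  have happrox : ∀ w : Cn n, ‖w‖ ≤ R → ‖poissonInt g w - f w‖ ≤ ε / 2 := by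
    intro w hw
    refine ((isMHarmonic_poissonInt hgi).sub hf).norm_le_of_sphere hn hR1 (fun v hv => ?_) hw
    obtain ⟨ξ, hξ⟩ := exists_smul_sphere hn v
    rw [← hξ, hv]
    exact hg ξ
  have key : ∀ t u : ℝ, 0 ≤ t → t ≤ R → 0 ≤ u → u < 1 →
      ‖poissonInt (fun η : unitSphere n => poissonInt g (t • (η : Cn n))) (u • (ζ : Cn n)) -
        poissonInt (fun η : unitSphere n => f (t • (η : Cn n))) (u • (ζ : Cn n))‖ ≤ ε / 2 := by
    intro t u ht0 htR hu0 hu1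
    have ht1 := htR.trans_lt hR1
    rw [← poissonInt_sub
      (integrable_of_continuous (continuous_poissonInt_dilate hgi ht0 ht1))
      (integrable_of_continuous (continuous_dilate_of_continuousOn hfc ht0 ht1))
      (smul_sphere_mem_ball hu0 hu1 ζ)]
    refine norm_poissonInt_le_of_bound hn (fun η => happrox _ ?_) (smul_sphere_mem_ball hu0 hu1 ζ)
    rwa [norm_real_smul_sphere ht0]
  have h1 := key r s hr0 hrR hs0 hs1
  have h2 := key s r hs0 hsR hr0 hr1
  rw [poissonInt_comm hgi hr0 hr1 hs0 hs1 ζ] at h1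
  rw [zero_add]
  calc _ = ‖(poissonInt (fun η : unitSphere n => poissonInt g (s • (η : Cn n))) (r • (ζ : Cn n)) -
        poissonInt (fun η : unitSphere n => f (s • (η : Cn n))) (r • (ζ : Cn n))) -
        (poissonInt (fun η : unitSphere n => poissonInt g (s • (η : Cn n))) (r • (ζ : Cn n)) -
        poissonInt (fun η : unitSphere n => f (r • (η : Cn n))) (s • (ζ : Cn n)))‖ := by
        congr 1; ring
    _ ≤ ε / 2 + ε / 2 := (norm_sub_le _ _).trans (add_le_add h2 h1)
    _ = ε := by ring

/-- Every function in the `M`-harmonic Hardy space is the Poisson–Szegő integral of a function in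
`L²(σ)`, a weak limit of its dilations. -/
theorem MemHardy.exists_eq_poissonInt (hn : 1 ≤ n) {f : Cn n → ℂ} (hf : MemHardy f) :
    ∃ g : unitSphere n → ℂ, MemLp g 2 (sigma n) ∧ ∀ z ∈ unitBall n, f z = poissonInt g z := by
  obtain ⟨hM, C, hC⟩ := hf
  have hfc := hM.1.continuousOn
  let D : ∀ r : ℝ, r ∈ Set.Ico (0 : ℝ) 1 → C(unitSphere n, ℂ) := fun r hr =>
    ⟨_, continuous_dilate_of_continuousOn hfc hr.1 hr.2⟩
  classical
  -- the dilations of `f` as functionals on `L²(σ)`, extended by zero outside `0 ≤ r < 1`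
  let φ : ℝ → WeakDual ℂ (Lp ℂ 2 (sigma n)) := fun r =>
    if hr : r ∈ Set.Ico (0 : ℝ) 1 then
      StrongDual.toWeakDual (InnerProductSpace.toDual ℂ _ (toL2 n (D r hr))) else 0
  have hφ : ∀ r (hr : r ∈ Set.Ico (0 : ℝ) 1),
      φ r = StrongDual.toWeakDual (InnerProductSpace.toDual ℂ _ (toL2 n (D r hr))) :=
    fun r hr => dif_pos hr
  have hmem : ∀ᶠ r in 𝓝[<] (1 : ℝ), r ∈ Set.Ico (0 : ℝ) 1 := by
    filter_upwards [eventually_Ioo_left_one zero_lt_one] with r hr using ⟨hr.1.le, hr.2⟩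
  set B : Set (WeakDual ℂ (Lp ℂ 2 (sigma n))) :=
    WeakDual.toStrongDual ⁻¹' Metric.closedBall 0 (C : ℝ)
  have hB : IsCompact B := WeakDual.isCompact_closedBall 0 C
  have hφB : ∀ᶠ r in 𝓝[<] (1 : ℝ), φ r ∈ B := by
    filter_upwards [hmem] with r hr
    rw [hφ r hr]
    change InnerProductSpace.toDual ℂ _ (toL2 n (D r hr)) ∈ Metric.closedBall 0 (C : ℝ)
    rw [mem_closedBall_zero_iff, LinearIsometryEquiv.norm_map, Lp.norm_def]
    have h1 : eLpNorm (toL2 n (D r hr)) 2 (sigma n) ≤ C := by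
      rw [eLpNorm_congr_ae (ContinuousMap.coeFn_toLp (sigma n) (p := 2) (𝕜 := ℂ) _)]
      exact hC r hr
    simpa using ENNReal.toReal_mono ENNReal.coe_ne_top h1
  set U : Ultrafilter ℝ := Ultrafilter.of (𝓝[<] (1 : ℝ))
  have hU : (U : Filter ℝ) ≤ 𝓝[<] 1 := Ultrafilter.of_le _
  obtain ⟨ψ, -, hψ⟩ := hB.ultrafilter_le_nhds (U.map φ) (by
    rw [le_principal_iff]
    exact hU hφB)
  set g : Lp ℂ 2 (sigma n) := (InnerProductSpace.toDual ℂ _).symm (WeakDual.toStrongDual ψ)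
  refine ⟨g, Lp.memLp g, fun z hz => ?_⟩
  obtain ⟨ζ, hζ⟩ := exists_smul_sphere hn z
  set s := ‖z‖
  have hs0 : 0 ≤ s := norm_nonneg z
  have hs1 : s < 1 := norm_lt_one_of_mem hz
  rw [← hζ]
  have hsz := smul_sphere_mem_ball hs0 hs1 ζ
  -- the weak limit, tested against the kernel
  have h1 : Tendsto (fun r => φ r (toL2 n (poissonMap (s • (ζ : Cn n))))) U
      (𝓝 (ψ (toL2 n (poissonMap (s • (ζ : Cn n)))))) :=
    ((WeakDual.eval_continuous _).tendsto ψ).comp hψ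
  have h2 : ψ (toL2 n (poissonMap (s • (ζ : Cn n)))) =
      (starRingEnd ℂ) (poissonInt g (s • (ζ : Cn n))) := by
    rw [← inner_toL2_poissonMap hsz, inner_conj_symm]
    exact (InnerProductSpace.toDual_symm_apply (𝕜 := ℂ)).symm
  -- the choice of ultrafilter is immaterial: `T_s f_r = T_r f_s` converges to `f_s`
  have h3 : (fun r => φ r (toL2 n (poissonMap (s • (ζ : Cn n))))) =ᶠ[(U : Filter ℝ)] fun r =>
      (starRingEnd ℂ) (poissonInt (fun η : unitSphere n => f (s • (η : Cn n))) (r • (ζ : Cn n))) := by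
    filter_upwards [hU hmem] with r hr
    rw [hφ r hr, ← hM.poissonInt_dilate_comm hn hr.1 hr.2 hs0 hs1]
    change inner ℂ (toL2 n (D r hr)) (toL2 n (poissonMap (s • (ζ : Cn n)))) = _
    rw [← inner_conj_symm, inner_toL2_poissonMap hsz,
      poissonInt_congr_ae (ContinuousMap.coeFn_toLp (sigma n) (p := 2) (𝕜 := ℂ) _)]
    rfl
  have h4 : Tendsto (fun r : ℝ => (starRingEnd ℂ)
      (poissonInt (fun η : unitSphere n => f (s • (η : Cn n))) (r • (ζ : Cn n)))) U
      (𝓝 ((starRingEnd ℂ) (f (s • (ζ : Cn n))))) := by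
    refine (Complex.continuous_conj.tendsto _).comp (Tendsto.mono_left ?_ hU)
    rw [Metric.tendsto_nhds]
    intro ε hε
    obtain ⟨δ, hδ1, hδ0, H⟩ := poissonInt_tendsto_uniform hn
      ⟨_, continuous_dilate_of_continuousOn hfc hs0 hs1⟩ (half_pos hε)
    filter_upwards [eventually_Ioo_left_one hδ1] with r hr
    rw [dist_eq_norm]
    exact (H r hr.1 hr.2 ζ).trans_lt (by linarith)
  have h5 := tendsto_nhds_unique h4 (h1.congr' h3)
  rw [h2] at h5
  exact (starRingEnd ℂ).injective h5

/-! ### The Szegő kernel: existence and uniqueness -/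

theorem szego_comm (z w : Cn n) : szego z w = szego w z := by
  simp only [szego, poissonInt, mul_comm]

theorem memLp_poisson {z : Cn n} (hz : z ∈ unitBall n) :
    MemLp (fun ζ : unitSphere n => (poisson z (ζ : Cn n) : ℂ)) 2 (sigma n) :=
  (Complex.continuous_ofReal.comp (continuous_poisson hz)).memLp_of_hasCompactSupport
    (HasCompactSupport.of_compactSpace _)

theorem isMHarmonic_szego_right {z : Cn n} (hz : z ∈ unitBall n) :
    IsMHarmonic fun w => szego z w :=
  isMHarmonic_poissonInt (integrable_poisson hz)

theorem isRadialBoundaryValue_szego (hn : 1 ≤ n) {z : Cn n} (hz : z ∈ unitBall n) :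
    IsRadialBoundaryValue (fun w => szego z w) fun ζ => (poisson z (ζ : Cn n) : ℂ) :=
  isRadialBoundaryValue_poissonInt hn (memLp_poisson hz)

theorem memHardy_szego (hn : 1 ≤ n) {z : Cn n} (hz : z ∈ unitBall n) :
    MemHardy fun w => szego z w := by
  have h := memLp_poisson hz
  refine ⟨isMHarmonic_szego_right hz,
    (eLpNorm (fun ζ : unitSphere n => (poisson z (ζ : Cn n) : ℂ)) 2 (sigma n)).toNNReal,
    fun r hr => ?_⟩
  exact (eLpNorm_poissonInt_le hn h hr.1 hr.2).trans (ENNReal.coe_toNNReal h.2.ne).ge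

theorem IsRadialBoundaryValue.congr {f g : Cn n → ℂ} {b : unitSphere n → ℂ}
    (h : IsRadialBoundaryValue f b) (hfg : ∀ z ∈ unitBall n, g z = f z) :
    IsRadialBoundaryValue g b := by
  refine ⟨h.1, h.2.congr' ?_⟩
  filter_upwards [eventually_Ioo_left_one zero_lt_one] with r hr
  congr 1
  ext ζ
  rw [hfg _ (smul_sphere_mem_ball hr.1.le hr.2 ζ)]

theorem isSzegoKernel_szego (hn : 1 ≤ n) : IsSzegoKernel (szego (n := n)) where
  mHarmonic_left w hw := by
    simpa only [szego_comm _ w] using isMHarmonic_szego_right hw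
  memHardy_right z hz := memHardy_szego hn hz
  reproducing f hf := by
    obtain ⟨g, hg, hfg⟩ := hf.exists_eq_poissonInt hn
    refine ⟨g, (isRadialBoundaryValue_poissonInt hn hg).congr hfg, fun z hz => ?_⟩
    exact ⟨_, isRadialBoundaryValue_szego hn hz, hfg z hz⟩

/-- Uniqueness of the Szegő kernel. The function `K(z, ·)` is the Poisson–Szegő integral of its
boundary value `k`, and the reproducing property of `K` applied to `szego w` computes the same
integral `∫ k P(w, ·) dσ`. -/
theorem IsSzegoKernel.eq_szego (hn : 1 ≤ n) {K : Cn n → Cn n → ℂ} (hK : IsSzegoKernel K)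
    {z w : Cn n} (hz : z ∈ unitBall n) (hw : w ∈ unitBall n) : K z w = szego z w := by
  have hKz := hK.memHardy_right z hz
  obtain ⟨g, hg, hKg⟩ := hKz.exists_eq_poissonInt hn
  have hgb : IsRadialBoundaryValue (fun w => K z w) g :=
    (isRadialBoundaryValue_poissonInt hn hg).congr hKg
  obtain ⟨fb, hfb, H⟩ := hK.reproducing _ (memHardy_szego hn hw)
  obtain ⟨kb, hkb, hint⟩ := H z hz
  have e1 := ae_eq_of_isRadialBoundaryValue (isMHarmonic_szego_right hw).1.continuousOn hfb
    (isRadialBoundaryValue_szego hn hw)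
  have e2 := ae_eq_of_isRadialBoundaryValue hKz.1.1.continuousOn hkb hgb
  rw [hKg w hw, szego_comm, hint, poissonInt]
  refine integral_congr_ae ?_
  filter_upwards [e1, e2] with ζ h1 h2
  rw [h1, h2, mul_comm]

/-! ### Automorphisms of the ball -/

/-- The number `√(1 - |z|²)`. -/
def defect (z : Cn n) : ℝ := Real.sqrt (1 - ‖z‖ ^ 2)

/-- The automorphism of the ball exchanging `0` and `z`, written without the division by `|z|²`
of the usual formula in terms of the projection to `ℂ z`. -/
def moebius (z w : Cn n) : Cn n :=
  (1 - herm w z)⁻¹ • (z - (defect z : ℂ) • w - (herm w z * (1 + (defect z : ℂ))⁻¹) • z)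

theorem defect_sq {z : Cn n} (hz : ‖z‖ < 1) : (defect z : ℂ) ^ 2 = 1 - herm z z := by
  have h : defect z ^ 2 = 1 - ‖z‖ ^ 2 := Real.sq_sqrt (by nlinarith [norm_nonneg z])
  rw [herm_self, ← Complex.ofReal_pow, h]; push_cast; rfl

theorem one_add_defect_ne_zero (z : Cn n) : (1 + (defect z : ℂ)) ≠ 0 := by
  have : (1 + defect z : ℝ) ≠ 0 := by have := Real.sqrt_nonneg (1 - ‖z‖ ^ 2); unfold defect; linarith
  exact_mod_cast this

theorem one_sub_herm_ne_zero' {z w : Cn n} (hz : ‖z‖ < 1) (hw : ‖w‖ ≤ 1) : 1 - herm w z ≠ 0 := by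
  rw [← norm_ne_zero_iff, norm_one_sub_herm_comm]
  exact norm_ne_zero_iff.2 (one_sub_herm_ne_zero hz hw)

/-- A moebius map can be moved from one argument of `1 - ⟨·, ·⟩` to the other. -/
theorem one_sub_herm_moebius_left {z w ζ : Cn n} (hz : ‖z‖ < 1) (hw : ‖w‖ ≤ 1) (hζ : ‖ζ‖ ≤ 1) :
    (1 - herm (moebius z w) ζ) * (1 - herm w z) = (1 - herm w (moebius z ζ)) * (1 - herm z ζ) := by
  have h1 := one_sub_herm_ne_zero' hz hw
  have h2 := one_sub_herm_ne_zero hz hζ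
  have h3 := one_add_defect_ne_zero z
  rw [moebius, moebius, herm_smul_left, herm_smul_right, herm_sub_left, herm_sub_left,
    herm_sub_right, herm_sub_right, herm_smul_left, herm_smul_left, herm_smul_right,
    herm_smul_right]
  simp only [map_inv₀, map_sub, map_one, map_mul, map_add, conj_herm, Complex.conj_ofReal]
  field_simp
  ring

theorem one_sub_herm_moebius {z a b : Cn n} (hz : ‖z‖ < 1) (ha : ‖a‖ ≤ 1) (hb : ‖b‖ ≤ 1) :
    1 - herm (moebius z a) (moebius z b) =
      (1 - herm z z) * (1 - herm a b) * ((1 - herm a z)⁻¹ * (1 - herm z b)⁻¹) := by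
  have h1 := one_sub_herm_ne_zero' hz ha
  have h2 := one_sub_herm_ne_zero hz hb
  have h3 := one_add_defect_ne_zero z
  have h4 := defect_sq hz
  have h5 : herm z z = 1 - (defect z : ℂ) ^ 2 := by rw [h4]; ring
  rw [moebius, moebius, herm_smul_left, herm_smul_right, herm_sub_left, herm_sub_left]
  simp only [herm_smul_left, herm_sub_right, herm_smul_right, map_inv₀, map_sub, map_one, map_mul,
    map_add, conj_herm, Complex.conj_ofReal, h5]
  field_simp
  ring

theorem moebius_zero (z : Cn n) : moebius z 0 = z := by simp [moebius]

theorem one_sub_herm_moebius_self {z w : Cn n} (hz : ‖z‖ < 1) (hw : ‖w‖ ≤ 1) :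
    1 - herm (moebius z w) z = (1 - herm z z) * (1 - herm w z)⁻¹ := by
  have h := one_sub_herm_moebius hz hw (b := 0) (by simp)
  simpa [moebius_zero] using h

theorem one_sub_normSq_moebius {z w : Cn n} (hz : ‖z‖ < 1) (hw : ‖w‖ ≤ 1) :
    1 - ‖moebius z w‖ ^ 2 = (1 - ‖z‖ ^ 2) * (1 - ‖w‖ ^ 2) / ‖1 - herm z w‖ ^ 2 := by
  have h := one_sub_herm_moebius hz hw hw
  rw [herm_self, herm_self, herm_self, ← mul_inv, ← normSq_one_sub_herm,
    norm_one_sub_herm_comm] at h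
  rw [div_eq_mul_inv]
  exact_mod_cast h

theorem norm_one_sub_herm_pos {z w : Cn n} (hz : ‖z‖ < 1) (hw : ‖w‖ ≤ 1) : 0 < ‖1 - herm z w‖ :=
  norm_pos_iff.2 (one_sub_herm_ne_zero hz hw)

theorem norm_moebius_lt_one {z w : Cn n} (hz : ‖z‖ < 1) (hw : ‖w‖ < 1) : ‖moebius z w‖ < 1 := by
  have h := one_sub_normSq_moebius hz hw.le
  have h1 := norm_one_sub_herm_pos hz hw.le
  have h2 : 0 < 1 - ‖z‖ ^ 2 := by nlinarith [norm_nonneg z]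
  have h3 : 0 < 1 - ‖w‖ ^ 2 := by nlinarith [norm_nonneg w]
  have h4 : 0 < 1 - ‖moebius z w‖ ^ 2 := by rw [h]; positivity
  nlinarith [norm_nonneg (moebius z w)]

/-- The action of a ball automorphism on the sphere. -/
def moebiusSphere {z : Cn n} (hz : ‖z‖ < 1) : C(unitSphere n, unitSphere n) where
  toFun ζ := ⟨moebius z ζ, by
    have h := one_sub_normSq_moebius hz (norm_sphere ζ).le
    rw [norm_sphere] at h
    simp only [one_pow, sub_self, mul_zero, zero_div] at h
    rw [mem_sphere_zero_iff_norm]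
    nlinarith [norm_nonneg (moebius z (ζ : Cn n))]⟩
  continuous_toFun := by
    refine Continuous.subtype_mk ?_ _
    unfold moebius
    exact (Continuous.inv₀ (by fun_prop)
      fun ζ => one_sub_herm_ne_zero' hz (norm_sphere ζ).le).smul (by fun_prop)

theorem coe_moebiusSphere {z : Cn n} (hz : ‖z‖ < 1) (ζ : unitSphere n) :
    (moebiusSphere hz ζ : Cn n) = moebius z ζ := rfl

/-- The Poisson–Szegő kernel is covariant under ball automorphisms. -/
theorem poisson_moebius {z w : Cn n} (hz : ‖z‖ < 1) (hw : ‖w‖ < 1) (ζ : unitSphere n) :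
    poisson w (moebius z ζ) =
      ((1 - ‖z‖ ^ 2) ^ n)⁻¹ * (‖1 - herm z ζ‖ ^ (2 * n) * poisson (moebius z w) (ζ : Cn n)) := by
  have h1 := congrArg norm (one_sub_herm_moebius_left hz hw.le (norm_sphere ζ).le)
  rw [norm_mul, norm_mul, norm_one_sub_herm_comm w z] at h1
  have p1 := norm_one_sub_herm_pos hz hw.le
  have p2 := norm_one_sub_herm_pos hz (norm_sphere ζ).le
  have p3 := norm_one_sub_herm_pos (norm_moebius_lt_one hz hw) (norm_sphere ζ).le
  have p4 : 0 < ‖1 - herm w (moebius z ζ)‖ :=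
    norm_one_sub_herm_pos hw (norm_sphere (moebiusSphere hz ζ)).le
  have h2 : 0 < 1 - ‖z‖ ^ 2 := by nlinarith [norm_nonneg z]
  rw [poisson, poisson, one_sub_normSq_moebius hz hw.le]
  have h3 : ‖1 - herm w (moebius z ζ)‖ =
      ‖1 - herm (moebius z w) ζ‖ * ‖1 - herm z w‖ / ‖1 - herm z (ζ : Cn n)‖ := by
    rw [h1]; field_simp
  rw [h3, div_pow, mul_pow, div_pow, mul_pow, ← pow_mul]
  field_simp

/-- `∫ P(w, φ(ζ)) dσ(ζ)`, where `φ` is the automorphism of the ball exchanging `0` and `z`. -/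
def moebiusInt (z w : Cn n) : ℂ :=
  ∫ ζ : unitSphere n, (poisson w (moebius z ζ) : ℂ) ∂(sigma n)

theorem isMHarmonic_moebiusInt {z : Cn n} (hz : ‖z‖ < 1) : IsMHarmonic (moebiusInt z) := by
  let L : C(unitSphere n, ℂ) →L[ℂ] ℂ :=
    (integralCLM (integrable_of_continuous (n := n) (continuous_const (y := (1 : ℂ))))).comp
      (ContinuousMap.compCLM ℂ ℂ (moebiusSphere hz))
  refine (isMHarmonic_functional contDiffOn_poissonMap isMHarmonic_poissonMap_apply L).congr
    fun w hw => ?_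
  have : L (poissonMap w) = ∫ ζ, 1 * poissonMap w (moebiusSphere hz ζ) ∂(sigma n) := rfl
  rw [this]
  simp only [poissonMap_apply hw, one_mul, moebiusInt, coe_moebiusSphere]

theorem moebiusInt_eq {z w : Cn n} (hz : ‖z‖ < 1) (hw : ‖w‖ < 1) : moebiusInt z w =
    ((1 - (‖z‖ : ℂ) ^ 2) ^ n)⁻¹ *
      poissonInt (fun ζ : unitSphere n => ((‖1 - herm z ζ‖ ^ (2 * n) : ℝ) : ℂ)) (moebius z w) := by
  rw [moebiusInt, poissonInt, ← integral_const_mul]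
  refine integral_congr_ae (Eventually.of_forall fun ζ => ?_)
  simp only [poisson_moebius hz hw]
  push_cast
  rfl

/-- The change of variables `ζ ↦ φ(ζ)` in `∫ P(z, ζ) P(w, ζ) dσ(ζ)`. Both sides are `M`-harmonic in
`w` with the same boundary values. -/
theorem szego_eq_moebiusInt (hn : 1 ≤ n) {z w : Cn n} (hz : z ∈ unitBall n) (hw : w ∈ unitBall n) :
    szego z w = massInv n * moebiusInt z w := by
  have hz' := norm_lt_one_of_mem hz
  have hz2 : 0 < 1 - ‖z‖ ^ 2 := by nlinarith [norm_nonneg z]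
  set F : Cn n → ℂ := fun v => (((1 - ‖z‖ ^ 2) ^ n / ‖1 - herm z v‖ ^ (2 * n) : ℝ) : ℂ)
  have hF : ContinuousOn F (Metric.closedBall 0 1) := by
    refine Complex.continuous_ofReal.comp_continuousOn (ContinuousOn.div (by fun_prop)
      (Continuous.continuousOn (by fun_prop)) fun v hv => ?_)
    exact (pow_pos (norm_one_sub_herm_pos hz' (by simpa using hv)) _).ne'
  have key : moebiusInt z w = poissonInt (fun ζ : unitSphere n => F ζ) w := by
    refine (isMHarmonic_moebiusInt hz').eq_poissonInt hn hF (fun ε hε => ?_) hw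
    set h : Cn n → ℂ := fun v => ((‖1 - herm z v‖ ^ (2 * n) : ℝ) : ℂ)
    have hc : Continuous h := by fun_prop
    obtain ⟨δ, hδ, H⟩ := poissonInt_sub_boundary hn hc.continuousOn
      (ε := ε * (1 - ‖z‖ ^ 2) ^ n) (by positivity)
    set δ' := max δ 0
    have hδ' : δ' < 1 := max_lt hδ one_pos
    have hδ0 : 0 ≤ δ' := le_max_right _ _
    have hδ2 : 0 < 1 - δ' ^ 2 := by nlinarith
    have hz1 : 0 < (1 - ‖z‖) ^ 2 := by
      have : 0 < 1 - ‖z‖ := by linarith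
      positivity
    refine ⟨1 - (1 - δ' ^ 2) * (1 - ‖z‖) ^ 2 / 2, by
      have := mul_pos hδ2 hz1; linarith, fun v hv hv1 => ?_⟩
    have hm1 := norm_moebius_lt_one hz' hv1
    have hm : δ' < ‖moebius z v‖ := by
      have h1 := one_sub_normSq_moebius hz' hv1.le
      have h2 : 1 - ‖z‖ ≤ ‖1 - herm z v‖ := by
        have h3 := norm_sub_norm_le (1 : ℂ) (herm z v)
        have h4 := norm_herm_le z v
        rw [norm_one] at h3
        nlinarith [norm_nonneg z, norm_nonneg v]
      have h3 : 1 - ‖moebius z v‖ ^ 2 < 1 - δ' ^ 2 := by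
        rw [h1, div_lt_iff₀ (pow_pos (norm_one_sub_herm_pos hz' hv1.le) 2)]
        have h4 : 1 - ‖v‖ ^ 2 < (1 - δ' ^ 2) * (1 - ‖z‖) ^ 2 := by nlinarith [norm_nonneg v]
        have h5 : (1 - ‖z‖) ^ 2 ≤ ‖1 - herm z v‖ ^ 2 :=
          pow_le_pow_left₀ (by linarith) h2 2
        have h6 : 0 ≤ 1 - ‖v‖ ^ 2 := by nlinarith [norm_nonneg v]
        have h7 : (1 - ‖z‖ ^ 2) * (1 - ‖v‖ ^ 2) ≤ 1 - ‖v‖ ^ 2 := by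
          nlinarith [sq_nonneg ‖z‖]
        calc _ ≤ 1 - ‖v‖ ^ 2 := h7
          _ < _ := h4
          _ ≤ _ := by gcongr
      nlinarith [norm_nonneg (moebius z v)]
    have h1 := H (moebius z v) ((le_max_left _ _).trans_lt hm) hm1
    have h2 : F v = ((1 - (‖z‖ : ℂ) ^ 2) ^ n)⁻¹ * h (moebius z v) := by
      have h3 := congrArg norm (one_sub_herm_moebius_self hz' hv1.le)
      rw [norm_one_sub_herm_comm, norm_mul, norm_inv, norm_one_sub_herm_comm v z, herm_self] at h3
      have h4 : ‖1 - (‖z‖ : ℂ) ^ 2‖ = 1 - ‖z‖ ^ 2 := by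
        rw [← Complex.ofReal_pow, ← Complex.ofReal_one, ← Complex.ofReal_sub, Complex.norm_real,
          Real.norm_of_nonneg hz2.le]
      rw [h4] at h3
      have h5 : (1 - ‖z‖ ^ 2) ^ n / ‖1 - herm z v‖ ^ (2 * n) =
          ((1 - ‖z‖ ^ 2) ^ n)⁻¹ * ‖1 - herm z (moebius z v)‖ ^ (2 * n) := by
        have := norm_one_sub_herm_pos hz' hv1.le
        rw [h3, mul_pow, inv_pow, pow_mul' (1 - ‖z‖ ^ 2) 2 n]
        field_simp
      simp only [F, h, h5]
      push_cast
      rfl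
    rw [moebiusInt_eq hz' hv1, h2, ← mul_sub, norm_mul]
    have h6 : ‖((1 - (‖z‖ : ℂ) ^ 2) ^ n)⁻¹‖ = ((1 - ‖z‖ ^ 2) ^ n)⁻¹ := by
      rw [norm_inv, norm_pow, ← Complex.ofReal_pow, ← Complex.ofReal_one, ← Complex.ofReal_sub,
        Complex.norm_real, Real.norm_of_nonneg hz2.le]
    rw [h6, inv_mul_le_iff₀ (by positivity), mul_comm _ ε]
    exact h1
  rw [key, ← poissonInt_const_mul, szego]
  simp only [F, poisson]
  push_cast
  rfl

/-- The Szegő kernel as an integral over the sphere after the automorphism `φ` exchanging `0` and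
`z`, with `b = φ(w)`. -/
theorem szego_eq_integral (hn : 1 ≤ n) {z w : Cn n} (hz : z ∈ unitBall n) (hw : w ∈ unitBall n) :
    szego z w = massInv n * ((1 - (‖w‖ : ℂ) ^ 2) ^ n / (‖1 - herm z w‖ : ℂ) ^ (2 * n)) *
      (massInv n * ∫ ζ : unitSphere n, ((1 - herm z ζ) ^ n * (1 - herm ζ z) ^ n) *
        (((1 - herm (moebius z w) ζ) ^ n)⁻¹ * ((1 - herm ζ (moebius z w)) ^ n)⁻¹) ∂(sigma n)) := by
  have hz' := norm_lt_one_of_mem hz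
  have hw' := norm_lt_one_of_mem hw
  have h2 : (1 - (‖z‖ : ℂ) ^ 2) ≠ 0 := one_sub_normSq_ne_zero hz
  have h3 : (1 - herm (moebius z w) (moebius z w)) =
      (1 - (‖z‖ : ℂ) ^ 2) * (1 - (‖w‖ : ℂ) ^ 2) / (‖1 - herm z w‖ : ℂ) ^ 2 := by
    rw [herm_self]
    exact_mod_cast congrArg (fun x : ℝ => (x : ℂ)) (one_sub_normSq_moebius hz' hw'.le)
  rw [szego_eq_moebiusInt hn hz hw, moebiusInt_eq hz' hw', poissonInt]
  simp only [poisson_eq, h3]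
  rw [mul_assoc (massInv n : ℂ)]
  congr 1
  simp only [← integral_const_mul]
  refine integral_congr_ae (Eventually.of_forall fun ζ => ?_)
  have h5 : (((‖1 - herm z (ζ : Cn n)‖ ^ (2 * n) : ℝ)) : ℂ) =
      (1 - herm z ζ) ^ n * (1 - herm (ζ : Cn n) z) ^ n := by
    rw [pow_mul]; push_cast; rw [normSq_one_sub_herm, mul_pow]
  simp only [h5, div_pow, mul_pow, ← pow_mul]
  field_simp

/-! ### Pochhammer symbols -/

theorem poch_add (a : ℂ) (j k : ℕ) : poch a (j + k) = poch a j * poch (a + j) k := by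
  rw [poch, ← ascPochhammer_mul]
  simp [poch]

theorem poch_natCast (d l : ℕ) : poch ((d + 1 : ℕ) : ℂ) l = l.factorial * (l + d).choose d := by
  rw [poch, ascPochhammer_nat_eq_natCast_ascFactorial, Nat.ascFactorial_eq_factorial_mul_choose,
    add_comm d l, Nat.choose_symm_add]
  push_cast
  rfl

theorem poch_natCast_ne_zero (hn : 1 ≤ n) (l : ℕ) : poch n l ≠ 0 := by
  obtain ⟨d, rfl⟩ := Nat.exists_eq_add_of_le' hn
  rw [poch_natCast]
  exact mul_ne_zero (by exact_mod_cast l.factorial_ne_zero)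
    (by exact_mod_cast (Nat.choose_pos (Nat.le_add_left d l)).ne')

theorem poch_neg_natCast (n j : ℕ) :
    poch (-n) j / j.factorial = (-1) ^ j * n.choose j := by
  have h : (j.factorial : ℂ) ≠ 0 := by exact_mod_cast j.factorial_ne_zero
  rw [poch, ascPochhammer_eval_neg_eq_descPochhammer, descPochhammer_eval_eq_descFactorial,
    Nat.descFactorial_eq_factorial_mul_choose]
  push_cast
  field_simp

theorem one_sub_pow_eq_sum (n : ℕ) (x : ℂ) :
    (1 - x) ^ n = ∑ j ∈ Finset.range (n + 1), poch (-n) j / j.factorial * x ^ j := by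
  rw [sub_eq_neg_add, add_pow]
  refine Finset.sum_congr rfl fun j _ => ?_
  rw [poch_neg_natCast, neg_pow, one_pow]
  ring

theorem hasSum_poch_smul_pow (hn : 1 ≤ n) {u : C(unitSphere n, ℂ)} (hu : ‖u‖ < 1) :
    HasSum (fun l : ℕ => (poch n l / l.factorial) • u ^ l) (Ring.inverse (1 - u) ^ n) := by
  obtain ⟨d, hd⟩ := Nat.exists_eq_add_of_le' hn
  have h := hasSum_choose_mul_geometric_of_norm_lt_one' d hu
  rw [← hd] at h
  refine h.congr_fun fun l => ?_
  have hl : (l.factorial : ℂ) ≠ 0 := by exact_mod_cast l.factorial_ne_zero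
  have : poch n l / l.factorial = ((l + d).choose d : ℂ) := by
    rw [hd, poch_natCast]; field_simp
  rw [this]
  ext ζ
  simp

theorem summable_norm_poch_smul_pow (hn : 1 ≤ n) {u : C(unitSphere n, ℂ)} (hu : ‖u‖ < 1) :
    Summable (fun l : ℕ => ‖(poch n l / l.factorial) • u ^ l‖) := by
  obtain ⟨d, hd⟩ := Nat.exists_eq_add_of_le' hn
  have h := summable_choose_mul_geometric_of_norm_lt_one d (r := ‖u‖) (by simpa using hu)
  refine h.of_nonneg_of_le (fun l => norm_nonneg _) fun l => ?_
  have hl : (l.factorial : ℂ) ≠ 0 := by exact_mod_cast l.factorial_ne_zero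
  have : poch n l / l.factorial = ((l + d).choose d : ℂ) := by
    rw [hd, poch_natCast]; field_simp
  rw [this, ContinuousMap.norm_le _ (by positivity)]
  intro ζ
  simp only [ContinuousMap.smul_apply, ContinuousMap.pow_apply, norm_smul, norm_pow,
    Complex.norm_natCast]
  gcongr
  exact u.norm_coe_le_norm ζ

/-! ### Moments of the surface measure -/

/-- Scalar multiplication by a complex number of modulus one. -/
def phaseIsometry (n : ℕ) (a : ℂ) (ha : ‖a‖ = 1) : Cn n ≃ₗᵢ[ℝ] Cn n :=
  { (LinearEquiv.smulOfNeZero ℂ (Cn n) a (norm_ne_zero_iff.1 (by rw [ha]; exact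
      one_ne_zero))).restrictScalars ℝ with
    norm_map' := fun v => by
      change ‖a • v‖ = ‖v‖
      rw [norm_smul, ha, one_mul] }

/-- A function of nonzero weight `p - q` under the action of the circle has integral zero. -/
theorem integral_eq_zero_of_phase {G : unitSphere n → ℂ} {p q : ℕ} (hpq : p ≠ q)
    (hG : ∀ (a : ℂ) (ζ η : unitSphere n), (η : Cn n) = a • (ζ : Cn n) →
      G η = a ^ p * (starRingEnd ℂ) a ^ q * G ζ) : ∫ ζ, G ζ ∂(sigma n) = 0 := by
  have hpq' : ((p : ℂ) - q) ≠ 0 := sub_ne_zero.2 (by exact_mod_cast hpq)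
  set θ : ℝ := Real.pi / (p - q)
  set a : ℂ := Complex.exp (θ * Complex.I)
  have ha : ‖a‖ = 1 := Complex.norm_exp_ofReal_mul_I θ
  have h1 : a ^ p * (starRingEnd ℂ) a ^ q = -1 := by
    have : (starRingEnd ℂ) a = Complex.exp (-(θ * Complex.I)) := by
      rw [← Complex.exp_conj]; simp
    rw [this, ← Complex.exp_nat_mul, ← Complex.exp_nat_mul, ← Complex.exp_add,
      ← Complex.exp_pi_mul_I]
    congr 1
    simp only [θ]
    push_cast
    field_simp
    ring
  have h2 := integral_sphereMap (phaseIsometry n a ha) G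
  have h3 : ∀ ζ, G (sphereMap (phaseIsometry n a ha) ζ) = -1 * G ζ := by
    intro ζ
    rw [hG a ζ (sphereMap (phaseIsometry n a ha) ζ) rfl, h1]
  simp only [h3, integral_const_mul] at h2
  have h4 : (2 : ℂ) * ∫ ζ, G ζ ∂(sigma n) = 0 := by linear_combination -h2
  simpa using h4

theorem contDiff_complex_herm (y : Cn n) : ContDiff ℂ 2 fun w : Cn n => herm w y := by
  simp only [herm_eq_inner]
  exact (innerSL ℂ y).contDiff

/-- The Cauchy–Szegő formula for the holomorphic polynomial `⟨·, y⟩ᴺ`, a consequence of the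
Poisson–Szegő formula for `⟨·, y⟩ᴺ (1 - ⟨·, x⟩)ⁿ` at `x`. -/
theorem cauchy_formula (hn : 1 ≤ n) {x : Cn n} (hx : x ∈ unitBall n) (y : Cn n) (N : ℕ) :
    herm x y ^ N = massInv n *
      ∫ ζ : unitSphere n, herm ζ y ^ N * ((1 - herm x ζ) ^ n)⁻¹ ∂(sigma n) := by
  set f : Cn n → ℂ := fun w => herm w y ^ N * (1 - herm w x) ^ n
  have hf : ContDiff ℂ 2 f := ((contDiff_complex_herm y).pow N).mul
    ((contDiff_const.sub (contDiff_complex_herm x)).pow n)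
  have h := (isMHarmonic_of_contDiff_complex hf).eq_poissonInt hn hf.continuous.continuousOn
    (fun ε hε => ⟨0, one_pos, fun z _ _ => by simpa using hε.le⟩) hx
  have hA : (1 - herm x x) ^ n ≠ 0 := by
    rw [herm_self]; exact pow_ne_zero n (one_sub_normSq_ne_zero hx)
  have h1 : poissonInt (fun ζ : unitSphere n => f ζ) x = (1 - herm x x) ^ n * (massInv n *
      ∫ ζ : unitSphere n, herm ζ y ^ N * ((1 - herm x ζ) ^ n)⁻¹ ∂(sigma n)) := by
    rw [poissonInt]
    simp only [← integral_const_mul]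
    refine integral_congr_ae (Eventually.of_forall fun ζ => ?_)
    have h2 := one_sub_herm_ne_zero' (norm_lt_one_of_mem hx) (norm_sphere ζ).le
    have h3 := one_sub_herm_ne_zero (norm_lt_one_of_mem hx) (norm_sphere ζ).le
    simp only [poisson_eq, f]
    field_simp
  rw [h1] at h
  have h4 : f x = (1 - herm x x) ^ n * herm x y ^ N := mul_comm _ _
  rw [h4] at h
  exact mul_left_cancel₀ hA h

/-- Expanding the Cauchy–Szegő kernel in `cauchy_formula`, only the term of degree `N` survives. -/
theorem integral_herm_pow_of_mem (hn : 1 ≤ n) {x : Cn n} (hx : x ∈ unitBall n) (y : Cn n)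
    (N : ℕ) : massInv n * ∫ ζ : unitSphere n, herm ζ y ^ N * herm x ζ ^ N ∂(sigma n) =
      N.factorial / poch n N * herm x y ^ N := by
  have hu : ‖hermMap n x‖ < 1 := (norm_hermMap_le x).trans_lt (norm_lt_one_of_mem hx)
  let F : C(unitSphere n, ℂ) := ⟨fun ζ => herm ζ y ^ N, by fun_prop⟩
  set L := integralCLM (integrable_of_continuous (n := n) F.continuous)
  have h1 := (hasSum_poch_smul_pow hn hu).mapL L
  have h2 : L (Ring.inverse (1 - hermMap n x) ^ n) =
      ∫ ζ : unitSphere n, herm ζ y ^ N * ((1 - herm x ζ) ^ n)⁻¹ ∂(sigma n) := by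
    simp only [L, integralCLM_apply]
    refine integral_congr_ae (Eventually.of_forall fun ζ => ?_)
    simp only [ContinuousMap.pow_apply,
      ContinuousMap.ringInverse_apply (isUnit_one_sub_of_norm_lt hu)]
    simp [F]
  have h3 : ∀ l, L ((poch n l / l.factorial) • hermMap n x ^ l) = poch n l / l.factorial *
      ∫ ζ : unitSphere n, herm ζ y ^ N * herm x ζ ^ l ∂(sigma n) := by
    intro l
    rw [map_smul, smul_eq_mul]
    rfl
  simp only [h3] at h1
  have h4 := h1.unique (hasSum_single N fun l hl => by
    rw [integral_eq_zero_of_phase (p := N) (q := l) hl.symm, mul_zero]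
    intro a ζ η hη
    rw [hη, herm_smul_left, herm_smul_right]
    ring)
  have h5 := cauchy_formula hn hx y N
  rw [← h2, h4] at h5
  have hl : (N.factorial : ℂ) ≠ 0 := by exact_mod_cast N.factorial_ne_zero
  have hp := poch_natCast_ne_zero hn N
  rw [h5]
  field_simp

theorem integral_herm_pow (hn : 1 ≤ n) (x y : Cn n) (N : ℕ) :
    massInv n * ∫ ζ : unitSphere n, herm ζ y ^ N * herm x ζ ^ N ∂(sigma n) =
      N.factorial / poch n N * herm x y ^ N := by
  set t : ℝ := ‖x‖ + 1
  have ht : 0 < t := by positivity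
  have hx : t⁻¹ • x ∈ unitBall n := by
    rw [mem_ball_zero_iff, norm_smul, norm_inv, Real.norm_of_nonneg ht.le,
      inv_mul_lt_iff₀ ht]
    simp only [t]; linarith
  have h := integral_herm_pow_of_mem hn hx y N
  simp only [herm_real_smul_left, mul_pow, mul_left_comm _ ((((t⁻¹ : ℝ)) : ℂ) ^ N)] at h
  rw [integral_const_mul, mul_left_comm] at h
  refine mul_left_cancel₀ (pow_ne_zero N ?_) h
  exact_mod_cast (inv_pos.2 ht).ne'

open Polynomial in
theorem coeff_C_add_C_mul_X_pow (a b : ℂ) (j p : ℕ) :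
    ((C a + C b * X) ^ j).coeff p = (j.choose p : ℂ) * a ^ (j - p) * b ^ p := by
  rw [add_comm, add_pow]
  simp only [mul_pow, ← C_pow, ← C_eq_natCast, mul_assoc, finsetSum_coeff, coeff_C_mul]
  have : ∀ m, (X ^ m * (C (a ^ (j - m)) * C (j.choose m : ℂ))).coeff p =
      if m = p then a ^ (j - m) * (j.choose m : ℂ) else 0 := by
    intro m
    rw [← C_mul, mul_comm, coeff_C_mul, coeff_X_pow]
    simp [eq_comm]
  simp only [this, mul_ite, mul_zero, Finset.sum_ite_eq', Finset.mem_range]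
  split_ifs with h
  · ring
  · rw [Nat.choose_eq_zero_of_lt (by omega)]; simp

open Polynomial in
theorem eq_of_forall_sum_pow_eq {N : ℕ} {a b : ℕ → ℂ}
    (h : ∀ t : ℂ, ∑ l ∈ Finset.range (N + 1), t ^ l * a l =
      ∑ l ∈ Finset.range (N + 1), t ^ l * b l) {l : ℕ} (hl : l ≤ N) : a l = b l := by
  have h1 : (∑ l ∈ Finset.range (N + 1), C (a l) * X ^ l : ℂ[X]) =
      ∑ l ∈ Finset.range (N + 1), C (b l) * X ^ l := by
    refine Polynomial.funext fun t => ?_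
    simp only [eval_finsetSum, eval_mul, eval_C, eval_pow, eval_X]
    simpa only [mul_comm] using h t
  have h2 := congrArg (fun p : ℂ[X] => p.coeff l) h1
  simpa [finsetSum_coeff, coeff_C_mul, coeff_X_pow, Nat.lt_succ_iff.2 hl] using h2

/-- The normalized moment `∫ ⟨z,ζ⟩ʲ ⟨b,ζ⟩ˡ ⟨ζ,z⟩ᵏ ⟨ζ,b⟩ᵐ dσ(ζ) / σ(∂𝔹)`. -/
def moment (z b : Cn n) (j l k m : ℕ) : ℂ :=
  massInv n * ∫ ζ : unitSphere n,
    herm z ζ ^ j * herm b ζ ^ l * (herm ζ z ^ k * herm ζ b ^ m) ∂(sigma n)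

theorem moment_eq_zero (z b : Cn n) {j l k m : ℕ} (h : j + l ≠ k + m) : moment z b j l k m = 0 := by
  rw [moment, integral_eq_zero_of_phase (p := k + m) (q := j + l) h.symm, mul_zero]
  intro a ζ η hη
  rw [hη, herm_smul_left, herm_smul_left, herm_smul_right, herm_smul_right]
  ring

/-- The moments with all bidegrees, by polarization of `integral_herm_pow`: comparing coefficients
of powers of `s` and `t` for `x = z + s b` and `y = z + t̄ b`. -/
theorem choose_mul_moment (hn : 1 ≤ n) (z b : Cn n) {j l k m : ℕ} (h : j + l = k + m) :
    ((j + l).choose m : ℂ) * moment z b j l k m = (j + l).factorial / poch n (j + l) *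
      ∑ p ∈ Finset.range (m + 1), ((j.choose p : ℂ) * herm z z ^ (j - p) * herm z b ^ p) *
        ((l.choose (m - p) : ℂ) * herm b z ^ (l - (m - p)) * herm b b ^ (m - p)) := by
  set N := j + l with hN
  set c : ℂ := N.factorial / poch n N
  have hint : ∀ j l k m : ℕ, Integrable (fun ζ : unitSphere n =>
      herm z ζ ^ j * herm b ζ ^ l * (herm ζ z ^ k * herm ζ b ^ m)) (sigma n) :=
    fun j l k m => integrable_of_continuous (by fun_prop)
  have h1 : ∀ s t : ℂ, ∑ l ∈ Finset.range (N + 1), s ^ l * ((N.choose l : ℂ) *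
      ∑ m ∈ Finset.range (N + 1), t ^ m * ((N.choose m : ℂ) * moment z b (N - l) l (N - m) m)) =
      ∑ l ∈ Finset.range (N + 1), s ^ l * ((N.choose l : ℂ) *
        (c * ((herm z z + t * herm z b) ^ (N - l) * (herm b z + t * herm b b) ^ l))) := by
    intro s t
    have h2 := integral_herm_pow hn (z + s • b) (z + (starRingEnd ℂ) t • b) N
    simp only [herm_add_left, herm_add_right, herm_smul_left, herm_smul_right,
      Complex.conj_conj] at h2
    have h3 : ∀ ζ : unitSphere n, (herm (ζ : Cn n) z + t * herm (ζ : Cn n) b) ^ N *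
        (herm z ζ + s * herm b ζ) ^ N = ∑ l ∈ Finset.range (N + 1), ∑ m ∈ Finset.range (N + 1),
          (s ^ l * (N.choose l : ℂ) * (t ^ m * (N.choose m : ℂ))) *
          (herm z ζ ^ (N - l) * herm b ζ ^ l * (herm ζ z ^ (N - m) * herm ζ b ^ m)) := by
      intro ζ
      rw [add_comm (herm (ζ : Cn n) z), add_comm (herm z ζ), add_pow, add_pow,
        Finset.sum_mul_sum, Finset.sum_comm]
      refine Finset.sum_congr rfl fun l _ => Finset.sum_congr rfl fun m _ => ?_
      rw [mul_pow, mul_pow]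
      ring
    simp only [h3] at h2
    rw [integral_finsetSum _ fun l _ => integrable_finsetSum _ fun m _ =>
      (hint (N - l) l (N - m) m).const_mul _] at h2
    have h4 : herm z z + s * herm b z + t * (herm z b + s * herm b b) =
      s * (herm b z + t * herm b b) + (herm z z + t * herm z b) := by ring
    rw [h4, add_pow] at h2
    simp only [integral_finsetSum _ fun m _ => (hint _ _ (N - m) m).const_mul _,
      integral_const_mul, Finset.mul_sum] at h2
    simp only [Finset.mul_sum]
    refine Eq.trans ?_ (h2.trans ?_)
    · refine Finset.sum_congr rfl fun l _ => Finset.sum_congr rfl fun m _ => ?_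
      rw [moment]; ring
    · refine Finset.sum_congr rfl fun l _ => ?_
      rw [mul_pow]; ring
  have h2 : ∀ t : ℂ, ∑ m ∈ Finset.range (N + 1), t ^ m * ((N.choose m : ℂ) *
      moment z b j l (N - m) m) =
      c * ((herm z z + t * herm z b) ^ j * (herm b z + t * herm b b) ^ l) := by
    intro t
    have h3 := eq_of_forall_sum_pow_eq (fun s => h1 s t) (l := l) (by omega)
    have h4 : ((N.choose l : ℂ)) ≠ 0 := by
      exact_mod_cast (Nat.choose_pos (by omega : l ≤ N)).ne'
    have h5 := mul_left_cancel₀ h4 h3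
    rwa [show N - l = j by omega] at h5
  open Polynomial in
  have h3 : (∑ m ∈ Finset.range (N + 1), C ((N.choose m : ℂ) * moment z b j l (N - m) m) * X ^ m
      : ℂ[X]) = C c * ((C (herm z z) + C (herm z b) * X) ^ j *
        (C (herm b z) + C (herm b b) * X) ^ l) := by
    refine Polynomial.funext fun t => ?_
    simp only [eval_finsetSum, eval_mul, eval_C, eval_pow, eval_X, eval_add]
    rw [mul_comm (herm z b), mul_comm (herm b b), ← h2 t]
    exact Finset.sum_congr rfl fun m _ => mul_comm _ _
  have h4 := congrArg (fun p : Polynomial ℂ => p.coeff m) h3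
  have hm : m < N + 1 := by omega
  have hk : N - m = k := by omega
  simp only [Polynomial.finsetSum_coeff, Polynomial.coeff_C_mul, Polynomial.coeff_X_pow, mul_ite,
    mul_one, mul_zero, Finset.sum_ite_eq, Finset.mem_range, hm, if_true, hk] at h4
  rw [Polynomial.coeff_mul, Finset.Nat.sum_antidiagonal_eq_sum_range_succ_mk] at h4
  simp only [coeff_C_add_C_mul_X_pow] at h4
  exact h4

/-! ### The hypergeometric expansion -/

/-- The general term of the expansion of the Szegő kernel: `i`, `p`, `c`, `q` count the factors
`⟨z, z⟩`, `⟨z, b⟩`, `⟨b, z⟩`, `⟨b, b⟩` arising from a moment. -/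
def kernelTerm (z b : Cn n) (i c p q : ℕ) : ℂ :=
  poch (-n) (i + c) * poch (-n) (i + p) * poch n (c + q) * poch n (p + q) /
    (i.factorial * c.factorial * p.factorial * q.factorial * poch n (i + c + p + q)) *
      (herm z z ^ i * herm b z ^ c * herm z b ^ p * herm b b ^ q)

/-- The sum of `kernelTerm` over its last index. -/
def kernelSum (z b : Cn n) (i c p : ℕ) : ℂ :=
  (poch (-n) (i + c) * poch (-n) (i + p) * poch n c * poch n p) /
      ((i.factorial : ℂ) * (c.factorial : ℂ) * (p.factorial : ℂ) * poch n (i + c + p)) *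
    herm z z ^ i * herm b z ^ c * herm z b ^ p *
      ₂F₁ ((c : ℂ) + n) ((p : ℂ) + n) ((i : ℂ) + c + p + n) (herm b b)

theorem hasSum_kernelTerm (hn : 1 ≤ n) (z : Cn n) {b : Cn n} (hb : ‖b‖ < 1) (i c p : ℕ) :
    HasSum (fun q => kernelTerm z b i c p q) (kernelSum z b i c p) := by
  have hne : ∀ a kn : ℕ, (kn : ℂ) ≠ -((a : ℂ) + n) := by
    intro a kn h
    have h1 : ((kn + (a + n) : ℕ) : ℂ) = 0 := by push_cast; rw [h]; ring
    have h2 : kn + (a + n) = 0 := by exact_mod_cast h1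
    omega
  have hr := ordinaryHypergeometricSeries_radius_eq_one (𝔸 := ℂ) ((c : ℂ) + n) ((p : ℂ) + n)
    ((i : ℂ) + c + p + n) fun kn => ⟨hne c kn, hne p kn, by
      have := hne (i + c + p) kn
      push_cast at this
      exact this⟩
  have hD : herm b b ∈ Metric.eball (0 : ℂ)
      (ordinaryHypergeometricSeries ℂ ((c : ℂ) + n) ((p : ℂ) + n) ((i : ℂ) + c + p + n)).radius := by
    rw [hr, Metric.mem_eball, edist_zero_right, enorm_eq_nnnorm, ENNReal.coe_lt_one_iff,
      herm_self, ← NNReal.coe_lt_coe, coe_nnnorm, norm_pow, Complex.norm_real, norm_norm]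
    have := norm_nonneg b
    simp only [NNReal.coe_one]
    nlinarith
  have h := (FormalMultilinearSeries.hasSum _ hD).mul_left
    ((poch (-n) (i + c) * poch (-n) (i + p) * poch n c * poch n p) /
      ((i.factorial : ℂ) * (c.factorial : ℂ) * (p.factorial : ℂ) * poch n (i + c + p)) *
      herm z z ^ i * herm b z ^ c * herm z b ^ p)
  refine h.congr_fun fun q => ?_
  rw [ordinaryHypergeometricSeries_apply_eq, kernelTerm, poch_add n c, poch_add n p,
    poch_add n (i + c + p), smul_eq_mul]
  have e : ((n : ℂ) + ((i + c + p : ℕ) : ℂ)) = (i : ℂ) + c + p + n := by push_cast; ring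
  rw [add_comm (n : ℂ) c, add_comm (n : ℂ) p, e]
  simp only [poch]
  ring

/-- The weighted moments are finite sums of terms of the expansion. -/
theorem weighted_moment_eq (hn : 1 ≤ n) (z b : Cn n) {j l k m : ℕ} (hj : j ≤ n)
    (h : j + l = k + m) :
    poch (-n) j / j.factorial * (poch (-n) k / k.factorial) *
      (poch n l / l.factorial * (poch n m / m.factorial) * moment z b j l k m) =
    ∑ i ∈ Finset.range (n + 1), if i ≤ j ∧ i ≤ k ∧ j ≤ i + m then
      kernelTerm z b i (k - i) (j - i) (i + m - j) else 0 := by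
  have hf : ∀ a : ℕ, (a.factorial : ℂ) ≠ 0 := fun a => by exact_mod_cast a.factorial_ne_zero
  have h1 := choose_mul_moment hn z b h
  have hchoose : ((j + l).choose m : ℂ) = (j + l).factorial / (k.factorial * m.factorial) := by
    rw [h, ← Nat.choose_symm_add, Nat.cast_add_choose]
  have h2 : moment z b j l k m = (k.factorial * m.factorial) / poch n (j + l) *
      ∑ p ∈ Finset.range (m + 1), ((j.choose p : ℂ) * herm z z ^ (j - p) * herm z b ^ p) *
        ((l.choose (m - p) : ℂ) * herm b z ^ (l - (m - p)) * herm b b ^ (m - p)) := by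
    rw [hchoose] at h1
    have hN := hf (j + l)
    have hk := hf k
    have hm := hf m
    refine mul_left_cancel₀ (div_ne_zero hN (mul_ne_zero hk hm)) (h1.trans ?_)
    field_simp
  rw [h2, ← Finset.sum_filter]
  simp only [Finset.mul_sum]
  rw [← Finset.sum_filter_of_ne (p := fun p => p ≤ j ∧ m ≤ p + l) (fun p _ hp => by
    by_contra hcon
    apply hp
    rcases not_and_or.1 hcon with h3 | h3
    · rw [Nat.choose_eq_zero_of_lt (by omega : j < p)]; simp
    · rw [Nat.choose_eq_zero_of_lt (by omega : l < m - p)]; simp)]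
  refine Finset.sum_nbij' (fun p => j - p) (fun i => j - i) ?_ ?_ ?_ ?_ ?_
  · intro p hp
    simp only [Finset.mem_filter, Finset.mem_range] at hp ⊢
    omega
  · intro i hi
    simp only [Finset.mem_filter, Finset.mem_range] at hi ⊢
    omega
  · intro p hp
    simp only [Finset.mem_filter, Finset.mem_range] at hp
    omega
  · intro i hi
    simp only [Finset.mem_filter, Finset.mem_range] at hi
    omega
  · intro p hp
    simp only [Finset.mem_filter, Finset.mem_range] at hp
    obtain ⟨q, rfl⟩ := Nat.exists_eq_add_of_le (by omega : p ≤ m)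
    obtain ⟨i, rfl⟩ := Nat.exists_eq_add_of_le' hp.2.1
    obtain ⟨c, rfl⟩ := Nat.exists_eq_add_of_le' (by omega : q ≤ l)
    obtain rfl : k = i + c := by omega
    simp only [Nat.add_sub_cancel, Nat.add_sub_cancel_left, show i + (p + q) - (i + p) = q by omega]
    rw [← Nat.choose_symm_add (a := i), ← Nat.choose_symm_add (a := c), Nat.cast_add_choose,
      Nat.cast_add_choose, kernelTerm, show i + p + (c + q) = i + c + p + q by omega]
    have f1 := hf i
    have f2 := hf c
    have f3 := hf p
    have f4 := hf q
    have f5 := hf (i + p)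
    have f6 := hf (c + q)
    have f7 := hf (i + c)
    have f8 := hf (p + q)
    have f9 := poch_natCast_ne_zero hn (i + c + p + q)
    field_simp

/-- Summation over the degrees `x = (l, m)` in `⟨b, ζ⟩` and `⟨ζ, b⟩`: those with `j + l = k + m` are
parametrized by `q ↦ (k - i + q, j - i + q)`, `q` being the exponent of `⟨b, b⟩`. -/
theorem hasSum_kernelTerm_pairs (hn : 1 ≤ n) (z : Cn n) {b : Cn n} (hb : ‖b‖ < 1) (i j k : ℕ) :
    HasSum (fun x : ℕ × ℕ => if j + x.1 = k + x.2 then (if i ≤ j ∧ i ≤ k ∧ j ≤ i + x.2 then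
      kernelTerm z b i (k - i) (j - i) (i + x.2 - j) else 0) else 0)
      (if i ≤ j ∧ i ≤ k then kernelSum z b i (k - i) (j - i) else 0) := by
  split_ifs with hij
  · have hinj : Function.Injective fun q : ℕ => ((k - i + q, j - i + q) : ℕ × ℕ) := by
      intro q q' h
      have := congrArg Prod.fst h
      simp only at this
      omega
    rw [← hinj.hasSum_iff]
    · refine (hasSum_kernelTerm hn z hb i (k - i) (j - i)).congr_fun fun q => ?_
      simp only [Function.comp_apply]
      rw [if_pos (by omega), if_pos (by omega), show i + (j - i + q) - j = q by omega]
    · rintro ⟨l, m⟩ hx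
      simp only
      split_ifs with h1 h2
      · exact absurd ⟨i + m - j, Prod.ext (by simp only; omega) (by simp only; omega)⟩ hx
      · rfl
      · rfl
  · refine hasSum_zero.congr_fun fun x => ?_
    split_ifs with h1 h2
    · exact absurd ⟨h2.1, h2.2.1⟩ hij
    · rfl
    · rfl

theorem sum_range_shift {i N : ℕ} (hi : i ≤ N) (f : ℕ → ℂ) :
    ∑ j ∈ Finset.range (N + 1), (if i ≤ j then f (j - i) else 0) =
      ∑ p ∈ Finset.range (N - i + 1), f p := by
  rw [← Finset.sum_filter]
  refine Finset.sum_nbij' (fun j => j - i) (fun p => p + i) ?_ ?_ ?_ ?_ ?_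
  · intro j hj
    simp only [Finset.mem_filter, Finset.mem_range] at hj ⊢
    omega
  · intro p hp
    simp only [Finset.mem_filter, Finset.mem_range] at hp ⊢
    omega
  · intro j hj
    simp only [Finset.mem_filter, Finset.mem_range] at hj
    omega
  · intro p _
    omega
  · intro j _
    rfl

/-- The part of the integral in `szego_eq_integral` that is of degree `j` in `z` and `k` in its
conjugate. -/
theorem integral_bidegree_eq (hn : 1 ≤ n) (z : Cn n) {b : Cn n} (hb : b ∈ unitBall n) {j : ℕ}
    (hj : j ≤ n) (k : ℕ) :
    poch (-n) j / j.factorial * (poch (-n) k / k.factorial) *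
      (massInv n * ∫ ζ : unitSphere n, herm z ζ ^ j * herm ζ z ^ k *
        (((1 - herm b ζ) ^ n)⁻¹ * ((1 - herm ζ b) ^ n)⁻¹) ∂(sigma n)) =
    ∑ i ∈ Finset.range (n + 1), if i ≤ j ∧ i ≤ k then kernelSum z b i (k - i) (j - i) else 0 := by
  have hb' := norm_lt_one_of_mem hb
  have hu : ‖hermMap n b‖ < 1 := (norm_hermMap_le b).trans_lt hb'
  have hv : ‖hermMapBar n b‖ < 1 := (norm_hermMapBar_le b).trans_lt hb'
  have s1 := summable_norm_poch_smul_pow hn hu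
  have s2 := summable_norm_poch_smul_pow hn hv
  have h1 := (summable_mul_of_summable_norm s1 s2).hasSum
  rw [← tsum_mul_tsum_of_summable_norm s1 s2, (hasSum_poch_smul_pow hn hu).tsum_eq,
    (hasSum_poch_smul_pow hn hv).tsum_eq] at h1
  let F : C(unitSphere n, ℂ) := ⟨fun ζ => herm z ζ ^ j * herm ζ z ^ k, by fun_prop⟩
  set L := integralCLM (integrable_of_continuous (n := n) F.continuous)
  have h2 := ((h1.mapL L).mul_left (massInv n : ℂ)).mul_left
    (poch (-n) j / j.factorial * (poch (-n) k / k.factorial))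
  have e1 : L (Ring.inverse (1 - hermMap n b) ^ n * Ring.inverse (1 - hermMapBar n b) ^ n) =
      ∫ ζ : unitSphere n, herm z ζ ^ j * herm ζ z ^ k *
        (((1 - herm b ζ) ^ n)⁻¹ * ((1 - herm ζ b) ^ n)⁻¹) ∂(sigma n) := by
    simp only [L, integralCLM_apply]
    refine integral_congr_ae (Eventually.of_forall fun ζ => ?_)
    simp only [ContinuousMap.mul_apply, ContinuousMap.pow_apply,
      ContinuousMap.ringInverse_apply (isUnit_one_sub_of_norm_lt hu),
      ContinuousMap.ringInverse_apply (isUnit_one_sub_of_norm_lt hv)]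
    simp [F]
  rw [e1] at h2
  refine h2.unique ?_
  refine (hasSum_sum fun i (_ : i ∈ Finset.range (n + 1)) =>
    hasSum_kernelTerm_pairs hn z hb' i j k).congr_fun fun x => ?_
  obtain ⟨l, m⟩ := x
  have e2 : (massInv n : ℂ) * L ((poch n l / l.factorial) • hermMap n b ^ l *
      (poch n m / m.factorial) • hermMapBar n b ^ m) =
      poch n l / l.factorial * (poch n m / m.factorial) * moment z b j l k m := by
    rw [smul_mul_smul_comm, map_smul, smul_eq_mul, moment, mul_left_comm]
    congr 2
    simp only [L, integralCLM_apply]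
    refine integral_congr_ae (Eventually.of_forall fun ζ => ?_)
    simp only [F, ContinuousMap.coe_mk, ContinuousMap.mul_apply, ContinuousMap.pow_apply,
      hermMap_apply, hermMapBar_apply]
    ring
  simp only [e2]
  by_cases h : j + l = k + m
  · simp only [h, if_true]
    exact weighted_moment_eq hn z b hj h
  · simp only [h, if_false, Finset.sum_const_zero]
    rw [moment_eq_zero z b h]; ring

theorem integral_eq_sum_kernelSum (hn : 1 ≤ n) (z : Cn n) {b : Cn n} (hb : b ∈ unitBall n) :
    massInv n * ∫ ζ : unitSphere n, ((1 - herm z ζ) ^ n * (1 - herm ζ z) ^ n) *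
        (((1 - herm b ζ) ^ n)⁻¹ * ((1 - herm ζ b) ^ n)⁻¹) ∂(sigma n) =
      ∑ i ∈ Finset.range (n + 1), ∑ c ∈ Finset.range (n - i + 1), ∑ p ∈ Finset.range (n - i + 1),
        kernelSum z b i c p := by
  have hb' := norm_lt_one_of_mem hb
  have hint : ∀ j k : ℕ, Integrable (fun ζ : unitSphere n => herm z ζ ^ j * herm ζ z ^ k *
      (((1 - herm b ζ) ^ n)⁻¹ * ((1 - herm ζ b) ^ n)⁻¹)) (sigma n) := by
    intro j k
    refine integrable_of_continuous (Continuous.mul (by fun_prop) (Continuous.mul ?_ ?_))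
    · exact Continuous.inv₀ (by fun_prop) fun ζ =>
        pow_ne_zero n (one_sub_herm_ne_zero hb' (norm_sphere ζ).le)
    · exact Continuous.inv₀ (by fun_prop) fun ζ =>
        pow_ne_zero n (one_sub_herm_ne_zero' hb' (norm_sphere ζ).le)
  have h1 : ∀ ζ : unitSphere n, ((1 - herm z ζ) ^ n * (1 - herm ζ z) ^ n) *
        (((1 - herm b ζ) ^ n)⁻¹ * ((1 - herm ζ b) ^ n)⁻¹) =
      ∑ j ∈ Finset.range (n + 1), ∑ k ∈ Finset.range (n + 1),
        poch (-n) j / j.factorial * (poch (-n) k / k.factorial) *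
        (herm z ζ ^ j * herm ζ z ^ k * (((1 - herm b ζ) ^ n)⁻¹ * ((1 - herm ζ b) ^ n)⁻¹)) := by
    intro ζ
    rw [one_sub_pow_eq_sum, one_sub_pow_eq_sum, Finset.sum_mul_sum, Finset.sum_mul]
    refine Finset.sum_congr rfl fun j _ => ?_
    rw [Finset.sum_mul]
    refine Finset.sum_congr rfl fun k _ => ?_
    ring
  simp only [h1]
  rw [integral_finsetSum _ fun j _ => integrable_finsetSum _ fun k _ => (hint j k).const_mul _]
  simp only [integral_finsetSum _ fun k _ => (hint _ k).const_mul _, integral_const_mul,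
    Finset.mul_sum]
  calc _ = ∑ j ∈ Finset.range (n + 1), ∑ k ∈ Finset.range (n + 1), ∑ i ∈ Finset.range (n + 1),
        if i ≤ j ∧ i ≤ k then kernelSum z b i (k - i) (j - i) else 0 := by
        refine Finset.sum_congr rfl fun j hj => Finset.sum_congr rfl fun k _ => ?_
        rw [mul_left_comm, integral_bidegree_eq hn z hb
          (Nat.lt_succ_iff.1 (Finset.mem_range.1 hj))]
    _ = ∑ j ∈ Finset.range (n + 1), ∑ i ∈ Finset.range (n + 1), ∑ k ∈ Finset.range (n + 1),
        if i ≤ j ∧ i ≤ k then kernelSum z b i (k - i) (j - i) else 0 :=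
        Finset.sum_congr rfl fun j _ => Finset.sum_comm
    _ = ∑ i ∈ Finset.range (n + 1), ∑ j ∈ Finset.range (n + 1), ∑ k ∈ Finset.range (n + 1),
        if i ≤ j ∧ i ≤ k then kernelSum z b i (k - i) (j - i) else 0 := Finset.sum_comm
    _ = _ := by
        refine Finset.sum_congr rfl fun i hi => ?_
        have hi' := Nat.lt_succ_iff.1 (Finset.mem_range.1 hi)
        rw [Finset.sum_comm, ← sum_range_shift hi']
        refine Finset.sum_congr rfl fun k _ => ?_
        by_cases hk : i ≤ k
        · simp only [hk, and_true, if_true]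
          exact sum_range_shift hi' fun p => kernelSum z b i (k - i) p
        · simp [hk]

end MHarmonic
end

/-- For every `n ≥ 1` the `M`-harmonic Szegő kernel of the unit ball of `ℂⁿ` exists, and it is given
by a finite sum of Gauss hypergeometric functions (whence it is unique on `𝔹ⁿ × 𝔹ⁿ`). -/
theorem theorem3p4 (n : ℕ) (hn : 1 ≤ n) :
    (∃ K : MHarmonic.Cn n → MHarmonic.Cn n → ℂ, MHarmonic.IsSzegoKernel K) ∧
    ∀ K : MHarmonic.Cn n → MHarmonic.Cn n → ℂ, MHarmonic.IsSzegoKernel K →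
      ∀ z ∈ MHarmonic.unitBall n, ∀ w ∈ MHarmonic.unitBall n,
        let t₁ : ℂ := (‖z‖ : ℂ) ^ 2
        let t₂ : ℂ := ((‖z‖ : ℂ) ^ 2 - MHarmonic.herm w z) / (1 - MHarmonic.herm w z)
        let t₃ : ℂ := (starRingEnd ℂ) t₂
        let t₄ : ℂ := 1 - (1 - (‖z‖ : ℂ) ^ 2) * (1 - (‖w‖ : ℂ) ^ 2) /
          (‖1 - MHarmonic.herm z w‖ : ℂ) ^ 2
        K z w =
          Complex.Gamma n / (2 * (Real.pi : ℂ) ^ n) *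
            ((1 - (‖w‖ : ℂ) ^ 2) ^ n / (‖1 - MHarmonic.herm z w‖ : ℂ) ^ (2 * n)) *
            ∑ i₁ ∈ Finset.range (n + 1),
              ∑ i₂ ∈ Finset.range (n - i₁ + 1), ∑ j₁ ∈ Finset.range (n - i₁ + 1),
                (MHarmonic.poch (-n) (i₁ + i₂) * MHarmonic.poch (-n) (i₁ + j₁) *
                    MHarmonic.poch n i₂ * MHarmonic.poch n j₁) /
                  ((i₁.factorial : ℂ) * (i₂.factorial : ℂ) * (j₁.factorial : ℂ) *
                    MHarmonic.poch n (i₁ + i₂ + j₁)) *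
                t₁ ^ i₁ * t₂ ^ i₂ * t₃ ^ j₁ *
                ₂F₁ ((i₂ : ℂ) + n) ((j₁ : ℂ) + n) ((i₁ : ℂ) + i₂ + j₁ + n) t₄ := by
  refine ⟨⟨_, MHarmonic.isSzegoKernel_szego hn⟩, fun K hK z hz w hw => ?_⟩
  intro t₁ t₂ t₃ t₄
  have hz' := MHarmonic.norm_lt_one_of_mem hz
  have hw' := MHarmonic.norm_lt_one_of_mem hw
  have hb := MHarmonic.norm_moebius_lt_one hz' hw'
  set b := MHarmonic.moebius z w
  have e₁ : t₁ = MHarmonic.herm z z := (MHarmonic.herm_self z).symm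
  have e₂ : t₂ = MHarmonic.herm b z := by
    have h := MHarmonic.one_sub_herm_moebius_self hz' hw'.le
    have h0 := MHarmonic.one_sub_herm_ne_zero' hz' hw'.le
    rw [MHarmonic.herm_self] at h
    simp only [t₂]
    rw [div_eq_iff h0]
    field_simp at h
    linear_combination h
  have e₃ : t₃ = MHarmonic.herm z b := by simp only [t₃, e₂, MHarmonic.conj_herm]
  have e₄ : t₄ = MHarmonic.herm b b := by
    have h := congrArg (fun x : ℝ => (x : ℂ)) (MHarmonic.one_sub_normSq_moebius hz' hw'.le)
    push_cast at h
    rw [MHarmonic.herm_self]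
    simp only [t₄]
    linear_combination h
  have hΓ : Complex.Gamma n / (2 * (Real.pi : ℂ) ^ n) = (MHarmonic.massInv n : ℂ) := by
    rw [MHarmonic.massInv]
    push_cast
    rw [← Complex.Gamma_ofReal]
    simp
  rw [hK.eq_szego hn hz hw, MHarmonic.szego_eq_integral hn hz hw,
    MHarmonic.integral_eq_sum_kernelSum hn z (by simpa using hb), hΓ, e₁, e₂, e₃, e₄]
  rfl
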